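/- **Theorem (Normalized STORM under BG-0 noise).** Setting. Let $f:\mathbb R^d\to\mathbb R$ be differentiable with $f^{\inf}:=\inf f>-\infty$, let $x^0\in\mathbb R^d$, $\Delta:=f(x^0)-f^{\inf}$, and let $\nabla f(x;\xi)$ be a (jointly measurable) stochastic gradient oracle that is unbiased, $\mathbb E_\xi[\nabla f(x;\xi)]=\nabla f(x)$, and satisfies the BG-0 condition $\mathbb E_\xi\|\nabla f(x;\xi)-\nabla f(x)\|^2\le B^2\|x-x^0\|^2+G^2$ for all $x$, with constants $B,G\ge 0$. Given a horizon $K\ge 0$, put $T:=K+1$. Normalized STORM with batch $N_{\rm init}\ge1$, stepsize $\gamma>0$ and parameter $\eta\in(0,1]$ starts from $v^0=\frac1{N_{\rm init}}\sum_{i=1}^{N_{\rm init}}\nabla f(x^0;\xi_i^{\rm init})$ and performs, for $k=0,\dots,K$, $$x^{k+1}=x^k-\gamma\frac{v^k}{\|v^k\|},\qquad v^{k+1}=\nabla f(x^{k+1};\xi^{k+1})+(1-\eta)\bigl(v^k-\nabla f(x^k;\xi^{k+1})\bigr),$$ where $v/\|v\|:=0$ if $v=0$ and all samples are independent copies of $\xi$.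 The output $\widehat x$ is uniform on $\{x^0,\dots,x^K\}$, independently of the samples. The SFO cost is the number of stochastic gradient evaluations, $N_{\rm init}+2T$. Smoothness conditions. *Mean-square smoothness* with constant $L>0$: $\mathbb E_\xi\|\nabla f(y;\xi)-\nabla f(x;\xi)\|^2\le L^2\|y-x\|^2$ for all $x,y$. *Expected $\alpha$-symmetric generalized smoothness* with constants $L_0,L_1>0$: for all $x,y$, with $x_\theta:=\theta y+(1-\theta)x$, $$\mathbb E_\xi\|\nabla f(y;\xi)-\nabla f(x;\xi)\|^2\le\|y-x\|^2\,\mathbb E_\xi\Bigl[\bigl(L_0+L_1\max_{\theta\in[0,1]}\|\nabla f(x_\theta;\xi)\|^\alpha\bigr)^2\Bigr],$$ where, for all $x,y$, $\theta\mapsto\nabla f(x_\theta;\xi)$ is almost surely continuous on $[0,1]$ and the expectation on the right is finite. (i) Suppose mean-square smoothness holds with constant $L>0$. Let $\gamma_0>0$, $N_{\rm init}=\max\{1,\lceil G^2T^{1/2}\rceil\}$, $\eta=T^{-1}$, $\gamma=\gamma_0T^{-3/4}$. Then $$\mathbb E\|\nabla f(\widehat x)\|\le\Bigl(\frac{\Delta}{\gamma_0}+2(1+L\gamma_0+B\gamma_0)\Bigr)T^{-1/4}+2GT^{-1/2}+\frac{L\gamma_0}{2}T^{-3/4}.$$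 Consequently $\mathbb E\|\nabla f(\widehat x)\|=O(T^{-1/4})$, and $\mathbb E\|\nabla f(\widehat x)\|\le\varepsilon$ is reached with $O(\varepsilon^{-4})$ SFO calls. (ii) Suppose expected $\alpha$-symmetric generalized smoothness holds with $\alpha\in(0,1)$ and $L_0,L_1>0$. Let $K_0=2^{\frac{2-\alpha}{1-\alpha}}L_0$, $K_1=2^{\frac{2-\alpha}{1-\alpha}}L_1$, $K_2=(5L_1)^{\frac1{1-\alpha}}$, $N_{\rm init}=\max\{1,\lceil G^2T^{\frac{2(1-\alpha)}{4+\alpha}}\rceil\}$, $\gamma=\gamma_0T^{-\frac{3+\alpha}{4+\alpha}}$, $\eta=\eta_0T^{-\frac4{4+\alpha}}$, where $\eta_0\in(0,1]$, $\gamma_0>0$, $\lambda_0>0$ satisfy $2^{\frac\alpha2}K_1\lambda_0\gamma_0\le1$ and $2^{\frac{6+\alpha}2}K_1\lambda_0\frac{\gamma_0}{\eta_0}\le1$. Then $$\begin{aligned}\mathbb E\|\nabla f(\widehat x)\|\le{}&\Bigl[\tfrac{4\Delta}{\gamma_0}+\tfrac8{\eta_0}+\tfrac{8(1-\alpha)\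alpha^{\frac\alpha{1-\alpha}}2^{\alpha/2}K_1\gamma_0\lambda_0^{-\frac\alpha{1-\alpha}}}{\sqrt{\eta_0}}+\tfrac{8\cdot2^{\alpha/2}K_1B^\alpha\gamma_0^{1+\alpha}}{\sqrt{\eta_0}}+8\sqrt{\eta_0}B\gamma_0\Bigr]T^{-\frac1{4+\alpha}}\\&+\Bigl[\tfrac{8K_0\gamma_0}{\sqrt{\eta_0}}+\tfrac{8\cdot2^{\alpha/2}K_1G^\alpha\gamma_0}{\sqrt{\eta_0}}\Bigr]T^{-\frac{1+\alpha}{4+\alpha}}+8\sqrt{\eta_0}GT^{-\frac2{4+\alpha}}+\tfrac{8K_2\gamma_0^{\frac1{1-\alpha}}}{\sqrt{\eta_0}}T^{-\frac{1+3\alpha}{(1-\alpha)(4+\alpha)}}\\&+2K_0\gamma_0T^{-\frac{3+\alpha}{4+\alpha}}+2(1-\alpha)\alpha^{\frac\alpha{1-\alpha}}2^{\alpha/2}K_1\gamma_0\lambda_0^{-\frac\alpha{1-\alpha}}T^{-\frac3{4+\alpha}}+4K_2\gamma_0^{\frac1{1-\alpha}}T^{-\frac{3+\alpha}{(1-\alpha)(4+\alpha)}}\\&+2^{1+\alpha/2}K_1G^\alpha\gamma_0T^{-\frac{3+\alpha}{4+\alpha}}+2^{1+\alpha/2}K_1B^\alpha\gamma_0^{1+\alpha}T^{-\frac3{4+\alpha}}.\end{aligned}$$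 Every decay exponent on the right is at least $\frac1{4+\alpha}$. Consequently $\mathbb E\|\nabla f(\widehat x)\|=O(T^{-1/(4+\alpha)})$, and $\mathbb E\|\nabla f(\widehat x)\|\le\varepsilon$ is reached with $O(\varepsilon^{-(4+\alpha)})$ SFO calls. (iii) Suppose expected $1$-symmetric generalized smoothness holds with $L_0,L_1>0$. Let $N_{\rm init}=1$, $\eta=T^{-4/5}$, $\gamma=\gamma_0T^{-4/5}$ with $0<\gamma_0\le\frac1{16\sqrt{2e^{3/4}}L_1}$. Then $b_0:=\mathbb E\|v^0-\nabla f(x^0)\|\le G$ and $$\begin{aligned}\mathbb E\|\nabla f(\widehat x)\|\le{}&\Bigl(\tfrac{4\Delta}{\gamma_0}+8b_0+8B\gamma_0+16\sqrt{2e^{3/4}}L_1B\gamma_0^2\Bigr)T^{-1/5}+\Bigl(8\sqrt{2e^{3/4}}\gamma_0(L_0+2L_1G)+8G\Bigr)T^{-2/5}\\&+8\sqrt2L_1B\gamma_0^2T^{-3/5}+\bigl(4\sqrt2L_0\gamma_0+8\sqrt2L_1G\gamma_0\bigr)T^{-4/5}.\end{aligned}$$ Consequently $\mathbb E\|\nabla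 f(\widehat x)\|=O(T^{-1/5})$, and $\mathbb E\|\nabla f(\widehat x)\|\le\varepsilon$ is reached with $O(\varepsilon^{-5})$ SFO calls. In the $O(\cdot)$ statements, which are for all $T\ge1$ and all $\varepsilon\in(0,1]$, the constants depend only on the parameters $\Delta,B,G,\gamma_0$ and, respectively, $L$; $\alpha,L_0,L_1,\eta_0,\lambda_0$; $L_0,L_1$ (and not on $d$, $f$ or the oracle). -/

import Mathlib

open MeasureTheory ProbabilityTheory

universe u v

noncomputable section

/-- A stochastic optimization problem on `ℝ^d` satisfying the two standing assumptions:
the objective `f` is (differentiable and) bounded below, and the stochastic gradient oracle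
`g x ξ` (written `∇f(x;ξ)` in the literature), where `ξ` is distributed according to `law`,
is unbiased with variance at `x` at most `B² ‖x - x⁰‖² + G²`. -/
structure BG0Problem (d : ℕ) (Ξ : Type u) [MeasurableSpace Ξ] (B G : ℝ) where
  /-- the distribution of one oracle sample -/
  law : Measure Ξ
  isProb : IsProbabilityMeasure law
  /-- the objective -/
  f : EuclideanSpace ℝ (Fin d) → ℝ
  /-- the stochastic gradient oracle -/
  g : EuclideanSpace ℝ (Fin d) → Ξ → EuclideanSpace ℝ (Fin d)
  /-- the initial point -/
  x0 : EuclideanSpace ℝ (Fin d)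
  differentiable : Differentiable ℝ f
  bddBelow : BddBelow (Set.range f)
  measurable : Measurable (Function.uncurry g)
  memLp : ∀ x, MemLp (g x) 2 law
  unbiased : ∀ x, ∫ ξ, g x ξ ∂law = gradient f x
  variance : ∀ x, ∫ ξ, ‖g x ξ - gradient f x‖ ^ 2 ∂law ≤ B ^ 2 * ‖x - x0‖ ^ 2 + G ^ 2

namespace BG0Problem

variable {d : ℕ} {Ξ : Type u} [MeasurableSpace Ξ] {B G : ℝ}

/-- The initial suboptimality gap `f(x⁰) - inf f`. -/
def gap (Q : BG0Problem d Ξ B G) : ℝ := Q.f Q.x0 - ⨅ x, Q.f x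

/-- Mean-square smoothness with constant `L`. -/
def MeanSquareSmooth (Q : BG0Problem d Ξ B G) (L : ℝ) : Prop :=
  ∀ x y, ∫ ξ, ‖Q.g y ξ - Q.g x ξ‖ ^ 2 ∂Q.law ≤ L ^ 2 * ‖y - x‖ ^ 2

/-- `max_{θ ∈ [0,1]} ‖g(x_θ; ξ)‖ ^ α` with `x_θ = θ y + (1 - θ) x`. -/
def segmentMax (Q : BG0Problem d Ξ B G) (α : ℝ) (x y : EuclideanSpace ℝ (Fin d)) (ξ : Ξ) : ℝ :=
  ⨆ θ : Set.Icc (0 : ℝ) 1, ‖Q.g ((θ : ℝ) • y + (1 - (θ : ℝ)) • x) ξ‖ ^ α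

/-- Expected `α`-symmetric generalized smoothness with constants `L₀`, `L₁`. The first two
fields say that the right-hand side of the third is meaningful: almost surely the sample
gradient is continuous along the segment (so that the maximum is attained), and the
expectation is finite. -/
structure ExpectedSymSmooth (Q : BG0Problem d Ξ B G) (α L₀ L₁ : ℝ) : Prop where
  continuousOn_segment : ∀ x y, ∀ᵐ ξ ∂Q.law,
    ContinuousOn (fun θ : ℝ => Q.g (θ • y + (1 - θ) • x) ξ) (Set.Icc 0 1)
  integrable : ∀ x y, Integrable (fun ξ => (L₀ + L₁ * Q.segmentMax α x y ξ) ^ 2) Q.law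
  bound : ∀ x y, ∫ ξ, ‖Q.g y ξ - Q.g x ξ‖ ^ 2 ∂Q.law ≤
    ‖y - x‖ ^ 2 * ∫ ξ, (L₀ + L₁ * Q.segmentMax α x y ξ) ^ 2 ∂Q.law

end BG0Problem

/-- State of normalized STORM: the iterate `x`, the gradient estimator `v`, and the number of
stochastic gradient evaluations made so far. -/
structure NSTORMState (E : Type*) where
  x : E
  v : E
  calls : ℕ

/-- The normalized STORM recursion with oracle `g`, start `x0`, stepsize `γ`, parameter `η`,
initial samples `s₀ i` and fresh samples `s k` (the sample `ξ^{k+1}` of the transition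
`k → k + 1`). The initialization evaluates `N` stochastic gradients and every transition two.
A zero estimator gives a zero direction, since `0⁻¹ = 0`. -/
def nstorm {E Ξ : Type*} [NormedAddCommGroup E] [NormedSpace ℝ E] (g : E → Ξ → E) (x0 : E)
    (γ η : ℝ) {N : ℕ} (s₀ : Fin N → Ξ) (s : ℕ → Ξ) : ℕ → NSTORMState E
  | 0 => ⟨x0, (N : ℝ)⁻¹ • ∑ i, g x0 (s₀ i), N⟩
  | k + 1 =>
    let p := nstorm g x0 γ η s₀ s k
    let x' := p.x - γ • (‖p.v‖⁻¹ • p.v)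
    ⟨x', g x' (s k) + (1 - η) • (p.v - g p.x (s k)), p.calls + 2⟩

/-- The randomness of a run of normalized STORM with horizon `K` and initialization batch size
`N`: i.i.d. oracle samples (`N` initial ones and one per transition) and an output index that
is uniform on `{0, …, K}` and independent of the samples. -/
structure NSTORMRun {d : ℕ} {Ξ : Type u} [MeasurableSpace Ξ] {B G : ℝ} (Q : BG0Problem d Ξ B G)
    (N K : ℕ) (Ω : Type v) [MeasurableSpace Ω] where
  /-- the underlying probability measure -/
  P : Measure Ω
  isProb : IsProbabilityMeasure P
  /-- the initial samples -/
  s₀ : Fin N → Ω → Ξ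
  /-- the fresh samples of the transitions -/
  s : ℕ → Ω → Ξ
  /-- the index of the output iterate -/
  κ : Ω → Fin (K + 1)
  measurable_s₀ : ∀ i, Measurable (s₀ i)
  measurable_s : ∀ k, Measurable (s k)
  measurable_κ : Measurable κ
  map_s₀ : ∀ i, P.map (s₀ i) = Q.law
  map_s : ∀ k, P.map (s k) = Q.law
  iIndepFun_samples : iIndepFun (Sum.elim s₀ s) P
  uniform_κ : ∀ j, P (κ ⁻¹' {j}) = ((K : ENNReal) + 1)⁻¹
  indepFun_κ : IndepFun κ (fun ω => (fun i => s₀ i ω, fun k => s k ω)) P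

namespace NSTORMRun

variable {d : ℕ} {Ξ : Type u} [MeasurableSpace Ξ] {B G : ℝ} {Q : BG0Problem d Ξ B G}
  {N K : ℕ} {Ω : Type v} [MeasurableSpace Ω]

/-- The state after `k` transitions. -/
def state (R : NSTORMRun Q N K Ω) (γ η : ℝ) (k : ℕ) (ω : Ω) :
    NSTORMState (EuclideanSpace ℝ (Fin d)) :=
  nstorm Q.g Q.x0 γ η (fun i => R.s₀ i ω) (fun k => R.s k ω) k

/-- The output `x̂`, uniform over `x⁰, …, x^K`. -/
def output (R : NSTORMRun Q N K Ω) (γ η : ℝ) (ω : Ω) : EuclideanSpace ℝ (Fin d) :=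
  (R.state γ η (R.κ ω) ω).x

/-- `‖∇f(x̂)‖`. -/
def gradNorm (R : NSTORMRun Q N K Ω) (γ η : ℝ) (ω : Ω) : ℝ :=
  ‖gradient Q.f (R.output γ η ω)‖

/-- `E‖∇f(x̂)‖`. -/
def meanGradNorm (R : NSTORMRun Q N K Ω) (γ η : ℝ) : ℝ := ∫ ω, R.gradNorm γ η ω ∂(R.P)

/-- The initial error `E‖v⁰ - ∇f(x⁰)‖`. -/
def initError (R : NSTORMRun Q N K Ω) (γ η : ℝ) : ℝ :=
  ∫ ω, ‖(R.state γ η 0 ω).v - gradient Q.f Q.x0‖ ∂(R.P)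

/-- The number of stochastic gradient evaluations of the whole run, that is, of the
initialization and the `K + 1` transitions `k = 0, …, K`. -/
def totalCalls (R : NSTORMRun Q N K Ω) (γ η : ℝ) (ω : Ω) : ℕ := (R.state γ η (K + 1) ω).calls

end NSTORMRun

/-- The initialization batch size `max {1, ⌈G² (K+1)^r⌉}`. -/
def initBatch (G r : ℝ) (K : ℕ) : ℕ := max 1 ⌈G ^ 2 * ((K : ℝ) + 1) ^ r⌉₊

/-- The schedule `c (K+1)^(-r)`. -/
def powerSchedule (c r : ℝ) (K : ℕ) : ℝ := c * ((K : ℝ) + 1) ^ (-r)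

end

/-! All three regimes follow from one estimate, `NSTORMRun.meanGradNorm_bound`, fed with different
local smoothness constants.

Normalization makes every step at most `γ` long, so a run of `T = K + 1` steps stays within distance
`Tγ` of `x⁰`, surely. This turns the growing variance bound into the uniform noise level `B T γ +
G`. It also bounds the gradients along the run deterministically, so integrability needs no moment
assumption on the iterates. If a step `h` from `x` changes the oracle by at most `‖h‖ (A + M
‖∇f(x)‖)` in `L²`, descent along the normalized direction loses only `2γ ‖v - ∇f‖` and a
second-order term, and telescoping bounds the average gradient by the average estimator error.

The error contracts by `1 - η` and receives a conditionally centred increment of conditional `L²`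
norm at most `c + m ‖∇f(x^k)‖`, with `c = γA + η(B T γ + G)` and `m = γM`. Treating the whole
increment by orthogonality would produce second moments of the gradient, while the triangle
inequality alone would cost `c / η` instead of `c / √η`. The increment is therefore multiplied by `p
= c / (c + m ‖∇f‖)` and `1 - p`. The weight is known before the fresh sample is drawn, so centring
survives. The first part is at most `c` and sums orthogonally to `c / √η`; the second is summed in
`L¹` and gives `(m / η) ∑ E‖∇f‖`, which is absorbed on the left.

For symmetric smoothness the difficulty is a maximum over the segment inside the expectation. On
shrinking subsegments it tends to its value at the left endpoint, so the right slopes of `θ ↦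
‖g(x_θ) - g(x)‖_{L²}` are controlled by `‖g(x_θ)‖_{L²}^α` (dominated convergence and Jensen).
Integrating gives the self-bounding inequality of `exists_lpNorm_sub_le`. Solving it, with Young's
inequality to linearize `‖∇f‖^α` when `α < 1`, yields `A` and `M`; the schedules balance the
remaining terms. -/

open Filter Topology

/-! ### Second moments and a descent inequality -/

theorem lpNorm_two_sq {α E : Type*} [MeasurableSpace α] [NormedAddCommGroup E] {μ : Measure α}
    {f : α → E} (hf : AEStronglyMeasurable f μ) :
    lpNorm f 2 μ ^ 2 = ∫ a, ‖f a‖ ^ 2 ∂μ := by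
  rw [lpNorm_eq_integral_norm_rpow_toReal (by norm_num) (by norm_num) hf]
  simp only [ENNReal.toReal_ofNat, Real.rpow_ofNat]
  rw [← Real.rpow_natCast, ← Real.rpow_mul (integral_nonneg fun _ => by positivity)]
  norm_num

theorem integral_norm_le_lpNorm_two {α E : Type*} [MeasurableSpace α] [NormedAddCommGroup E]
    {μ : Measure α} [IsProbabilityMeasure μ] {f : α → E} (hf : MemLp f 2 μ) :
    ∫ a, ‖f a‖ ∂μ ≤ lpNorm f 2 μ := by
  rw [← lpNorm_one_eq_integral_norm hf.1, ← toReal_eLpNorm hf.1, ← toReal_eLpNorm hf.1]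
  exact ENNReal.toReal_mono hf.2.ne
    (eLpNorm_le_eLpNorm_of_exponent_le (by norm_num) hf.1)

theorem norm_integral_le_lpNorm_two {α E : Type*} [MeasurableSpace α] [NormedAddCommGroup E]
    [NormedSpace ℝ E]
    {μ : Measure α} [IsProbabilityMeasure μ] {f : α → E} (hf : MemLp f 2 μ) :
    ‖∫ a, f a ∂μ‖ ≤ lpNorm f 2 μ :=
  (norm_integral_le_integral_norm f).trans (integral_norm_le_lpNorm_two hf)

theorem lpNorm_two_sq_eq_variance_add {α E : Type*} [MeasurableSpace α] [NormedAddCommGroup E]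
    [InnerProductSpace ℝ E] [CompleteSpace E]
    {μ : Measure α} [IsProbabilityMeasure μ] {f : α → E} (hf : MemLp f 2 μ) :
    lpNorm f 2 μ ^ 2 = lpNorm (fun a => f a - ∫ b, f b ∂μ) 2 μ ^ 2 + ‖∫ b, f b ∂μ‖ ^ 2 := by
  set m := ∫ b, f b ∂μ with hm
  have hfm : MemLp (fun a => f a - m) 2 μ := hf.sub (memLp_const m)
  have hint : Integrable f μ := hf.integrable (by norm_num)
  rw [lpNorm_two_sq hf.1, lpNorm_two_sq hfm.1]
  have h : ∀ a, ‖f a‖ ^ 2 = ‖f a - m‖ ^ 2 + (2 * inner ℝ m (f a - m) + ‖m‖ ^ 2) := fun a => by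
    have := norm_add_sq_real (f a - m) m
    rw [sub_add_cancel, real_inner_comm] at this
    linarith
  have h0 : ∫ a, inner ℝ m (f a - m) ∂μ = 0 := by
    have hfi : Integrable (fun a => f a - m) μ := hint.sub (integrable_const m)
    rw [integral_inner hfi, integral_sub hint (integrable_const m)]
    simp [hm]
  have hi : Integrable (fun a => inner ℝ m (f a - m)) μ :=
    (hint.sub (integrable_const m)).const_inner m
  simp_rw [h]
  have hi2 : Integrable (fun a => 2 * inner ℝ m (f a - m) + ‖m‖ ^ 2) μ :=
    (hi.const_mul 2).add (integrable_const _)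
  rw [integral_add hfm.norm.integrable_sq hi2, integral_add (hi.const_mul 2) (integrable_const _), integral_const_mul, h0]
  simp

theorem lpNorm_two_sub_mean_le {α E : Type*} [MeasurableSpace α] [NormedAddCommGroup E]
    [InnerProductSpace ℝ E] [CompleteSpace E]
    {μ : Measure α} [IsProbabilityMeasure μ] {f : α → E} (hf : MemLp f 2 μ) :
    lpNorm (fun a => f a - ∫ b, f b ∂μ) 2 μ ≤ lpNorm f 2 μ := by
  refine le_of_sq_le_sq ?_ lpNorm_nonneg
  rw [lpNorm_two_sq_eq_variance_add hf]
  nlinarith [sq_nonneg ‖∫ b, f b ∂μ‖]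

/-- Gradients are compared only with the one at the starting point `x`, so `c` may depend on `x`.
This is what allows a smoothness constant that grows with `‖∇f(x)‖`. -/
theorem le_add_inner_gradient_of_norm_gradient_sub_le {E : Type*} [NormedAddCommGroup E]
    [InnerProductSpace ℝ E] [CompleteSpace E] {f : E → ℝ} (hf : Differentiable ℝ f) {c : ℝ}
    {x y : E}
    (h : ∀ θ ∈ Set.Icc (0 : ℝ) 1,
      ‖gradient f (x + θ • (y - x)) - gradient f x‖ ≤ c * (θ * ‖y - x‖)) :
    f y ≤ f x + inner ℝ (gradient f x) (y - x) + c / 2 * ‖y - x‖ ^ 2 := by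
  set w := y - x with hw
  -- The linear and quadratic models are subtracted from `f` on the segment; the hypothesis makes
  -- the derivative nonpositive, and the claim is `φ 1 ≤ φ 0`.
  let φ : ℝ → ℝ := fun t =>
    f (x + t • w) - t * inner ℝ (gradient f x) w - c / 2 * ‖w‖ ^ 2 * t ^ 2
  have hline : ∀ t : ℝ, HasDerivAt (fun t : ℝ => x + t • w) w t := fun t => by
    simpa using ((hasDerivAt_id t).smul_const w).const_add x
  have hφ : ∀ t, HasDerivAt φ (inner ℝ (gradient f (x + t • w)) w - inner ℝ (gradient f x) w
      - c / 2 * ‖w‖ ^ 2 * (2 * t)) t := fun t => by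
    have h1 := ((hf (x + t • w)).hasGradientAt.hasFDerivAt).comp_hasDerivAt t (hline t)
    have h2 : HasDerivAt (fun t : ℝ => t * inner ℝ (gradient f x) w)
        (inner ℝ (gradient f x) w) t := by
      simpa using (hasDerivAt_id t).mul_const (inner ℝ (gradient f x) w)
    have h3 : HasDerivAt (fun t : ℝ => c / 2 * ‖w‖ ^ 2 * t ^ 2) (c / 2 * ‖w‖ ^ 2 * (2 * t)) t := by
      simpa using (hasDerivAt_pow 2 t).const_mul (c / 2 * ‖w‖ ^ 2)
    exact (h1.sub h2).sub h3
  have hanti : AntitoneOn φ (Set.Icc 0 1) := by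
    refine antitoneOn_of_deriv_nonpos (convex_Icc 0 1)
      (fun t _ => (hφ t).continuousAt.continuousWithinAt)
      (fun t _ => (hφ t).differentiableAt.differentiableWithinAt) fun t ht => ?_
    rw [interior_Icc] at ht
    rw [(hφ t).deriv, ← inner_sub_left]
    have h1 := (real_inner_le_norm (gradient f (x + t • w) - gradient f x) w).trans
      (mul_le_mul_of_nonneg_right (h t ⟨ht.1.le, ht.2.le⟩) (norm_nonneg w))
    nlinarith
  have h01 := hanti (Set.left_mem_Icc.2 zero_le_one) (Set.right_mem_Icc.2 zero_le_one) zero_le_one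
  simp only [φ, one_smul, zero_smul, add_zero, hw, add_sub_cancel] at h01
  rw [← hw] at h01
  linarith

/-! ### Oracle noise and the increments of the estimator -/

namespace BG0Problem

variable {d : ℕ} {Ξ : Type u} [MeasurableSpace Ξ] {B G : ℝ} (Q : BG0Problem d Ξ B G)

instance : IsProbabilityMeasure Q.law := Q.isProb

/-- Unbiasedness presents the gradient as a parameter integral of a jointly measurable function, so
no continuity of the gradient is needed. -/
theorem measurable_gradient : Measurable (gradient Q.f) := by
  have h : gradient Q.f = fun x => ∫ ξ, Q.g x ξ ∂Q.law := funext fun x => (Q.unbiased x).symm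
  rw [h]
  exact (Q.measurable.stronglyMeasurable.integral_prod_right (ν := Q.law)).measurable

theorem measurable_g (x : EuclideanSpace ℝ (Fin d)) : Measurable (Q.g x) :=
  Q.measurable.comp (measurable_const.prodMk measurable_id)

theorem memLp_sub (x y : EuclideanSpace ℝ (Fin d)) :
    MemLp (fun ξ => Q.g y ξ - Q.g x ξ) 2 Q.law := (Q.memLp y).sub (Q.memLp x)

theorem integrable_g (x : EuclideanSpace ℝ (Fin d)) : Integrable (Q.g x) Q.law :=
  (Q.memLp x).integrable (by norm_num)

theorem memLp_noise (x : EuclideanSpace ℝ (Fin d)) :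
    MemLp (fun ξ => Q.g x ξ - gradient Q.f x) 2 Q.law := (Q.memLp x).sub (memLp_const _)

theorem integral_sub_eq (x y : EuclideanSpace ℝ (Fin d)) :
    ∫ ξ, (Q.g y ξ - Q.g x ξ) ∂Q.law = gradient Q.f y - gradient Q.f x := by
  rw [integral_sub (Q.integrable_g y) (Q.integrable_g x), Q.unbiased, Q.unbiased]

theorem norm_gradient_sub_le (x y : EuclideanSpace ℝ (Fin d)) :
    ‖gradient Q.f y - gradient Q.f x‖ ≤ lpNorm (fun ξ => Q.g y ξ - Q.g x ξ) 2 Q.law := by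
  rw [← Q.integral_sub_eq]
  exact norm_integral_le_lpNorm_two (Q.memLp_sub x y)

theorem lpNorm_noise_sq_le (x : EuclideanSpace ℝ (Fin d)) :
    lpNorm (fun ξ => Q.g x ξ - gradient Q.f x) 2 Q.law ^ 2 ≤ B ^ 2 * ‖x - Q.x0‖ ^ 2 + G ^ 2 := by
  rw [lpNorm_two_sq (Q.memLp_noise x).1]
  exact Q.variance x

theorem lpNorm_noise_le (hB : 0 ≤ B) (hG : 0 ≤ G) (x : EuclideanSpace ℝ (Fin d)) :
    lpNorm (fun ξ => Q.g x ξ - gradient Q.f x) 2 Q.law ≤ B * ‖x - Q.x0‖ + G := by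
  refine le_of_sq_le_sq ((Q.lpNorm_noise_sq_le x).trans ?_) (by positivity)
  have : 0 ≤ B * ‖x - Q.x0‖ * G := by positivity
  nlinarith

theorem lpNorm_g_le (hB : 0 ≤ B) (hG : 0 ≤ G) (x : EuclideanSpace ℝ (Fin d)) :
    lpNorm (Q.g x) 2 Q.law ≤ ‖gradient Q.f x‖ + B * ‖x - Q.x0‖ + G := by
  have h := lpNorm_le_lpNorm_add_lpNorm_sub' (f := Q.g x) (p := 2) (μ := Q.law)
    (memLp_const (gradient Q.f x)) (by norm_num)
  have h2 := Q.lpNorm_noise_le hB hG x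
  have h3 : lpNorm (fun _ : Ξ => gradient Q.f x) 2 Q.law = ‖gradient Q.f x‖ := by simp
  have h4 : (Q.g x - fun _ => gradient Q.f x) = fun ξ => Q.g x ξ - gradient Q.f x := rfl
  rw [h4, h3] at h
  linarith

/-- The martingale increment of the STORM estimator for a transition from `x` to `y`. -/
noncomputable def increment (η : ℝ) (x y : EuclideanSpace ℝ (Fin d)) (ξ : Ξ) :
    EuclideanSpace ℝ (Fin d) :=
  (Q.g y ξ - gradient Q.f y) - (1 - η) • (Q.g x ξ - gradient Q.f x)

theorem memLp_increment (η : ℝ) (x y : EuclideanSpace ℝ (Fin d)) :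
    MemLp (Q.increment η x y) 2 Q.law :=
  (Q.memLp_noise y).sub ((Q.memLp_noise x).const_smul (1 - η))

theorem integral_increment (η : ℝ) (x y : EuclideanSpace ℝ (Fin d)) :
    ∫ ξ, Q.increment η x y ξ ∂Q.law = 0 := by
  have h : ∀ z, ∫ ξ, (Q.g z ξ - gradient Q.f z) ∂Q.law = 0 := fun z => by
    rw [integral_sub (Q.integrable_g z) (integrable_const _), Q.unbiased]; simp
  have hi : ∀ z, Integrable (fun ξ => Q.g z ξ - gradient Q.f z) Q.law := fun z =>
    (Q.integrable_g z).sub (integrable_const _)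
  unfold increment
  have hs : Integrable (fun ξ => (1 - η) • (Q.g x ξ - gradient Q.f x)) Q.law :=
    (hi x).smul (1 - η)
  rw [integral_sub (hi y) hs, integral_smul, h, h]
  simp

/-- The increment is `(1 - η)` times the centred oracle difference plus `η` times the noise at the
new point. Centring does not increase the `L²` norm, so smoothness controls the first term, and the
noise level enters only with the small factor `η`. -/
theorem lpNorm_increment_le (hB : 0 ≤ B) (hG : 0 ≤ G) {η : ℝ} (hη : 0 ≤ η) (hη1 : η ≤ 1)
    (x y : EuclideanSpace ℝ (Fin d)) :
    lpNorm (Q.increment η x y) 2 Q.law ≤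
      lpNorm (fun ξ => Q.g y ξ - Q.g x ξ) 2 Q.law + η * (B * ‖y - Q.x0‖ + G) := by
  set D : Ξ → EuclideanSpace ℝ (Fin d) := fun ξ =>
    (Q.g y ξ - Q.g x ξ) - ∫ ζ, (Q.g y ζ - Q.g x ζ) ∂Q.law with hD
  set Z : Ξ → EuclideanSpace ℝ (Fin d) := fun ξ => Q.g y ξ - gradient Q.f y with hZ
  have hDm : MemLp D 2 Q.law := (Q.memLp_sub x y).sub (memLp_const _)
  have hZm : MemLp Z 2 Q.law := Q.memLp_noise y
  have heq : Q.increment η x y = (1 - η) • D + η • Z := by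
    funext ξ
    simp only [increment, hD, hZ, Q.integral_sub_eq, Pi.add_apply, Pi.smul_apply]
    module
  rw [heq]
  refine (lpNorm_add_le (hDm.const_smul _) (by norm_num)).trans ?_
  rw [lpNorm_const_smul, lpNorm_const_smul]
  have h1 : ‖1 - η‖ ≤ 1 := by rw [Real.norm_eq_abs, abs_le]; constructor <;> linarith
  have h2 : lpNorm D 2 Q.law ≤ _ := lpNorm_two_sub_mean_le (Q.memLp_sub x y)
  have h3 : lpNorm Z 2 Q.law ≤ _ := Q.lpNorm_noise_le hB hG y
  have h4 : (0 : ℝ) ≤ lpNorm D 2 Q.law := lpNorm_nonneg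
  have e1 : ((‖1 - η‖₊ : NNReal) : ℝ) = ‖1 - η‖ := rfl
  have e2 : ((‖η‖₊ : NNReal) : ℝ) = η := by rw [coe_nnnorm, Real.norm_of_nonneg hη]
  rw [e1, e2]
  refine add_le_add ?_ (mul_le_mul_of_nonneg_left h3 hη)
  nlinarith

theorem measurable_increment (η : ℝ) :
    Measurable fun p : (EuclideanSpace ℝ (Fin d) × EuclideanSpace ℝ (Fin d)) × Ξ =>
      Q.increment η p.1.1 p.1.2 p.2 := by
  have h1 := Q.measurable.comp (measurable_fst.snd.prodMk measurable_snd :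
    Measurable fun p : (EuclideanSpace ℝ (Fin d) × EuclideanSpace ℝ (Fin d)) × Ξ => (p.1.2, p.2))
  have h2 := Q.measurable.comp (measurable_fst.fst.prodMk measurable_snd :
    Measurable fun p : (EuclideanSpace ℝ (Fin d) × EuclideanSpace ℝ (Fin d)) × Ξ => (p.1.1, p.2))
  exact (h1.sub (Q.measurable_gradient.comp measurable_fst.snd)).sub
    ((h2.sub (Q.measurable_gradient.comp measurable_fst.fst)).const_smul (1 - η))

end BG0Problem

/-! ### Integration against an independent sample -/

theorem integrable_inner_of_memLp_two {α E : Type*} [MeasurableSpace α] [NormedAddCommGroup E]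
    [InnerProductSpace ℝ E] {μ : Measure α} {f g : α → E} (hf : MemLp f 2 μ) (hg : MemLp g 2 μ) :
    Integrable (fun a => inner ℝ (f a) (g a)) μ :=
  (hf.norm.integrable_mul hg.norm).mono' (hf.1.inner hg.1)
    (ae_of_all _ fun a => norm_inner_le_norm (f a) (g a))

section Independence

variable {Ω 𝒲 Ξ E : Type*} [MeasurableSpace Ω] [MeasurableSpace 𝒲] [MeasurableSpace Ξ]
  {P : Measure Ω} [IsProbabilityMeasure P] {μ : Measure Ξ} [IsProbabilityMeasure μ]
  {W : Ω → 𝒲} {X : Ω → Ξ}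

theorem ProbabilityTheory.IndepFun.lintegral_comp_prodMk (h : IndepFun W X P) (hW : Measurable W)
    (hX : Measurable X) (hμ : P.map X = μ) {ψ : 𝒲 × Ξ → ENNReal} (hψ : Measurable ψ) :
    ∫⁻ ω, ψ (W ω, X ω) ∂P = ∫⁻ ω, ∫⁻ ξ, ψ (W ω, ξ) ∂μ ∂P := by
  have h1 := h.map_prod_eq_prod_map_map hW.aemeasurable hX.aemeasurable
  rw [hμ] at h1
  rw [← lintegral_map hψ (hW.prodMk hX), h1, lintegral_prod _ hψ.aemeasurable,
    lintegral_map hψ.lintegral_prod_right' hW]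

theorem ProbabilityTheory.IndepFun.integral_comp_prodMk (h : IndepFun W X P) (hW : Measurable W)
    (hX : Measurable X) (hμ : P.map X = μ) {ψ : 𝒲 × Ξ → ℝ} (hψ : Measurable ψ)
    (hi : Integrable (fun ω => ψ (W ω, X ω)) P) :
    ∫ ω, ψ (W ω, X ω) ∂P = ∫ ω, ∫ ξ, ψ (W ω, ξ) ∂μ ∂P := by
  have h1 := h.map_prod_eq_prod_map_map hW.aemeasurable hX.aemeasurable
  rw [hμ] at h1
  have hi' : Integrable ψ (P.map fun ω => (W ω, X ω)) :=
    (integrable_map_measure hψ.aestronglyMeasurable (hW.prodMk hX).aemeasurable).2 hi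
  rw [← integral_map (hW.prodMk hX).aemeasurable hψ.aestronglyMeasurable]
  rw [h1] at hi' ⊢
  rw [integral_prod _ hi', integral_map hW.aemeasurable]
  exact hψ.stronglyMeasurable.integral_prod_right'.aestronglyMeasurable

variable [NormedAddCommGroup E] [MeasurableSpace E] [BorelSpace E] [SecondCountableTopology E]
  {φ : 𝒲 × Ξ → E}

/-- Conditioning on `W` amounts to freezing it and integrating over the sample law. The computation
is done with lower integrals, so integrability of the composite is a conclusion. -/
theorem ProbabilityTheory.IndepFun.memLp_two_comp_prodMk (h : IndepFun W X P) (hW : Measurable W)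
    (hX : Measurable X) (hμ : P.map X = μ) (hφ : Measurable φ)
    (hL : ∀ ω, MemLp (fun ξ => φ (W ω, ξ)) 2 μ) {c : ℝ}
    (hc : ∀ ω, lpNorm (fun ξ => φ (W ω, ξ)) 2 μ ≤ c) :
    MemLp (fun ω => φ (W ω, X ω)) 2 P ∧ lpNorm (fun ω => φ (W ω, X ω)) 2 P ≤ c := by
  have hmeas : AEStronglyMeasurable (fun ω => φ (W ω, X ω)) P :=
    (hφ.comp (hW.prodMk hX)).aestronglyMeasurable
  obtain ⟨ω₀⟩ : Nonempty Ω := nonempty_of_isProbabilityMeasure P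
  have hc0 : 0 ≤ c := lpNorm_nonneg.trans (hc ω₀)
  have hin : ∀ ω, ∫⁻ ξ, ‖φ (W ω, ξ)‖ₑ ^ (2 : ℝ) ∂μ ≤ ENNReal.ofReal c ^ (2 : ℝ) := fun ω => by
    have h3 : eLpNorm (fun ξ => φ (W ω, ξ)) 2 μ ≤ ENNReal.ofReal c := by
      rw [← ofReal_lpNorm (hL ω)]
      exact ENNReal.ofReal_le_ofReal (hc ω)
    have h4 := ENNReal.rpow_le_rpow h3 (show (0 : ℝ) ≤ 2 by norm_num)
    rwa [eLpNorm_eq_lintegral_rpow_enorm_toReal (by norm_num) (by norm_num), ← ENNReal.rpow_mul,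
      ENNReal.toReal_ofNat, show (1 / 2 * 2 : ℝ) = 1 by norm_num, ENNReal.rpow_one] at h4
  have hmain : eLpNorm (fun ω => φ (W ω, X ω)) 2 P ≤ ENNReal.ofReal c := by
    rw [eLpNorm_eq_lintegral_rpow_enorm_toReal (by norm_num) (by norm_num), ENNReal.toReal_ofNat,
      h.lintegral_comp_prodMk hW hX hμ (ψ := fun p => ‖φ p‖ₑ ^ (2 : ℝ))
        (hφ.enorm.pow_const 2)]
    refine (ENNReal.rpow_le_rpow (lintegral_mono hin) (by norm_num)).trans ?_
    rw [lintegral_const, measure_univ, mul_one, ← ENNReal.rpow_mul]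
    norm_num
  have hm : MemLp (fun ω => φ (W ω, X ω)) 2 P := ⟨hmeas, hmain.trans_lt ENNReal.ofReal_lt_top⟩
  refine ⟨hm, ?_⟩
  rw [← toReal_eLpNorm hmeas]
  exact ENNReal.toReal_le_of_le_ofReal hc0 hmain

/-- The `L¹` counterpart, in which the conditional bound may itself be random; it serves the part of
the increment that scales with the gradient. -/
theorem ProbabilityTheory.IndepFun.integrable_comp_prodMk (h : IndepFun W X P) (hW : Measurable W)
    (hX : Measurable X) (hμ : P.map X = μ) (hφ : Measurable φ)
    (hL : ∀ ω, MemLp (fun ξ => φ (W ω, ξ)) 2 μ) {c : Ω → ℝ} (hci : Integrable c P)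
    (hc : ∀ ω, lpNorm (fun ξ => φ (W ω, ξ)) 2 μ ≤ c ω) :
    Integrable (fun ω => φ (W ω, X ω)) P ∧ ∫ ω, ‖φ (W ω, X ω)‖ ∂P ≤ ∫ ω, c ω ∂P := by
  have hmeas : AEStronglyMeasurable (fun ω => φ (W ω, X ω)) P :=
    (hφ.comp (hW.prodMk hX)).aestronglyMeasurable
  have hc0 : ∀ ω, 0 ≤ c ω := fun ω => lpNorm_nonneg.trans (hc ω)
  have hmain : ∫⁻ ω, ‖φ (W ω, X ω)‖ₑ ∂P ≤ ENNReal.ofReal (∫ ω, c ω ∂P) := by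
    rw [h.lintegral_comp_prodMk hW hX hμ (ψ := fun p => ‖φ p‖ₑ) hφ.enorm,
      ofReal_integral_eq_lintegral_ofReal hci (ae_of_all _ hc0)]
    refine lintegral_mono fun ω => ?_
    have hi : Integrable (fun ξ => φ (W ω, ξ)) μ := (hL ω).integrable (by norm_num)
    rw [← ofReal_integral_norm_eq_lintegral_enorm hi]
    exact ENNReal.ofReal_le_ofReal ((integral_norm_le_lpNorm_two (hL ω)).trans (hc ω))
  have hi : Integrable (fun ω => φ (W ω, X ω)) P :=
    ⟨hmeas, hmain.trans_lt ENNReal.ofReal_lt_top⟩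
  refine ⟨hi, ?_⟩
  rw [← ofReal_integral_norm_eq_lintegral_enorm hi] at hmain
  exact (ENNReal.ofReal_le_ofReal_iff (integral_nonneg hc0)).1 hmain

/-- Martingale orthogonality: with `W` frozen, the inner product is linear in a centred variable. -/
theorem ProbabilityTheory.IndepFun.integral_inner_comp_prodMk_eq_zero [InnerProductSpace ℝ E]
    [CompleteSpace E]
    (h : IndepFun W X P) (hW : Measurable W)
    (hX : Measurable X) (hμ : P.map X = μ) (hφ : Measurable φ)
    (hL : ∀ ω, Integrable (fun ξ => φ (W ω, ξ)) μ) {a : 𝒲 → E} (ha : Measurable a)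
    (haL : MemLp (fun ω => a (W ω)) 2 P) (hφL : MemLp (fun ω => φ (W ω, X ω)) 2 P)
    (h0 : ∀ ω, ∫ ξ, φ (W ω, ξ) ∂μ = 0) :
    ∫ ω, inner ℝ (a (W ω)) (φ (W ω, X ω)) ∂P = 0 := by
  have hi : Integrable (fun ω => inner ℝ (a (W ω)) (φ (W ω, X ω))) P :=
    integrable_inner_of_memLp_two haL hφL
  rw [h.integral_comp_prodMk hW hX hμ (ψ := fun p => inner ℝ (a p.1) (φ p))
    ((ha.comp measurable_fst).inner hφ) hi]
  have : ∀ ω, ∫ ξ, inner ℝ (a (W ω)) (φ (W ω, ξ)) ∂μ = 0 := fun ω => by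
    rw [integral_inner (hL ω), h0, inner_zero_right]
  simp [this]

end Independence

/-! ### Measurability, independence and error recursion of a run -/

namespace BG0Problem

variable {d : ℕ} {Ξ : Type u} [MeasurableSpace Ξ] {B G : ℝ} (Q : BG0Problem d Ξ B G)
  {N : ℕ} (γ η : ℝ) {α : Type*} [MeasurableSpace α]

/-- The accumulated increments of the STORM estimator with weights `p` evaluated at the iterates. -/
noncomputable def noise (p : EuclideanSpace ℝ (Fin d) → ℝ) (s₀ : Fin N → Ξ) (s : ℕ → Ξ) :
    ℕ → EuclideanSpace ℝ (Fin d)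
  | 0 => 0
  | k + 1 => (1 - η) • noise p s₀ s k + p (nstorm Q.g Q.x0 γ η s₀ s k).x •
      Q.increment η (nstorm Q.g Q.x0 γ η s₀ s k).x (nstorm Q.g Q.x0 γ η s₀ s (k + 1)).x (s k)

/-- The measurable space is arbitrary so that the result applies to the ambient σ-algebra, to the
history and to the space of samples. The third component matters most: `x^{k+1}` is computed from
`x^k` and `v^k` alone, so both endpoints of a transition are known before its sample `s k` is drawn.
-/
theorem measurable_nstorm {s₀ : Fin N → α → Ξ} {s : ℕ → α → Ξ} (k : ℕ)
    (h₀ : ∀ i, Measurable (s₀ i)) (h : ∀ j < k, Measurable (s j)) :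
    Measurable (fun a => (nstorm Q.g Q.x0 γ η (s₀ · a) (s · a) k).x) ∧
      Measurable (fun a => (nstorm Q.g Q.x0 γ η (s₀ · a) (s · a) k).v) ∧
      Measurable (fun a => (nstorm Q.g Q.x0 γ η (s₀ · a) (s · a) (k + 1)).x) := by
  have hx : ∀ k, Measurable (fun a => (nstorm Q.g Q.x0 γ η (s₀ · a) (s · a) k).x) →
      Measurable (fun a => (nstorm Q.g Q.x0 γ η (s₀ · a) (s · a) k).v) →
      Measurable (fun a => (nstorm Q.g Q.x0 γ η (s₀ · a) (s · a) (k + 1)).x) := fun k h1 h2 =>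
    h1.sub ((h2.norm.inv.smul h2).const_smul γ)
  induction k with
  | zero =>
    have h1 : Measurable (fun a => (nstorm Q.g Q.x0 γ η (s₀ · a) (s · a) 0).x) := measurable_const
    have hsum : Measurable fun a => ∑ i, Q.g Q.x0 (s₀ i a) :=
      Finset.measurable_fun_sum _ fun i _ => (Q.measurable_g Q.x0).comp (h₀ i)
    have h2 : Measurable (fun a => (nstorm Q.g Q.x0 γ η (s₀ · a) (s · a) 0).v) :=
      hsum.const_smul (N : ℝ)⁻¹
    exact ⟨h1, h2, hx 0 h1 h2⟩
  | succ k ih =>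
    obtain ⟨h1, h2, h3⟩ := ih fun j hj => h j (hj.trans k.lt_succ_self)
    have hs := h k k.lt_succ_self
    have h4 : Measurable (fun a => (nstorm Q.g Q.x0 γ η (s₀ · a) (s · a) (k + 1)).v) :=
      (Q.measurable.comp (h3.prodMk hs)).add
        ((h2.sub (Q.measurable.comp (h1.prodMk hs))).const_smul (1 - η))
    exact ⟨h3, h4, hx (k + 1) h3 h4⟩

theorem measurable_noise {p : EuclideanSpace ℝ (Fin d) → ℝ} (hp : Measurable p)
    {s₀ : Fin N → α → Ξ} {s : ℕ → α → Ξ} (k : ℕ)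
    (h₀ : ∀ i, Measurable (s₀ i)) (h : ∀ j < k, Measurable (s j)) :
    Measurable (fun a => Q.noise γ η p (s₀ · a) (s · a) k) := by
  induction k with
  | zero => exact measurable_const
  | succ k ih =>
    have h' : ∀ j < k, Measurable (s j) := fun j hj => h j (hj.trans k.lt_succ_self)
    obtain ⟨h1, -, h3⟩ := Q.measurable_nstorm γ η k h₀ h'
    have h5 := (Q.measurable_increment η).comp ((h1.prodMk h3).prodMk (h k k.lt_succ_self))
    exact ((ih h').const_smul (1 - η)).add ((hp.comp h1).smul h5)

end BG0Problem

namespace NSTORMRun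

variable {d : ℕ} {Ξ : Type u} [MeasurableSpace Ξ] {B G : ℝ} {Q : BG0Problem d Ξ B G}
  {N K : ℕ} {Ω : Type v} [MeasurableSpace Ω] (R : NSTORMRun Q N K Ω) (γ η : ℝ)

instance : IsProbabilityMeasure R.P := R.isProb

theorem state_zero_x (ω : Ω) : (R.state γ η 0 ω).x = Q.x0 := rfl

theorem state_zero_v (ω : Ω) :
    (R.state γ η 0 ω).v = (N : ℝ)⁻¹ • ∑ i, Q.g Q.x0 (R.s₀ i ω) := rfl

theorem state_succ_x (k : ℕ) (ω : Ω) : (R.state γ η (k + 1) ω).x =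
    (R.state γ η k ω).x - γ • (‖(R.state γ η k ω).v‖⁻¹ • (R.state γ η k ω).v) := rfl

theorem state_succ_v (k : ℕ) (ω : Ω) : (R.state γ η (k + 1) ω).v =
    Q.g (R.state γ η (k + 1) ω).x (R.s k ω)
      + (1 - η) • ((R.state γ η k ω).v - Q.g (R.state γ η k ω).x (R.s k ω)) := rfl

theorem state_calls (k : ℕ) (ω : Ω) : (R.state γ η k ω).calls = N + 2 * k := by
  induction k with
  | zero => rfl
  | succ k ih =>
    change (R.state γ η k ω).calls + 2 = _
    rw [ih]; ring

theorem totalCalls_eq (ω : Ω) : R.totalCalls γ η ω = N + 2 * (K + 1) := R.state_calls γ η _ ω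

theorem norm_state_succ_x_sub_le {γ : ℝ} (hγ : 0 ≤ γ) (k : ℕ) (ω : Ω) :
    ‖(R.state γ η (k + 1) ω).x - (R.state γ η k ω).x‖ ≤ γ := by
  rw [state_succ_x, sub_sub_cancel_left, norm_neg, norm_smul, norm_smul, norm_inv, norm_norm,
    Real.norm_of_nonneg hγ]
  exact mul_le_of_le_one_right hγ (inv_mul_le_one_of_le₀ le_rfl (norm_nonneg _))

theorem norm_state_x_sub_le {γ : ℝ} (hγ : 0 ≤ γ) (k : ℕ) (ω : Ω) :
    ‖(R.state γ η k ω).x - Q.x0‖ ≤ k * γ := by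
  induction k with
  | zero => simp [state_zero_x]
  | succ k ih =>
    have h := norm_add_le ((R.state γ η (k + 1) ω).x - (R.state γ η k ω).x)
      ((R.state γ η k ω).x - Q.x0)
    rw [sub_add_sub_cancel] at h
    have := R.norm_state_succ_x_sub_le η hγ k ω
    push_cast
    linarith

/-- The accumulated increments of the STORM estimator with weights `p` evaluated at the iterates. -/
noncomputable def noise (p : EuclideanSpace ℝ (Fin d) → ℝ) (k : ℕ) (ω : Ω) :
    EuclideanSpace ℝ (Fin d) :=
  Q.noise γ η p (fun i => R.s₀ i ω) (fun k => R.s k ω) k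

theorem noise_zero (p : EuclideanSpace ℝ (Fin d) → ℝ) (ω : Ω) : R.noise γ η p 0 ω = 0 := rfl

theorem noise_succ (p : EuclideanSpace ℝ (Fin d) → ℝ) (k : ℕ) (ω : Ω) :
    R.noise γ η p (k + 1) ω = (1 - η) • R.noise γ η p k ω + p (R.state γ η k ω).x •
      Q.increment η (R.state γ η k ω).x (R.state γ η (k + 1) ω).x (R.s k ω) := rfl

/-- Substituting the update shows that the error obeys a linear recursion driven by the increments.
Hence it splits along any decomposition `p + (1 - p)` of each increment. -/
theorem error_eq (p : EuclideanSpace ℝ (Fin d) → ℝ) (k : ℕ) (ω : Ω) :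
    (R.state γ η k ω).v - gradient Q.f (R.state γ η k ω).x =
      (1 - η) ^ k • ((R.state γ η 0 ω).v - gradient Q.f Q.x0) + R.noise γ η p k ω
        + R.noise γ η (fun x => 1 - p x) k ω := by
  induction k with
  | zero => simp [noise_zero, state_zero_x]
  | succ k ih =>
    rw [noise_succ, noise_succ, state_succ_v, BG0Problem.increment]
    have h : (R.state γ η k ω).v = gradient Q.f (R.state γ η k ω).x +
      ((1 - η) ^ k • ((R.state γ η 0 ω).v - gradient Q.f Q.x0) + R.noise γ η p k ω
        + R.noise γ η (fun x => 1 - p x) k ω) := by rw [← ih]; abel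
    rw [h]
    module

/-- The σ-algebra generated by the samples used before the transition from `k` to `k + 1`. -/
abbrev history (k : ℕ) : MeasurableSpace Ω :=
  ⨆ i ∈ {i : Fin N ⊕ ℕ | i ≠ Sum.inr k ∧ ∀ j, i = Sum.inr j → j < k},
    MeasurableSpace.comap (Sum.elim R.s₀ R.s i) inferInstance

theorem measurable_s₀_history (k : ℕ) (i : Fin N) : Measurable[R.history k] (R.s₀ i) := by
  rw [measurable_iff_comap_le]
  exact le_iSup₂_of_le (f := fun i (_ : i ∈ {i : Fin N ⊕ ℕ | i ≠ Sum.inr k ∧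
    ∀ j, i = Sum.inr j → j < k}) => MeasurableSpace.comap (Sum.elim R.s₀ R.s i) inferInstance)
    (Sum.inl i) (by simp) le_rfl

theorem measurable_s_history {k j : ℕ} (hj : j < k) : Measurable[R.history k] (R.s j) := by
  rw [measurable_iff_comap_le]
  exact le_iSup₂_of_le (f := fun i (_ : i ∈ {i : Fin N ⊕ ℕ | i ≠ Sum.inr k ∧
    ∀ j, i = Sum.inr j → j < k}) => MeasurableSpace.comap (Sum.elim R.s₀ R.s i) inferInstance)
    (Sum.inr j) (by simp [hj, hj.ne]) le_rfl

theorem measurable_samples (i : Fin N ⊕ ℕ) : Measurable (Sum.elim R.s₀ R.s i) := by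
  cases i with
  | inl i => exact R.measurable_s₀ i
  | inr j => exact R.measurable_s j

/-- The history is generated by samples whose indices avoid `Sum.inr k`, and disjoint groups of an
independent family are independent. -/
theorem indepFun_history {𝒲 : Type*} [MeasurableSpace 𝒲] {k : ℕ} {W : Ω → 𝒲}
    (hW : Measurable[R.history k] W) : IndepFun W (R.s k) R.P := by
  rw [IndepFun_iff_Indep]
  have h := indep_iSup_of_disjoint
    (fun i => (R.measurable_samples i).comap_le) R.iIndepFun_samples.iIndep
    (S := {i : Fin N ⊕ ℕ | i ≠ Sum.inr k ∧ ∀ j, i = Sum.inr j → j < k}) (T := {Sum.inr k})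
    (by rw [Set.disjoint_singleton_right]; simp)
  simp only [Set.mem_singleton_iff, iSup_iSup_eq_left] at h
  exact indep_of_indep_of_le_left h hW.comap_le

theorem measurable_state_history (k : ℕ) :
    Measurable[R.history k] (fun ω => (R.state γ η k ω).x) ∧
      Measurable[R.history k] (fun ω => (R.state γ η k ω).v) ∧
      Measurable[R.history k] (fun ω => (R.state γ η (k + 1) ω).x) :=
  @BG0Problem.measurable_nstorm d Ξ _ B G Q N γ η Ω (R.history k) R.s₀ R.s k
    (R.measurable_s₀_history k) fun _ hj => R.measurable_s_history hj

theorem measurable_noise_history {p : EuclideanSpace ℝ (Fin d) → ℝ} (hp : Measurable p) (k : ℕ) :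
    Measurable[R.history k] (R.noise γ η p k) :=
  @BG0Problem.measurable_noise d Ξ _ B G Q N γ η Ω (R.history k) p hp R.s₀ R.s k
    (R.measurable_s₀_history k) fun _ hj => R.measurable_s_history hj

theorem measurable_x (k : ℕ) : Measurable fun ω => (R.state γ η k ω).x :=
  (Q.measurable_nstorm γ η k R.measurable_s₀ fun j _ => R.measurable_s j).1

theorem measurable_noise {p : EuclideanSpace ℝ (Fin d) → ℝ} (hp : Measurable p) (k : ℕ) :
    Measurable (R.noise γ η p k) :=
  Q.measurable_noise γ η hp k R.measurable_s₀ fun j _ => R.measurable_s j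

theorem indepFun_κ_x (k : ℕ) : IndepFun R.κ (fun ω => (R.state γ η k ω).x) R.P := by
  have h : Measurable fun q : (Fin N → Ξ) × (ℕ → Ξ) => (nstorm Q.g Q.x0 γ η q.1 q.2 k).x :=
    (Q.measurable_nstorm γ η (s₀ := fun i (q : (Fin N → Ξ) × (ℕ → Ξ)) => q.1 i)
      (s := fun j q => q.2 j) k
      (fun i => (measurable_pi_apply i).comp measurable_fst)
      fun j _ => (measurable_pi_apply j).comp measurable_snd).1
  exact R.indepFun_κ.comp measurable_id h

/-- The output is uniform over the iterates. -/
theorem integral_output {F : EuclideanSpace ℝ (Fin d) → ℝ} (hF : Measurable F)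
    (hi : ∀ k < K + 1, Integrable (fun ω => F (R.state γ η k ω).x) R.P) :
    Integrable (fun ω => F (R.output γ η ω)) R.P ∧
      ∫ ω, F (R.output γ η ω) ∂(R.P) =
        ((K : ℝ) + 1)⁻¹ * ∑ k ∈ Finset.range (K + 1), ∫ ω, F (R.state γ η k ω).x ∂(R.P) := by
  have hset : ∀ j, MeasurableSet (R.κ ⁻¹' {j}) := fun j =>
    R.measurable_κ (measurableSet_singleton j)
  -- The output is decomposed over the value of `κ`. On each piece the iterate has a fixed index and
  -- is independent of `κ`, so the expectation factors with probability `1 / (K + 1)`.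
  have hsum : (fun ω => F (R.output γ η ω)) = fun ω => ∑ j : Fin (K + 1),
      (R.κ ⁻¹' {j}).indicator (fun ω => F (R.state γ η j ω).x) ω := by
    funext ω
    rw [Finset.sum_eq_single (R.κ ω)]
    · simp [output]
    · intro j _ hj
      exact Set.indicator_of_notMem (fun h => hj (by simpa using h.symm)) _
    · simp
  have hij : ∀ j : Fin (K + 1), Integrable
      ((R.κ ⁻¹' {j}).indicator (fun ω => F (R.state γ η j ω).x)) R.P := fun j =>
    (hi j j.2).indicator (hset j)
  refine ⟨by rw [hsum]; exact integrable_finsetSum _ fun j _ => hij j, ?_⟩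
  rw [hsum, integral_finsetSum _ fun j _ => hij j, Finset.mul_sum, ← Fin.sum_univ_eq_sum_range
    (fun k => ((K : ℝ) + 1)⁻¹ * ∫ ω, F (R.state γ η k ω).x ∂(R.P))]
  refine Finset.sum_congr rfl fun j _ => ?_
  have hind : IndepFun R.κ (fun ω => F (R.state γ η j ω).x) R.P :=
    (R.indepFun_κ_x γ η j).comp measurable_id hF
  have hone : Measurable fun i : Fin (K + 1) => if i = j then (1 : ℝ) else 0 :=
    measurable_of_finite _
  have hprod := (hind.comp hone measurable_id).integral_mul_eq_mul_integral
    (hone.comp R.measurable_κ).aestronglyMeasurable (hi j j.2).aestronglyMeasurable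
  have h1 : (R.κ ⁻¹' {j}).indicator (fun ω => F (R.state γ η j ω).x) =
      ((fun i : Fin (K + 1) => if i = j then (1 : ℝ) else 0) ∘ R.κ) *
        (id ∘ fun ω => F (R.state γ η j ω).x) := by
    funext ω
    by_cases h : R.κ ω = j <;> simp [h]
  have h2 : ((fun i : Fin (K + 1) => if i = j then (1 : ℝ) else 0) ∘ R.κ) =
      (R.κ ⁻¹' {j}).indicator 1 := by
    funext ω
    by_cases h : R.κ ω = j <;> simp [h]
  rw [h1]
  refine hprod.trans ?_
  rw [h2, integral_indicator_one (hset j), Measure.real, R.uniform_κ]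
  congr 1
  rw [ENNReal.toReal_inv, ENNReal.toReal_add (by simp) (by simp)]
  simp

end NSTORMRun

/-! ### Local smoothness and descent along normalized steps -/

/-- With `u = v / ‖v‖`, `⟨w, u⟩ = ‖v‖ - ⟨v - w, u⟩ ≥ ‖v‖ - ‖v - w‖ ≥ ‖w‖ - 2‖v - w‖`. For `v = 0`
the direction vanishes and the error is `‖w‖` itself, so the bound persists. -/
theorem inner_neg_normalized_le {E : Type*} [NormedAddCommGroup E] [InnerProductSpace ℝ E]
    (w v : E) : inner ℝ w (-(‖v‖⁻¹ • v)) ≤ -‖w‖ + 2 * ‖v - w‖ := by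
  rcases eq_or_ne v 0 with rfl | hv
  · simp only [norm_zero, inv_zero, zero_smul, neg_zero, inner_zero_right, zero_sub, norm_neg]
    linarith [norm_nonneg w]
  have hv' : 0 < ‖v‖ := norm_pos_iff.2 hv
  have h1 : inner ℝ v (‖v‖⁻¹ • v) = ‖v‖ := by
    rw [inner_smul_right, real_inner_self_eq_norm_sq]; field_simp
  have h2 : inner ℝ (v - w) (‖v‖⁻¹ • v) ≤ ‖v - w‖ := by
    refine (real_inner_le_norm _ _).trans ?_
    rw [norm_smul, norm_inv, norm_norm, inv_mul_cancel₀ hv'.ne', mul_one]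
  rw [inner_sub_left, h1] at h2
  rw [inner_neg_right]
  have h3 := norm_sub_norm_le w v
  rw [norm_sub_rev] at h3
  linarith

namespace BG0Problem

variable {d : ℕ} {Ξ : Type u} [MeasurableSpace Ξ] {B G : ℝ} (Q : BG0Problem d Ξ B G)

/-- Mean-square smoothness for steps of length at most `γ` from points at distance at most `r`
from `x⁰`, with a constant growing affinely in the norm of the gradient. -/
def LocallySmooth (r γ A M : ℝ) : Prop :=
  ∀ x y, ‖x - Q.x0‖ ≤ r → ‖y - x‖ ≤ γ →
    lpNorm (fun ξ => Q.g y ξ - Q.g x ξ) 2 Q.law ≤ ‖y - x‖ * (A + M * ‖gradient Q.f x‖)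

theorem ciInf_le_f (x : EuclideanSpace ℝ (Fin d)) : ⨅ z, Q.f z ≤ Q.f x := ciInf_le Q.bddBelow x

variable {Q}

theorem LocallySmooth.descent {r γ A M : ℝ} (h : Q.LocallySmooth r γ A M)
    {x y : EuclideanSpace ℝ (Fin d)} (hx : ‖x - Q.x0‖ ≤ r) (hy : ‖y - x‖ ≤ γ) :
    Q.f y ≤ Q.f x + inner ℝ (gradient Q.f x) (y - x)
      + (A + M * ‖gradient Q.f x‖) / 2 * ‖y - x‖ ^ 2 := by
  refine le_add_inner_gradient_of_norm_gradient_sub_le Q.differentiable fun θ hθ => ?_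
  have h1 : x + θ • (y - x) - x = θ • (y - x) := by abel
  have h2 : ‖θ • (y - x)‖ = θ * ‖y - x‖ := by rw [norm_smul, Real.norm_of_nonneg hθ.1]
  have h3 := h x (x + θ • (y - x)) hx (by
    rw [h1, h2]; exact (mul_le_of_le_one_left (norm_nonneg _) hθ.2).trans hy)
  rw [h1, h2] at h3
  exact ((Q.norm_gradient_sub_le _ _).trans h3).trans_eq (mul_comm _ _)

end BG0Problem

namespace NSTORMRun

variable {d : ℕ} {Ξ : Type u} [MeasurableSpace Ξ] {B G : ℝ} {Q : BG0Problem d Ξ B G}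
  {N K : ℕ} {Ω : Type v} [MeasurableSpace Ω] (R : NSTORMRun Q N K Ω) {γ η A M : ℝ}

theorem norm_state_x_sub_le' (hγ : 0 ≤ γ) {k : ℕ} (hk : k ≤ K + 1) (ω : Ω) :
    ‖(R.state γ η k ω).x - Q.x0‖ ≤ ((K : ℝ) + 1) * γ := by
  refine (R.norm_state_x_sub_le η hγ k ω).trans (mul_le_mul_of_nonneg_right ?_ hγ)
  exact_mod_cast hk

/-- Each step changes the gradient by at most `γ (A + M ‖∇f‖)`, so induction on the finite horizon
gives a sure bound. Its size is irrelevant; it only provides integrability. -/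
theorem exists_norm_gradient_le (hγ : 0 ≤ γ) (hA : 0 ≤ A) (hM : 0 ≤ M)
    (h : Q.LocallySmooth (((K : ℝ) + 1) * γ) γ A M) {k : ℕ} (hk : k ≤ K + 1) :
    ∃ C, ∀ ω, ‖gradient Q.f (R.state γ η k ω).x‖ ≤ C := by
  induction k with
  | zero => exact ⟨‖gradient Q.f Q.x0‖, fun ω => le_rfl⟩
  | succ k ih =>
    obtain ⟨C, hC⟩ := ih (by omega)
    refine ⟨γ * (A + M * C) + C, fun ω => ?_⟩
    have hstep := R.norm_state_succ_x_sub_le η hγ k ω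
    have h1 := (Q.norm_gradient_sub_le _ _).trans
      (h _ (R.state γ η (k + 1) ω).x (R.norm_state_x_sub_le' hγ (by omega) ω) hstep)
    have h2 := norm_sub_norm_le (gradient Q.f (R.state γ η (k + 1) ω).x)
      (gradient Q.f (R.state γ η k ω).x)
    have h3 : ‖(R.state γ η (k + 1) ω).x - (R.state γ η k ω).x‖ *
        (A + M * ‖gradient Q.f (R.state γ η k ω).x‖) ≤ γ * (A + M * C) := by
      have := hC ω
      gcongr
    linarith [hC ω]

theorem integrable_norm_gradient (hγ : 0 ≤ γ) (hA : 0 ≤ A) (hM : 0 ≤ M)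
    (h : Q.LocallySmooth (((K : ℝ) + 1) * γ) γ A M) {k : ℕ} (hk : k ≤ K + 1) :
    Integrable (fun ω => ‖gradient Q.f (R.state γ η k ω).x‖) R.P := by
  obtain ⟨C, hC⟩ := R.exists_norm_gradient_le (η := η) hγ hA hM h hk
  exact (integrable_const C).mono'
    (Q.measurable_gradient.comp (R.measurable_x γ η k)).norm.aestronglyMeasurable
    (ae_of_all _ fun ω => by simpa using hC ω)

theorem f_state_succ_le (hγ : 0 ≤ γ) (hA : 0 ≤ A) (hM : 0 ≤ M)
    (h : Q.LocallySmooth (((K : ℝ) + 1) * γ) γ A M) {k : ℕ} (hk : k ≤ K) (ω : Ω) :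
    Q.f (R.state γ η (k + 1) ω).x ≤ Q.f (R.state γ η k ω).x
      - γ * ‖gradient Q.f (R.state γ η k ω).x‖
      + 2 * γ * ‖(R.state γ η k ω).v - gradient Q.f (R.state γ η k ω).x‖
      + γ ^ 2 / 2 * (A + M * ‖gradient Q.f (R.state γ η k ω).x‖) := by
  have hstep := R.norm_state_succ_x_sub_le η hγ k ω
  have h1 := h.descent (R.norm_state_x_sub_le' hγ (η := η) (k := k) (by omega) ω) hstep
  have h2 : (R.state γ η (k + 1) ω).x - (R.state γ η k ω).x =
      γ • (-(‖(R.state γ η k ω).v‖⁻¹ • (R.state γ η k ω).v)) := by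
    rw [state_succ_x]; module
  have h3 := mul_le_mul_of_nonneg_left (inner_neg_normalized_le
    (gradient Q.f (R.state γ η k ω).x) (R.state γ η k ω).v) hγ
  have h4 : (A + M * ‖gradient Q.f (R.state γ η k ω).x‖) / 2 *
      ‖(R.state γ η (k + 1) ω).x - (R.state γ η k ω).x‖ ^ 2 ≤
      (A + M * ‖gradient Q.f (R.state γ η k ω).x‖) / 2 * γ ^ 2 := by gcongr
  have h5 : inner ℝ (gradient Q.f (R.state γ η k ω).x)
      ((R.state γ η (k + 1) ω).x - (R.state γ η k ω).x) =
      γ * inner ℝ (gradient Q.f (R.state γ η k ω).x)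
        (-(‖(R.state γ η k ω).v‖⁻¹ • (R.state γ η k ω).v)) := by
    rw [h2, inner_smul_right]
  linarith

theorem sum_norm_gradient_le (hγ : 0 ≤ γ) (hA : 0 ≤ A) (hM : 0 ≤ M)
    (h : Q.LocallySmooth (((K : ℝ) + 1) * γ) γ A M) (ω : Ω) :
    γ * ∑ k ∈ Finset.range (K + 1), ‖gradient Q.f (R.state γ η k ω).x‖ ≤ Q.gap
      + 2 * γ * ∑ k ∈ Finset.range (K + 1),
          ‖(R.state γ η k ω).v - gradient Q.f (R.state γ η k ω).x‖
      + γ ^ 2 / 2 * (((K : ℝ) + 1) * A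
        + M * ∑ k ∈ Finset.range (K + 1), ‖gradient Q.f (R.state γ η k ω).x‖) := by
  have h1 : ∀ n ≤ K + 1, γ * ∑ k ∈ Finset.range n, ‖gradient Q.f (R.state γ η k ω).x‖ ≤
      Q.f Q.x0 - Q.f (R.state γ η n ω).x
      + 2 * γ * ∑ k ∈ Finset.range n,
          ‖(R.state γ η k ω).v - gradient Q.f (R.state γ η k ω).x‖
      + γ ^ 2 / 2 * (n * A
        + M * ∑ k ∈ Finset.range n, ‖gradient Q.f (R.state γ η k ω).x‖) := by
    intro n
    induction n with
    | zero => simp [state_zero_x]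
    | succ n ih =>
      intro hn
      have := ih (by omega)
      have h2 := R.f_state_succ_le (η := η) hγ hA hM h (show n ≤ K by omega) ω
      simp only [Finset.sum_range_succ]
      push_cast
      linarith
  have h2 := h1 (K + 1) le_rfl
  have h3 := Q.ciInf_le_f (R.state γ η (K + 1) ω).x
  push_cast at h2
  unfold BG0Problem.gap
  linarith

/-! ### Splitting the accumulated noise into an `L²` and an `L¹` part -/

theorem lpNorm_increment_state_le (hB : 0 ≤ B) (hG : 0 ≤ G) (hγ : 0 ≤ γ) (hη : 0 ≤ η)
    (hη1 : η ≤ 1) (hA : 0 ≤ A) (hM : 0 ≤ M)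
    (h : Q.LocallySmooth (((K : ℝ) + 1) * γ) γ A M) {k : ℕ} (hk : k ≤ K) (ω : Ω) :
    lpNorm (Q.increment η (R.state γ η k ω).x (R.state γ η (k + 1) ω).x) 2 Q.law ≤
      (γ * A + η * (B * (((K : ℝ) + 1) * γ) + G))
        + γ * M * ‖gradient Q.f (R.state γ η k ω).x‖ := by
  have hstep := R.norm_state_succ_x_sub_le η hγ k ω
  have h1 := Q.lpNorm_increment_le hB hG hη hη1 (R.state γ η k ω).x (R.state γ η (k + 1) ω).x
  have h2 := h _ _ (R.norm_state_x_sub_le' hγ (η := η) (k := k) (by omega) ω) hstep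
  have h3 := R.norm_state_x_sub_le' hγ (η := η) (k := k + 1) (by omega) ω
  have h4 : ‖(R.state γ η (k + 1) ω).x - (R.state γ η k ω).x‖ *
      (A + M * ‖gradient Q.f (R.state γ η k ω).x‖) ≤
      γ * (A + M * ‖gradient Q.f (R.state γ η k ω).x‖) := by gcongr
  have h5 : η * (B * ‖(R.state γ η (k + 1) ω).x - Q.x0‖ + G) ≤
    η * (B * (((K : ℝ) + 1) * γ) + G) := by gcongr
  linarith

/-- The weight that splits an increment of size at most `c + m ‖∇f(x)‖` into a part of size at
most `c` and a part of size at most `m ‖∇f(x)‖`. -/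
noncomputable def splitWeight (Q : BG0Problem d Ξ B G) (c m : ℝ)
    (x : EuclideanSpace ℝ (Fin d)) : ℝ := c / (c + m * ‖gradient Q.f x‖)

theorem measurable_splitWeight (c m : ℝ) : Measurable (splitWeight Q c m) :=
  measurable_const.div ((Q.measurable_gradient.norm.const_mul m).const_add c)

theorem splitWeight_nonneg {c m : ℝ} (hc : 0 ≤ c) (hm : 0 ≤ m) (x : EuclideanSpace ℝ (Fin d)) :
    0 ≤ splitWeight Q c m x := by
  unfold splitWeight; positivity

theorem splitWeight_le_one {c m : ℝ} (hc : 0 ≤ c) (hm : 0 ≤ m) (x : EuclideanSpace ℝ (Fin d)) :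
    splitWeight Q c m x ≤ 1 := by
  have : 0 ≤ m * ‖gradient Q.f x‖ := by positivity
  exact div_le_one_of_le₀ (by linarith) (by linarith)

theorem splitWeight_mul_le {c m : ℝ} (hc : 0 ≤ c) (x : EuclideanSpace ℝ (Fin d)) :
    splitWeight Q c m x * (c + m * ‖gradient Q.f x‖) ≤ c := by
  unfold splitWeight
  -- In the degenerate case the quotient is `0` by convention, and the product vanishes anyway.
  by_cases h : c + m * ‖gradient Q.f x‖ = 0
  · rw [h, mul_zero]; exact hc
  · rw [div_mul_cancel₀ _ h]

theorem one_sub_splitWeight_mul_le {c m : ℝ} (hm : 0 ≤ m) (x : EuclideanSpace ℝ (Fin d)) :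
    (1 - splitWeight Q c m x) * (c + m * ‖gradient Q.f x‖) ≤ m * ‖gradient Q.f x‖ := by
  have h0 : 0 ≤ m * ‖gradient Q.f x‖ := by positivity
  unfold splitWeight
  by_cases h : c + m * ‖gradient Q.f x‖ = 0
  · rw [h, mul_zero]; exact h0
  · rw [sub_mul, div_mul_cancel₀ _ h]; linarith

theorem measurable_weighted_increment {p : EuclideanSpace ℝ (Fin d) → ℝ} (hp : Measurable p) :
    Measurable fun q : ((EuclideanSpace ℝ (Fin d) × EuclideanSpace ℝ (Fin d))
      × EuclideanSpace ℝ (Fin d)) × Ξ => p q.1.1.1 • Q.increment η q.1.1.1 q.1.1.2 q.2 := by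
  have h1 := (Q.measurable_increment η).comp (measurable_fst.fst.prodMk measurable_snd :
    Measurable fun q : ((EuclideanSpace ℝ (Fin d) × EuclideanSpace ℝ (Fin d))
      × EuclideanSpace ℝ (Fin d)) × Ξ => (q.1.1, q.2))
  exact (hp.comp measurable_fst.fst.fst).smul h1

theorem measurable_transition_history {p : EuclideanSpace ℝ (Fin d) → ℝ} (hp : Measurable p)
    (k : ℕ) : Measurable[R.history k] fun ω =>
      (((R.state γ η k ω).x, (R.state γ η (k + 1) ω).x), R.noise γ η p k ω) := by
  obtain ⟨h1, -, h3⟩ := R.measurable_state_history γ η k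
  exact (h1.prodMk h3).prodMk (R.measurable_noise_history γ η hp k)

theorem measurable_transition {p : EuclideanSpace ℝ (Fin d) → ℝ} (hp : Measurable p)
    (k : ℕ) : Measurable fun ω =>
      (((R.state γ η k ω).x, (R.state γ η (k + 1) ω).x), R.noise γ η p k ω) :=
  ((R.measurable_x γ η k).prodMk (R.measurable_x γ η (k + 1))).prodMk (R.measurable_noise γ η hp k)

theorem memLp_smul_increment (a : ℝ) (x y : EuclideanSpace ℝ (Fin d)) :
    MemLp (fun ξ => a • Q.increment η x y ξ) 2 Q.law :=
  (Q.memLp_increment η x y).const_smul a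

theorem lpNorm_weighted_increment_le {p : EuclideanSpace ℝ (Fin d) → ℝ} {x y} {b : ℝ}
    (hp : 0 ≤ p x) (hb : lpNorm (Q.increment η x y) 2 Q.law ≤ b) :
    lpNorm (fun ξ => p x • Q.increment η x y ξ) 2 Q.law ≤ p x * b := by
  have h := lpNorm_const_smul (p := 2) (p x) (Q.increment η x y) Q.law
  have e : ((‖p x‖₊ : NNReal) : ℝ) = p x := by rw [coe_nnnorm, Real.norm_of_nonneg hp]
  rw [e] at h
  exact h.le.trans (mul_le_mul_of_nonneg_left hb hp)

/-- The weighted increments are conditionally centred with conditional `L²` norm at most `c`.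
Orthogonality gives the recursion `a ↦ (1 - η)² a + c²` for second moments, under which the level
`c² / η` is preserved. -/
theorem memLp_noise_splitWeight (hB : 0 ≤ B) (hG : 0 ≤ G) (hγ : 0 ≤ γ) (hη : 0 < η)
    (hη1 : η ≤ 1) (hA : 0 ≤ A) (hM : 0 ≤ M)
    (h : Q.LocallySmooth (((K : ℝ) + 1) * γ) γ A M) {c : ℝ}
    (hc : c = γ * A + η * (B * (((K : ℝ) + 1) * γ) + G)) {k : ℕ} (hk : k ≤ K) :
    MemLp (R.noise γ η (splitWeight Q c (γ * M)) k) 2 R.P ∧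
      lpNorm (R.noise γ η (splitWeight Q c (γ * M)) k) 2 R.P ^ 2 ≤ c ^ 2 / η := by
  have hc0 : 0 ≤ c := by rw [hc]; positivity
  have hm0 : 0 ≤ γ * M := by positivity
  set p := splitWeight Q c (γ * M) with hp
  have hpm : Measurable p := measurable_splitWeight _ _
  induction k with
  | zero =>
    have : R.noise γ η p 0 = fun _ => 0 := rfl
    rw [this]
    refine ⟨MemLp.zero, ?_⟩
    rw [lpNorm_fun_zero, zero_pow two_ne_zero]
    positivity
  | succ k ih =>
    obtain ⟨h1, h2⟩ := ih (by omega)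
    have hW := R.measurable_transition (γ := γ) (η := η) hpm k
    have hind := R.indepFun_history (R.measurable_transition_history (γ := γ) (η := η) hpm k)
    have hφ := measurable_weighted_increment (Q := Q) (η := η) hpm
    have hL : ∀ ω, MemLp (fun ξ => p (R.state γ η k ω).x • Q.increment η (R.state γ η k ω).x
        (R.state γ η (k + 1) ω).x ξ) 2 Q.law := fun ω =>
      memLp_smul_increment _ _ _
    have hb : ∀ ω, lpNorm (fun ξ => p (R.state γ η k ω).x • Q.increment η (R.state γ η k ω).x
        (R.state γ η (k + 1) ω).x ξ) 2 Q.law ≤ c := fun ω => by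
      have hb1 := R.lpNorm_increment_state_le hB hG hγ hη.le hη1 hA hM h
        (show k ≤ K by omega) ω
      rw [← hc] at hb1
      exact (lpNorm_weighted_increment_le (splitWeight_nonneg hc0 hm0 _) hb1).trans
        (splitWeight_mul_le hc0 _)
    obtain ⟨hS, hSb⟩ := hind.memLp_two_comp_prodMk hW (R.measurable_s k) (R.map_s k) hφ hL hb
    -- The weight depends on `x^k` only, which the history determines, so multiplying by it keeps
    -- the increment centred.
    have h0 := hind.integral_inner_comp_prodMk_eq_zero hW (R.measurable_s k) (R.map_s k) hφ
      (fun ω => (hL ω).integrable (by norm_num)) measurable_snd h1 hS (fun ω => by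
        simp only []
        rw [integral_smul, Q.integral_increment, smul_zero])
    simp only [] at hS hSb h0
    set S : Ω → EuclideanSpace ℝ (Fin d) := fun ω => p (R.state γ η k ω).x •
      Q.increment η (R.state γ η k ω).x (R.state γ η (k + 1) ω).x (R.s k ω) with hSdef
    have heq : R.noise γ η p (k + 1) = fun ω => (1 - η) • R.noise γ η p k ω + S ω := by
      funext ω; exact R.noise_succ γ η p k ω
    have hmem : MemLp (R.noise γ η p (k + 1)) 2 R.P := by
      rw [heq]; exact (h1.const_smul (1 - η)).add hS
    refine ⟨hmem, ?_⟩
    have hi : Integrable (fun ω => inner ℝ (R.noise γ η p k ω) (S ω)) R.P :=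
      integrable_inner_of_memLp_two h1 hS
    have hexp : ∀ ω, ‖R.noise γ η p (k + 1) ω‖ ^ 2 = (1 - η) ^ 2 * ‖R.noise γ η p k ω‖ ^ 2
        + (2 * (1 - η) * inner ℝ (R.noise γ η p k ω) (S ω) + ‖S ω‖ ^ 2) := fun ω => by
      rw [heq]
      simp only []
      rw [norm_add_sq_real, norm_smul, inner_smul_left, mul_pow, Real.norm_eq_abs, sq_abs]
      simp only [conj_trivial]
      ring
    have hint : ∫ ω, ‖R.noise γ η p (k + 1) ω‖ ^ 2 ∂(R.P) =
        (1 - η) ^ 2 * ∫ ω, ‖R.noise γ η p k ω‖ ^ 2 ∂(R.P) + ∫ ω, ‖S ω‖ ^ 2 ∂(R.P) := by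
      simp_rw [hexp]
      have i1 : Integrable (fun ω => (1 - η) ^ 2 * ‖R.noise γ η p k ω‖ ^ 2) R.P :=
        h1.norm.integrable_sq.const_mul _
      have i2 : Integrable (fun ω => 2 * (1 - η) * inner ℝ (R.noise γ η p k ω) (S ω)) R.P :=
        hi.const_mul _
      have i3 : Integrable (fun ω => ‖S ω‖ ^ 2) R.P := hS.norm.integrable_sq
      have i4 : Integrable (fun ω => 2 * (1 - η) * inner ℝ (R.noise γ η p k ω) (S ω)
        + ‖S ω‖ ^ 2) R.P := i2.add i3
      rw [integral_add i1 i4, integral_add i2 i3, integral_const_mul, integral_const_mul, h0]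
      ring
    rw [lpNorm_two_sq hmem.1, hint, ← lpNorm_two_sq h1.1, ← lpNorm_two_sq hS.1]
    have h6 : lpNorm S 2 R.P ^ 2 ≤ c ^ 2 := pow_le_pow_left₀ lpNorm_nonneg hSb 2
    have h7 : (1 - η) ^ 2 * lpNorm (R.noise γ η p k) 2 R.P ^ 2 ≤ (1 - η) ^ 2 * (c ^ 2 / η) := by
      gcongr
    refine (add_le_add h7 h6).trans ?_
    rw [le_div_iff₀ hη]
    have h8 : ((1 - η) ^ 2 * (c ^ 2 / η) + c ^ 2) * η = c ^ 2 * ((1 - η) ^ 2 + η) := by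
      field_simp
    rw [h8]
    -- What remains is `(1 - η)² + η ≤ 1`, that is, `η (1 - η) ≥ 0`.
    nlinarith [sq_nonneg c, mul_nonneg hη.le (sub_nonneg.2 hη1)]

/-- The gradient-sized part is kept in `L¹`, so that it can be compared with the `E‖∇f‖` being
estimated. The triangle inequality gives `b_{k+1} ≤ (1 - η) b_k + γM E‖∇f(x^k)‖`; carrying the
leftover `(1 - η) b_k` in the statement makes the summed form close by induction. -/
theorem integrable_noise_one_sub_splitWeight (hB : 0 ≤ B) (hG : 0 ≤ G) (hγ : 0 ≤ γ) (hη : 0 < η)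
    (hη1 : η ≤ 1) (hA : 0 ≤ A) (hM : 0 ≤ M)
    (h : Q.LocallySmooth (((K : ℝ) + 1) * γ) γ A M) {c : ℝ}
    (hc : c = γ * A + η * (B * (((K : ℝ) + 1) * γ) + G)) {k : ℕ} (hk : k ≤ K) :
    Integrable (R.noise γ η (fun x => 1 - splitWeight Q c (γ * M) x) k) R.P ∧
      η * ∑ j ∈ Finset.range (k + 1),
          ∫ ω, ‖R.noise γ η (fun x => 1 - splitWeight Q c (γ * M) x) j ω‖ ∂(R.P)
        + (1 - η) * ∫ ω, ‖R.noise γ η (fun x => 1 - splitWeight Q c (γ * M) x) k ω‖ ∂(R.P)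
      ≤ γ * M * ∑ j ∈ Finset.range k, ∫ ω, ‖gradient Q.f (R.state γ η j ω).x‖ ∂(R.P) := by
  have hc0 : 0 ≤ c := by rw [hc]; positivity
  have hm0 : 0 ≤ γ * M := by positivity
  set p : EuclideanSpace ℝ (Fin d) → ℝ := fun x => 1 - splitWeight Q c (γ * M) x with hp
  have hpm : Measurable p := measurable_const.sub (measurable_splitWeight _ _)
  induction k with
  | zero =>
    have : R.noise γ η p 0 = fun _ => 0 := rfl
    simp [this]
  | succ k ih =>
    obtain ⟨h1, h2⟩ := ih (by omega)
    have hW := R.measurable_transition (γ := γ) (η := η) hpm k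
    have hind := R.indepFun_history (R.measurable_transition_history (γ := γ) (η := η) hpm k)
    have hφ := measurable_weighted_increment (Q := Q) (η := η) hpm
    have hL : ∀ ω, MemLp (fun ξ => p (R.state γ η k ω).x • Q.increment η (R.state γ η k ω).x
        (R.state γ η (k + 1) ω).x ξ) 2 Q.law := fun ω =>
      memLp_smul_increment _ _ _
    have hgi := R.integrable_norm_gradient (η := η) hγ hA hM h (show k ≤ K + 1 by omega)
    have hb : ∀ ω, lpNorm (fun ξ => p (R.state γ η k ω).x • Q.increment η (R.state γ η k ω).x
        (R.state γ η (k + 1) ω).x ξ) 2 Q.law ≤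
        γ * M * ‖gradient Q.f (R.state γ η k ω).x‖ := fun ω => by
      have hb1 := R.lpNorm_increment_state_le hB hG hγ hη.le hη1 hA hM h
        (show k ≤ K by omega) ω
      rw [← hc] at hb1
      exact (lpNorm_weighted_increment_le
        (sub_nonneg.2 (splitWeight_le_one hc0 hm0 _)) hb1).trans
        (one_sub_splitWeight_mul_le hm0 _)
    obtain ⟨hS, hSb⟩ := hind.integrable_comp_prodMk hW (R.measurable_s k) (R.map_s k) hφ hL
      (hgi.const_mul (γ * M)) hb
    simp only [integral_const_mul] at hS hSb
    set S : Ω → EuclideanSpace ℝ (Fin d) := fun ω => p (R.state γ η k ω).x •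
      Q.increment η (R.state γ η k ω).x (R.state γ η (k + 1) ω).x (R.s k ω) with hSdef
    have heq : R.noise γ η p (k + 1) = fun ω => (1 - η) • R.noise γ η p k ω + S ω := by
      funext ω; exact R.noise_succ γ η p k ω
    have hint : Integrable (R.noise γ η p (k + 1)) R.P := by
      rw [heq]; exact (h1.smul (1 - η)).add hS
    refine ⟨hint, ?_⟩
    have hle : ∫ ω, ‖R.noise γ η p (k + 1) ω‖ ∂(R.P) ≤
        (1 - η) * ∫ ω, ‖R.noise γ η p k ω‖ ∂(R.P) + ∫ ω, ‖S ω‖ ∂(R.P) := by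
      rw [← integral_const_mul, ← integral_add (h1.norm.const_mul _) hS.norm]
      refine integral_mono hint.norm ((h1.norm.const_mul _).add hS.norm) fun ω => ?_
      rw [heq]
      simp only []
      refine (norm_add_le _ _).trans_eq ?_
      rw [norm_smul, Real.norm_of_nonneg (sub_nonneg.2 hη1)]
    rw [Finset.sum_range_succ _ (k + 1),
      Finset.sum_range_succ (fun j => ∫ ω, ‖gradient Q.f (R.state γ η j ω).x‖ ∂(R.P)) k]
    have hSb' : ∫ ω, ‖S ω‖ ∂(R.P) ≤
      γ * M * ∫ ω, ‖gradient Q.f (R.state γ η k ω).x‖ ∂(R.P) := hSb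
    linarith

end NSTORMRun

/-! ### Initial error and the general bound -/

namespace NSTORMRun

variable {d : ℕ} {Ξ : Type u} [MeasurableSpace Ξ] {B G : ℝ} {Q : BG0Problem d Ξ B G}
  {N K : ℕ} {Ω : Type v} [MeasurableSpace Ω] (R : NSTORMRun Q N K Ω) {γ η A M : ℝ}

theorem memLp_comp_s₀ {F : Ξ → EuclideanSpace ℝ (Fin d)} (hF : MemLp F 2 Q.law) (i : Fin N) :
    MemLp (fun ω => F (R.s₀ i ω)) 2 R.P := by
  rw [← R.map_s₀ i] at hF
  exact hF.comp_of_map (R.measurable_s₀ i).aemeasurable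

theorem memLp_initial_error :
    MemLp (fun ω => (R.state γ η 0 ω).v - gradient Q.f Q.x0) 2 R.P := by
  have h : MemLp (fun ω => ∑ i, Q.g Q.x0 (R.s₀ i ω)) 2 R.P :=
    memLp_finsetSum _ fun i _ => R.memLp_comp_s₀ (Q.memLp Q.x0) i
  exact (h.const_smul (N : ℝ)⁻¹).sub (memLp_const _)

theorem initError_nonneg : 0 ≤ R.initError γ η := integral_nonneg fun _ => norm_nonneg _

/-- Independence of the initial samples removes the off-diagonal inner products. Each diagonal term
is a variance at `x⁰`, where the `B` term vanishes. -/
theorem integral_norm_sum_noise_sq_le :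
    ∫ ω, ‖∑ i, (Q.g Q.x0 (R.s₀ i ω) - gradient Q.f Q.x0)‖ ^ 2 ∂(R.P) ≤ N * G ^ 2 := by
  set X : Ξ → EuclideanSpace ℝ (Fin d) := fun ξ => Q.g Q.x0 ξ - gradient Q.f Q.x0 with hX
  have hXL : MemLp X 2 Q.law := Q.memLp_noise Q.x0
  have hXm : Measurable X := (Q.measurable_g Q.x0).sub measurable_const
  have hX0 : ∫ ξ, X ξ ∂Q.law = 0 := by
    rw [hX, integral_sub (Q.integrable_g _) (integrable_const _), Q.unbiased]; simp
  have hi : ∀ i j, Integrable (fun ω => inner ℝ (X (R.s₀ i ω)) (X (R.s₀ j ω))) R.P := fun i j =>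
    integrable_inner_of_memLp_two (R.memLp_comp_s₀ hXL i) (R.memLp_comp_s₀ hXL j)
  have hoff : ∀ i j, j ≠ i → ∫ ω, inner ℝ (X (R.s₀ i ω)) (X (R.s₀ j ω)) ∂(R.P) = 0 :=
    fun i j hij => by
    have hind : IndepFun (R.s₀ i) (R.s₀ j) R.P :=
      R.iIndepFun_samples.indepFun (i := Sum.inl i) (j := Sum.inl j) (by simpa using hij.symm)
    exact hind.integral_inner_comp_prodMk_eq_zero (R.measurable_s₀ i) (R.measurable_s₀ j)
      (R.map_s₀ j) (φ := fun q : Ξ × Ξ => X q.2) (hXm.comp measurable_snd)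
      (fun _ => hXL.integrable (by norm_num)) hXm (R.memLp_comp_s₀ hXL i)
      (R.memLp_comp_s₀ hXL j) fun _ => hX0
  have hdiag : ∀ i, ∫ ω, inner ℝ (X (R.s₀ i ω)) (X (R.s₀ i ω)) ∂(R.P) ≤ G ^ 2 := fun i => by
    simp_rw [real_inner_self_eq_norm_sq]
    have h1 := Q.variance Q.x0
    rw [sub_self, norm_zero] at h1
    rw [← integral_map (f := fun ξ => ‖X ξ‖ ^ 2) (R.measurable_s₀ i).aemeasurable
      (hXm.norm.pow_const 2).aestronglyMeasurable, R.map_s₀ i]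
    simpa using h1
  simp_rw [← real_inner_self_eq_norm_sq, sum_inner, inner_sum]
  rw [integral_finsetSum _ fun i _ => integrable_finsetSum _ fun j _ => hi i j]
  refine (Finset.sum_le_card_nsmul _ _ (G ^ 2) fun i _ => ?_).trans_eq (by simp)
  rw [integral_finsetSum _ fun j _ => hi i j, Finset.sum_eq_single i (fun j _ h => hoff i j h)
    (by simp)]
  exact hdiag i

theorem initError_le (hG : 0 ≤ G) (hN : 0 < N) : R.initError γ η ≤ G / √N := by
  have hN' : (0 : ℝ) < N := by exact_mod_cast hN
  have h1 : R.initError γ η ≤ _ := integral_norm_le_lpNorm_two R.memLp_initial_error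
  refine h1.trans (le_of_sq_le_sq ?_ (by positivity))
  rw [lpNorm_two_sq R.memLp_initial_error.1, div_pow, Real.sq_sqrt hN'.le]
  have h2 : ∀ ω, ‖(R.state γ η 0 ω).v - gradient Q.f Q.x0‖ ^ 2 =
      ((N : ℝ) ^ 2)⁻¹ * ‖∑ i, (Q.g Q.x0 (R.s₀ i ω) - gradient Q.f Q.x0)‖ ^ 2 := fun ω => by
    rw [state_zero_v, Finset.sum_sub_distrib, ← inv_pow, ← sq_abs (N : ℝ)⁻¹, ← Real.norm_eq_abs,
      ← mul_pow, ← norm_smul]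
    simp only [Finset.sum_const, Finset.card_univ, Fintype.card_fin, smul_sub]
    rw [← Nat.cast_smul_eq_nsmul ℝ, smul_smul, inv_mul_cancel₀ hN'.ne', one_smul]
  simp_rw [h2]
  rw [integral_const_mul]
  refine (mul_le_mul_of_nonneg_left R.integral_norm_sum_noise_sq_le (by positivity)).trans_eq ?_
  field_simp

theorem sum_one_sub_pow_le (hη : 0 < η) (hη1 : η ≤ 1) (n : ℕ) :
    ∑ k ∈ Finset.range n, (1 - η) ^ k ≤ 1 / η := by
  rw [le_div_iff₀ hη]
  have h := geom_sum_mul (1 - η) n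
  have : 0 ≤ (1 - η) ^ n := pow_nonneg (sub_nonneg.2 hη1) n
  linarith

/-- The initial error decays geometrically, the orthogonal part contributes `c / √η` through its
`L²` norm, and the `L¹` part is left unevaluated because it is only controlled after summation over
`k`. -/
theorem integrable_error (hB : 0 ≤ B) (hG : 0 ≤ G) (hγ : 0 ≤ γ) (hη : 0 < η)
    (hη1 : η ≤ 1) (hA : 0 ≤ A) (hM : 0 ≤ M)
    (h : Q.LocallySmooth (((K : ℝ) + 1) * γ) γ A M) {c : ℝ}
    (hc : c = γ * A + η * (B * (((K : ℝ) + 1) * γ) + G)) {k : ℕ} (hk : k ≤ K) :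
    Integrable (fun ω => (R.state γ η k ω).v - gradient Q.f (R.state γ η k ω).x) R.P ∧
      ∫ ω, ‖(R.state γ η k ω).v - gradient Q.f (R.state γ η k ω).x‖ ∂(R.P) ≤
        (1 - η) ^ k * R.initError γ η + c / √η
          + ∫ ω, ‖R.noise γ η (fun x => 1 - splitWeight Q c (γ * M) x) k ω‖ ∂(R.P) := by
  obtain ⟨ha, hab⟩ := R.memLp_noise_splitWeight hB hG hγ hη hη1 hA hM h hc hk
  obtain ⟨hb, -⟩ := R.integrable_noise_one_sub_splitWeight hB hG hγ hη hη1 hA hM h hc hk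
  have h0 : Integrable (fun ω => (R.state γ η 0 ω).v - gradient Q.f Q.x0) R.P :=
    R.memLp_initial_error.integrable (by norm_num)
  have hai := ha.integrable (q := 2) (by norm_num)
  have hc0 : 0 ≤ c := by rw [hc]; positivity
  have heq : (fun ω => (R.state γ η k ω).v - gradient Q.f (R.state γ η k ω).x) = fun ω =>
      (1 - η) ^ k • ((R.state γ η 0 ω).v - gradient Q.f Q.x0)
        + R.noise γ η (splitWeight Q c (γ * M)) k ω
        + R.noise γ η (fun x => 1 - splitWeight Q c (γ * M) x) k ω :=
    funext fun ω => R.error_eq γ η _ k ω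
  have hint : Integrable
      (fun ω => (R.state γ η k ω).v - gradient Q.f (R.state γ η k ω).x) R.P := by
    rw [heq]
    have h0' : Integrable
        (fun ω => (1 - η) ^ k • ((R.state γ η 0 ω).v - gradient Q.f Q.x0)) R.P :=
      h0.smul ((1 - η) ^ k)
    exact (h0'.add hai).add hb
  refine ⟨hint, ?_⟩
  have hsq : lpNorm (R.noise γ η (splitWeight Q c (γ * M)) k) 2 R.P ≤ c / √η := by
    refine le_of_sq_le_sq (hab.trans_eq ?_) (by positivity)
    rw [div_pow, Real.sq_sqrt hη.le]
  have h1 := (integral_norm_le_lpNorm_two ha).trans hsq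
  have hn0 := h0.norm.const_mul ((1 - η) ^ k)
  have h2 : ∫ ω, ‖(R.state γ η k ω).v - gradient Q.f (R.state γ η k ω).x‖ ∂(R.P) ≤
      ∫ ω, ((1 - η) ^ k * ‖(R.state γ η 0 ω).v - gradient Q.f Q.x0‖
        + ‖R.noise γ η (splitWeight Q c (γ * M)) k ω‖
        + ‖R.noise γ η (fun x => 1 - splitWeight Q c (γ * M) x) k ω‖) ∂(R.P) := by
    refine integral_mono hint.norm ((hn0.add hai.norm).add hb.norm) fun ω => ?_
    have e := congrFun heq ω
    simp only [] at e ⊢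
    rw [e]
    refine (norm_add_le _ _).trans (add_le_add_left ((norm_add_le _ _).trans_eq ?_) _)
    rw [norm_smul, Real.norm_of_nonneg (pow_nonneg (sub_nonneg.2 hη1) k)]
  have hn1 : Integrable (fun ω => (1 - η) ^ k * ‖(R.state γ η 0 ω).v - gradient Q.f Q.x0‖
        + ‖R.noise γ η (splitWeight Q c (γ * M)) k ω‖) R.P := hn0.add hai.norm
  rw [integral_add hn1 hb.norm, integral_add hn0 hai.norm, integral_const_mul] at h2
  have e0 : R.initError γ η = ∫ ω, ‖(R.state γ η 0 ω).v - gradient Q.f Q.x0‖ ∂(R.P) := rfl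
  rw [e0]
  linarith

/-- The convergence guarantee of normalized STORM in terms of the local smoothness constants. -/
theorem meanGradNorm_bound (hB : 0 ≤ B) (hG : 0 ≤ G) (hγ : 0 < γ) (hη : 0 < η)
    (hη1 : η ≤ 1) (hA : 0 ≤ A) (hM : 0 ≤ M)
    (h : Q.LocallySmooth (((K : ℝ) + 1) * γ) γ A M) :
    Integrable (R.gradNorm γ η) R.P ∧
      (1 - 2 * (γ * M / η) - γ * M / 2) * R.meanGradNorm γ η ≤
        Q.gap / (γ * ((K : ℝ) + 1)) + 2 * (R.initError γ η / (η * ((K : ℝ) + 1)))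
          + 2 * ((γ * A + η * (B * (((K : ℝ) + 1) * γ) + G)) / √η) + γ * A / 2 := by
  set c := γ * A + η * (B * (((K : ℝ) + 1) * γ) + G) with hc
  have hgi : ∀ k < K + 1, Integrable (fun ω => ‖gradient Q.f (R.state γ η k ω).x‖) R.P :=
    fun k hk => R.integrable_norm_gradient hγ.le hA hM h hk.le
  have hei := fun k (hk : k < K + 1) =>
    R.integrable_error hB hG hγ.le hη hη1 hA hM h hc (Nat.lt_succ_iff.1 hk)
  obtain ⟨-, hb⟩ := R.integrable_noise_one_sub_splitWeight hB hG hγ.le hη hη1 hA hM h hc le_rfl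
  obtain ⟨hint, hmean⟩ := R.integral_output γ η (F := fun x => ‖gradient Q.f x‖)
    Q.measurable_gradient.norm hgi
  refine ⟨hint, ?_⟩
  have hmean' : R.meanGradNorm γ η = ((K : ℝ) + 1)⁻¹ * ∑ k ∈ Finset.range (K + 1),
    ∫ ω, ‖gradient Q.f (R.state γ η k ω).x‖ ∂(R.P) := hmean
  set b : ℕ → ℝ := fun k =>
    ∫ ω, ‖R.noise γ η (fun x => 1 - splitWeight Q c (γ * M) x) k ω‖ ∂(R.P) with hbdef
  set g : ℕ → ℝ := fun k => ∫ ω, ‖gradient Q.f (R.state γ η k ω).x‖ ∂(R.P) with hg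
  set e : ℕ → ℝ := fun k =>
    ∫ ω, ‖(R.state γ η k ω).v - gradient Q.f (R.state γ η k ω).x‖ ∂(R.P) with he
  set S := ∑ k ∈ Finset.range (K + 1), g k with hS
  set T : ℝ := (K : ℝ) + 1 with hT
  have hT0 : 0 < T := by positivity
  have hdesc : γ * S ≤ Q.gap + 2 * γ * ∑ k ∈ Finset.range (K + 1), e k
      + γ ^ 2 / 2 * (T * A + M * S) := by
    have hG1 : Integrable (fun ω => ∑ k ∈ Finset.range (K + 1),
        ‖gradient Q.f (R.state γ η k ω).x‖) R.P :=
      integrable_finsetSum _ fun k hk => hgi k (Finset.mem_range.1 hk)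
    have hE1 : Integrable (fun ω => ∑ k ∈ Finset.range (K + 1),
        ‖(R.state γ η k ω).v - gradient Q.f (R.state γ η k ω).x‖) R.P :=
      integrable_finsetSum _ fun k hk => (hei k (Finset.mem_range.1 hk)).1.norm
    have eG : ∫ ω, ∑ k ∈ Finset.range (K + 1), ‖gradient Q.f (R.state γ η k ω).x‖ ∂(R.P) = S :=
      integral_finsetSum _ fun k hk => hgi k (Finset.mem_range.1 hk)
    have eE : ∫ ω, ∑ k ∈ Finset.range (K + 1),
        ‖(R.state γ η k ω).v - gradient Q.f (R.state γ η k ω).x‖ ∂(R.P)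
        = ∑ k ∈ Finset.range (K + 1), e k :=
      integral_finsetSum _ fun k hk => (hei k (Finset.mem_range.1 hk)).1.norm
    have i1 : Integrable (fun ω => Q.gap + 2 * γ * ∑ k ∈ Finset.range (K + 1),
        ‖(R.state γ η k ω).v - gradient Q.f (R.state γ η k ω).x‖) R.P :=
      (integrable_const _).add (hE1.const_mul _)
    have i2 : Integrable (fun ω => T * A + M * ∑ k ∈ Finset.range (K + 1),
        ‖gradient Q.f (R.state γ η k ω).x‖) R.P :=
      (integrable_const _).add (hG1.const_mul _)
    have hm := integral_mono (hG1.const_mul γ) (i1.add (i2.const_mul (γ ^ 2 / 2)))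
      fun ω => R.sum_norm_gradient_le hγ.le hA hM h ω
    simp only [Pi.add_apply] at hm
    rw [integral_add i1 (i2.const_mul _), integral_const_mul, integral_const_mul,
      integral_add (integrable_const _) (hE1.const_mul _),
      integral_add (integrable_const _) (hG1.const_mul _), integral_const_mul,
      integral_const_mul M, eG, eE] at hm
    simpa using hm
  have hesum : ∑ k ∈ Finset.range (K + 1), e k ≤
      (1 / η) * R.initError γ η + T * (c / √η) + ∑ k ∈ Finset.range (K + 1), b k := by
    have h1 := Finset.sum_le_sum fun k hk => (hei k (Finset.mem_range.1 hk)).2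
    rw [Finset.sum_add_distrib, Finset.sum_add_distrib, ← Finset.sum_mul, Finset.sum_const,
      Finset.card_range, nsmul_eq_mul] at h1
    have h2 := mul_le_mul_of_nonneg_right (sum_one_sub_pow_le hη hη1 (K + 1))
      (R.initError_nonneg (γ := γ) (η := η))
    push_cast at h1
    linarith
  -- The leftover `(1 - η) b K` is dropped, and the gradient sum, which stops at `K - 1`, is
  -- completed to `S`.
  have hbsum : ∑ k ∈ Finset.range (K + 1), b k ≤ γ * M / η * S := by
    have h1 : 0 ≤ (1 - η) * b K :=
      mul_nonneg (sub_nonneg.2 hη1) (integral_nonneg fun _ => norm_nonneg _)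
    have h2 : ∑ k ∈ Finset.range K, g k ≤ S := by
      rw [hS, Finset.sum_range_succ]
      exact le_add_of_nonneg_right (integral_nonneg fun _ => norm_nonneg _)
    have h3 : γ * M * ∑ k ∈ Finset.range K, g k ≤ γ * M * S := by gcongr
    rw [div_mul_eq_mul_div, le_div_iff₀ hη]
    linarith
  -- The sum `S` now stands on both sides; moving it to the left produces the factor `1 - 2γM/η -
  -- γM/2`.
  have hfin : γ * S ≤ Q.gap + 2 * γ * ((1 / η) * R.initError γ η + T * (c / √η)
      + γ * M / η * S) + γ ^ 2 / 2 * (T * A + M * S) := by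
    refine hdesc.trans ?_
    gcongr
    linarith
  have hS' : S = T * R.meanGradNorm γ η := by
    rw [hmean', ← mul_assoc, mul_inv_cancel₀ hT0.ne', one_mul]
  rw [hS'] at hfin
  have hγT : 0 < γ * T := by positivity
  have e1 : Q.gap / (γ * T) + 2 * (R.initError γ η / (η * T)) + 2 * (c / √η) + γ * A / 2 =
      (Q.gap + 2 * γ * ((1 / η) * R.initError γ η + T * (c / √η)) + γ ^ 2 / 2 * (T * A))
        / (γ * T) := by
    field_simp
    ring
  rw [e1, le_div_iff₀ hγT]
  linarith

end NSTORMRun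

/-! ### Symmetric smoothness along a segment -/

namespace BG0Problem

variable {d : ℕ} {Ξ : Type u} [MeasurableSpace Ξ] {B G : ℝ} {Q : BG0Problem d Ξ B G}
  {α L₀ L₁ : ℝ} {x y : EuclideanSpace ℝ (Fin d)}

/-- The point `x_θ = θ y + (1 - θ) x`. -/
abbrev segmentPoint (x y : EuclideanSpace ℝ (Fin d)) (θ : ℝ) : EuclideanSpace ℝ (Fin d) :=
  θ • y + (1 - θ) • x

theorem segmentMax_segmentPoint (s t : ℝ) (ξ : Ξ) :
    Q.segmentMax α (segmentPoint x y s) (segmentPoint x y t) ξ =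
      ⨆ θ : Set.Icc (0 : ℝ) 1, ‖Q.g (segmentPoint x y ((θ : ℝ) * t + (1 - θ) * s)) ξ‖ ^ α := by
  unfold segmentMax
  congr 1
  funext θ
  congr 3
  simp only [segmentPoint]
  module

theorem segmentMax_nonneg (ξ : Ξ) : 0 ≤ Q.segmentMax α x y ξ :=
  Real.iSup_nonneg fun _ => Real.rpow_nonneg (norm_nonneg _) _

theorem norm_segmentPoint_sub (s t : ℝ) :
    ‖segmentPoint x y t - segmentPoint x y s‖ = |t - s| * ‖y - x‖ := by
  rw [← Real.norm_eq_abs, ← norm_smul]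
  congr 1
  simp only [segmentPoint]
  module

theorem segmentMax_segmentPoint_le {ξ : Ξ} {s t C : ℝ}
    (h : ∀ θ ∈ Set.Icc s t, ‖Q.g (segmentPoint x y θ) ξ‖ ^ α ≤ C) (hst : s ≤ t) :
    Q.segmentMax α (segmentPoint x y s) (segmentPoint x y t) ξ ≤ C := by
  rw [segmentMax_segmentPoint]
  refine ciSup_le fun θ => h _ ?_
  have h0 := θ.2.1
  have h1 := θ.2.2
  constructor <;> nlinarith

section Segment

variable {ξ : Ξ} (hα : 0 < α)
  (hξ : ContinuousOn (fun θ : ℝ => Q.g (segmentPoint x y θ) ξ) (Set.Icc 0 1))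

include hα hξ

theorem continuousOn_norm_rpow_segment :
    ContinuousOn (fun θ : ℝ => ‖Q.g (segmentPoint x y θ) ξ‖ ^ α) (Set.Icc 0 1) :=
  hξ.norm.rpow_const fun _ _ => Or.inr hα.le

theorem le_segmentMax {θ : ℝ} (hθ : θ ∈ Set.Icc (0 : ℝ) 1) :
    ‖Q.g (segmentPoint x y θ) ξ‖ ^ α ≤ Q.segmentMax α x y ξ := by
  have hc := continuousOn_norm_rpow_segment hα hξ
  obtain ⟨C, hC⟩ := isCompact_Icc.bddAbove_image hc
  refine le_ciSup (f := fun θ : Set.Icc (0 : ℝ) 1 => ‖Q.g (segmentPoint x y θ) ξ‖ ^ α) ?_ ⟨θ, hθ⟩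
  refine ⟨C, ?_⟩
  rintro _ ⟨r, rfl⟩
  exact hC ⟨r, r.2, rfl⟩

/-- Continuity of the sample gradient bounds the maximum over a short subsegment from above, and the
left endpoint bounds it from below. -/
theorem tendsto_segmentMax {t : ℝ} (ht : t ∈ Set.Ico (0 : ℝ) 1) :
    Tendsto (fun u => Q.segmentMax α (segmentPoint x y t) (segmentPoint x y u) ξ) (𝓝[>] t)
      (𝓝 (‖Q.g (segmentPoint x y t) ξ‖ ^ α)) := by
  have hc := continuousOn_norm_rpow_segment hα hξ
  rw [Metric.tendsto_nhds]
  intro ε hε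
  obtain ⟨δ, hδ, hδ'⟩ := Metric.continuousOn_iff.1 hc t ⟨ht.1, ht.2.le⟩ (ε / 2) (half_pos hε)
  have hu : Set.Ioo t (min (t + δ) 1) ∈ 𝓝[>] t :=
    Ioo_mem_nhdsGT (lt_min (by linarith) ht.2)
  filter_upwards [hu] with u hu
  have hu1 := lt_min_iff.1 hu.2
  have hle := segmentMax_segmentPoint_le (Q := Q) (α := α) (x := x) (y := y) (ξ := ξ)
    (s := t) (t := u)
    (C := ‖Q.g (segmentPoint x y t) ξ‖ ^ α + ε / 2) (fun θ hθ => by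
      have := hδ' θ ⟨ht.1.trans hθ.1, hθ.2.trans hu1.2.le⟩ (by
        rw [Real.dist_eq, abs_lt]; constructor <;> linarith [hθ.1, hθ.2])
      rw [Real.dist_eq, abs_lt] at this
      linarith [this.2]) hu.1.le
  have hsub : ContinuousOn (fun θ : ℝ =>
      Q.g (segmentPoint (segmentPoint x y t) (segmentPoint x y u) θ) ξ) (Set.Icc 0 1) := by
    have e : (fun θ : ℝ => Q.g (segmentPoint (segmentPoint x y t) (segmentPoint x y u) θ) ξ) =
        (fun θ : ℝ => Q.g (segmentPoint x y θ) ξ) ∘ fun θ => θ * u + (1 - θ) * t := by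
      funext θ
      simp only [Function.comp, segmentPoint]
      congr 1
      module
    rw [e]
    refine hξ.comp (by fun_prop) fun θ hθ => ?_
    have h0 := hθ.1
    have h1 := hθ.2
    have h2 := ht.1
    have h3 := hu.1
    have h4 := hu1.2
    constructor <;> nlinarith
  have hge := le_segmentMax hα hsub (θ := 0) (by simp)
  simp only [segmentPoint, zero_smul, sub_zero, one_smul, zero_add] at hge
  rw [Real.dist_eq, abs_lt]
  constructor <;> linarith

end Segment

theorem integral_norm_rpow_le {F : Ξ → EuclideanSpace ℝ (Fin d)} {β : ℝ} (h0 : 0 ≤ β) (h1 : β ≤ 1)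
    {q : ℝ} (hF : Integrable (fun ξ => ‖F ξ‖ ^ q) Q.law) :
    Integrable (fun ξ => (‖F ξ‖ ^ q) ^ β) Q.law ∧
      ∫ ξ, (‖F ξ‖ ^ q) ^ β ∂Q.law ≤ (∫ ξ, ‖F ξ‖ ^ q ∂Q.law) ^ β := by
  have hnn : ∀ ξ, 0 ≤ ‖F ξ‖ ^ q := fun ξ => Real.rpow_nonneg (norm_nonneg _) _
  have hi : Integrable (fun ξ => (‖F ξ‖ ^ q) ^ β) Q.law := by
    refine ((integrable_const (1 : ℝ)).add hF).mono' ((Real.continuous_rpow_const h0).comp_aestronglyMeasurable hF.1)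
      (ae_of_all _ fun ξ => ?_)
    rw [Real.norm_of_nonneg (Real.rpow_nonneg (hnn ξ) _), Pi.add_apply]
    rcases le_total (‖F ξ‖ ^ q) 1 with h | h
    · linarith [Real.rpow_le_one (hnn ξ) h h0, hnn ξ]
    · have := Real.rpow_le_rpow_of_exponent_le h h1
      rw [Real.rpow_one] at this
      linarith
  exact ⟨hi, (Real.concaveOn_rpow h0 h1).le_map_integral
    (Real.continuous_rpow_const h0).continuousOn isClosed_Ici (ae_of_all _ hnn) hF hi⟩

/-- After the square is expanded, Jensen's inequality for the concave powers bounds `E‖F‖^α` and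
`E‖F‖^{2α}` by powers of the `L²` norm, and the square reassembles. -/
theorem integral_growth_sq_le {F : Ξ → EuclideanSpace ℝ (Fin d)} (hF : MemLp F 2 Q.law)
    (hα : 0 ≤ α) (hα1 : α ≤ 1) (hL₀ : 0 ≤ L₀) (hL₁ : 0 ≤ L₁) :
    ∫ ξ, (L₀ + L₁ * ‖F ξ‖ ^ α) ^ 2 ∂Q.law ≤ (L₀ + L₁ * lpNorm F 2 Q.law ^ α) ^ 2 := by
  obtain ⟨i1, h1⟩ := integral_norm_rpow_le (Q := Q) (F := F) hα hα1 (q := 1)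
    (by simpa using (hF.integrable (by norm_num)).norm)
  obtain ⟨i2, h2⟩ := integral_norm_rpow_le (Q := Q) (F := F) hα hα1 (q := 2)
    (by simpa using hF.norm.integrable_sq)
  simp only [Real.rpow_one, Real.rpow_ofNat] at i1 h1 i2 h2
  have h3 : ∫ ξ, ‖F ξ‖ ^ α ∂Q.law ≤ lpNorm F 2 Q.law ^ α :=
    h1.trans (Real.rpow_le_rpow (integral_nonneg fun _ => norm_nonneg _)
      (integral_norm_le_lpNorm_two hF) hα)
  rw [← lpNorm_two_sq hF.1] at h2
  have e1 : (lpNorm F 2 Q.law ^ 2) ^ α = (lpNorm F 2 Q.law ^ α) ^ 2 := by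
    rw [← Real.rpow_natCast, ← Real.rpow_natCast, ← Real.rpow_mul lpNorm_nonneg,
      ← Real.rpow_mul lpNorm_nonneg, mul_comm]
  have e2 : ∀ ξ, (‖F ξ‖ ^ 2) ^ α = (‖F ξ‖ ^ α) ^ 2 := fun ξ => by
    rw [← Real.rpow_natCast, ← Real.rpow_natCast, ← Real.rpow_mul (norm_nonneg _),
      ← Real.rpow_mul (norm_nonneg _), mul_comm]
  have e3 : ∀ ξ, (L₀ + L₁ * ‖F ξ‖ ^ α) ^ 2 =
      (L₀ ^ 2 + 2 * L₀ * L₁ * ‖F ξ‖ ^ α) + L₁ ^ 2 * (‖F ξ‖ ^ 2) ^ α := fun ξ => by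
    rw [e2]; ring
  simp_rw [e3]
  have i3 : Integrable (fun ξ => L₀ ^ 2 + 2 * L₀ * L₁ * ‖F ξ‖ ^ α) Q.law :=
    (integrable_const _).add (i1.const_mul _)
  rw [integral_add i3 (i2.const_mul _), integral_add (integrable_const _) (i1.const_mul _),
    integral_const_mul, integral_const_mul]
  rw [e1] at h2
  have h4 := mul_le_mul_of_nonneg_left h3 (show 0 ≤ 2 * L₀ * L₁ by positivity)
  have h5 := mul_le_mul_of_nonneg_left h2 (sq_nonneg L₁)
  simp only [integral_const, probReal_univ, one_smul]
  nlinarith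

theorem lpNorm_two_sub_lpNorm_two_le {f g : Ξ → EuclideanSpace ℝ (Fin d)}
    (hg : MemLp g 2 Q.law) : lpNorm f 2 Q.law - lpNorm g 2 Q.law ≤ lpNorm (f - g) 2 Q.law := by
  have := lpNorm_le_lpNorm_add_lpNorm_sub' (f := f) (p := 2) (μ := Q.law) hg (by norm_num)
  linarith

namespace ExpectedSymSmooth

theorem lpNorm_sub_le_sqrt (h : Q.ExpectedSymSmooth α L₀ L₁) {x y : EuclideanSpace ℝ (Fin d)} :
    lpNorm (fun ξ => Q.g y ξ - Q.g x ξ) 2 Q.law ≤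
      ‖y - x‖ * √(∫ ξ, (L₀ + L₁ * Q.segmentMax α x y ξ) ^ 2 ∂Q.law) := by
  refine le_of_sq_le_sq ?_ (by positivity)
  rw [lpNorm_two_sq (Q.memLp_sub x y).1, mul_pow,
    Real.sq_sqrt (integral_nonneg fun _ => sq_nonneg _)]
  exact h.bound x y

variable (h : Q.ExpectedSymSmooth α L₀ L₁) (hα : 0 < α)

include h hα

theorem ae_segmentMax_segmentPoint_le {s t : ℝ} (hs : 0 ≤ s) (hst : s ≤ t) (ht : t ≤ 1) :
    ∀ᵐ ξ ∂Q.law, Q.segmentMax α (segmentPoint x y s) (segmentPoint x y t) ξ ≤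
      Q.segmentMax α x y ξ := by
  filter_upwards [h.continuousOn_segment x y] with ξ hξ
  exact segmentMax_segmentPoint_le
    (fun θ hθ => le_segmentMax hα hξ ⟨hs.trans hθ.1, hθ.2.trans ht⟩) hst

variable (hα1 : α ≤ 1) (hL₀ : 0 ≤ L₀) (hL₁ : 0 ≤ L₁)

include hL₀ hL₁

/-- A crude Lipschitz bound: a maximum over a subsegment is at most the one over the whole segment.
It supplies only continuity and finiteness for the sharper estimate. -/
theorem lpNorm_segment_sub_le {s t : ℝ} (hs : 0 ≤ s) (hst : s ≤ t) (ht : t ≤ 1) :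
    lpNorm (fun ξ => Q.g (segmentPoint x y t) ξ - Q.g (segmentPoint x y s) ξ) 2 Q.law ≤
      (t - s) * (‖y - x‖ * √(∫ ξ, (L₀ + L₁ * Q.segmentMax α x y ξ) ^ 2 ∂Q.law)) := by
  refine (h.lpNorm_sub_le_sqrt).trans ?_
  rw [norm_segmentPoint_sub, abs_of_nonneg (sub_nonneg.2 hst), mul_assoc]
  have hmono : ∫ ξ, (L₀ + L₁ * Q.segmentMax α (segmentPoint x y s) (segmentPoint x y t) ξ) ^ 2
      ∂Q.law ≤ ∫ ξ, (L₀ + L₁ * Q.segmentMax α x y ξ) ^ 2 ∂Q.law := by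
    refine integral_mono_ae (h.integrable _ _) (h.integrable _ _) ?_
    filter_upwards [h.ae_segmentMax_segmentPoint_le hα (x := x) (y := y) hs hst ht] with ξ hξ
    have := segmentMax_nonneg (Q := Q) (α := α) (x := segmentPoint x y s)
      (y := segmentPoint x y t) ξ
    gcongr
  exact mul_le_mul_of_nonneg_left (mul_le_mul_of_nonneg_left (Real.sqrt_le_sqrt hmono)
    (norm_nonneg _)) (sub_nonneg.2 hst)

/-- Dominated convergence, with the integrand for the full segment as dominating function. -/
theorem tendsto_integral_segmentMax {t : ℝ} (ht : t ∈ Set.Ico (0 : ℝ) 1) :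
    Tendsto (fun u => ∫ ξ, (L₀ + L₁ * Q.segmentMax α (segmentPoint x y t)
        (segmentPoint x y u) ξ) ^ 2 ∂Q.law) (𝓝[>] t)
      (𝓝 (∫ ξ, (L₀ + L₁ * ‖Q.g (segmentPoint x y t) ξ‖ ^ α) ^ 2 ∂Q.law)) := by
  refine tendsto_integral_filter_of_dominated_convergence
    (fun ξ => (L₀ + L₁ * Q.segmentMax α x y ξ) ^ 2)
    (Eventually.of_forall fun u => (h.integrable _ _).1) ?_ (h.integrable _ _) ?_
  · filter_upwards [Ioo_mem_nhdsGT ht.2] with u hu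
    filter_upwards [h.ae_segmentMax_segmentPoint_le hα (x := x) (y := y) ht.1 hu.1.le hu.2.le]
      with ξ hξ
    have := segmentMax_nonneg (Q := Q) (α := α) (x := segmentPoint x y t)
      (y := segmentPoint x y u) ξ
    rw [Real.norm_of_nonneg (sq_nonneg _)]
    gcongr
  · filter_upwards [h.continuousOn_segment x y] with ξ hξ
    exact (((tendsto_segmentMax hα hξ ht).const_mul L₁).const_add L₀).pow 2

include hα1

/-- This removes the maximum from the expectation. Smoothness on `[t, u]` with `u ↓ t` bounds the
right slope of the `L²` increment at `t` by a quantity involving the oracle at `x_t` alone, hence by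
`‖y - x‖ (L₀ + L₁ S^α)`; a continuous function with such right slopes grows at most linearly. -/
theorem lpNorm_segment_sub_le_of_forall_le {S : ℝ}
    (hS : ∀ θ ∈ Set.Icc (0 : ℝ) 1, lpNorm (Q.g (segmentPoint x y θ)) 2 Q.law ≤ S)
    {θ : ℝ} (hθ : θ ∈ Set.Icc (0 : ℝ) 1) :
    lpNorm (fun ξ => Q.g (segmentPoint x y θ) ξ - Q.g x ξ) 2 Q.law ≤
      ‖y - x‖ * (L₀ + L₁ * S ^ α) * θ := by
  have hS0 : 0 ≤ S := lpNorm_nonneg.trans (hS 0 (by simp))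
  set J := ‖y - x‖ * √(∫ ξ, (L₀ + L₁ * Q.segmentMax α x y ξ) ^ 2 ∂Q.law) with hJ
  have hJ0 : 0 ≤ J := by positivity
  set Φ : ℝ → ℝ := fun θ => lpNorm (fun ξ => Q.g (segmentPoint x y θ) ξ - Q.g x ξ) 2 Q.law with hΦ
  have hdiff : ∀ s t, Φ t - Φ s ≤
      lpNorm (fun ξ => Q.g (segmentPoint x y t) ξ - Q.g (segmentPoint x y s) ξ) 2 Q.law :=
    fun s t => by
    refine (lpNorm_two_sub_lpNorm_two_le (Q.memLp_sub _ _)).trans_eq ?_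
    congr 1
    funext ξ
    simp
  have hcomm : ∀ s t, lpNorm
      (fun ξ => Q.g (segmentPoint x y t) ξ - Q.g (segmentPoint x y s) ξ) 2 Q.law = lpNorm
      (fun ξ => Q.g (segmentPoint x y s) ξ - Q.g (segmentPoint x y t) ξ) 2 Q.law := fun s t =>
    lpNorm_sub_comm (Q.g (segmentPoint x y t)) (Q.g (segmentPoint x y s)) 2 Q.law
  have hcont : ContinuousOn Φ (Set.Icc 0 1) := by
    refine LipschitzOnWith.continuousOn (K := J.toNNReal) (LipschitzOnWith.of_le_add_mul _ ?_)
    intro s hs t ht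
    rw [Real.dist_eq, Real.coe_toNNReal _ hJ0]
    rcases le_total s t with hst | hst
    · have h1 := h.lpNorm_segment_sub_le hα hL₀ hL₁ (x := x) (y := y) hs.1 hst ht.2
      rw [abs_of_nonpos (sub_nonpos.2 hst)]
      have h2 := hdiff t s
      rw [hcomm] at h2
      linarith
    · have h1 := h.lpNorm_segment_sub_le hα hL₀ hL₁ (x := x) (y := y) ht.1 hst hs.2
      rw [abs_of_nonneg (sub_nonneg.2 hst)]
      have h2 := hdiff t s
      linarith
  refine image_le_of_liminf_slope_right_le_deriv_boundary (f := Φ)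
    (B := fun θ => ‖y - x‖ * (L₀ + L₁ * S ^ α) * θ) (B' := fun _ => ‖y - x‖ * (L₀ + L₁ * S ^ α))
    hcont ?_ (by fun_prop) (fun t _ => ?_) (fun t ht r hr => ?_) hθ
  · simp [hΦ, segmentPoint]
  · simpa using ((hasDerivAt_id t).const_mul (‖y - x‖ * (L₀ + L₁ * S ^ α))).hasDerivWithinAt
  · have hlim := ((h.tendsto_integral_segmentMax hα hL₀ hL₁ (x := x) (y := y) ht).sqrt).const_mul
      ‖y - x‖
    have hle : ‖y - x‖ * √(∫ ξ, (L₀ + L₁ * ‖Q.g (segmentPoint x y t) ξ‖ ^ α) ^ 2 ∂Q.law) < r := by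
      refine lt_of_le_of_lt (mul_le_mul_of_nonneg_left ?_ (norm_nonneg _)) hr
      refine Real.sqrt_le_iff.2 ⟨by positivity, ?_⟩
      refine (integral_growth_sq_le (Q.memLp _) hα.le hα1 hL₀ hL₁).trans ?_
      have h1 := hS t ⟨ht.1, ht.2.le⟩
      have h0 : 0 ≤ lpNorm (Q.g (segmentPoint x y t)) 2 Q.law := lpNorm_nonneg
      gcongr
    refine Eventually.frequently ?_
    filter_upwards [hlim.eventually_lt_const hle, self_mem_nhdsWithin] with u hu hut
    have hut' : 0 < u - t := sub_pos.2 hut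
    rw [slope_def_field, div_lt_iff₀ hut']
    have h1 := h.lpNorm_sub_le_sqrt (x := segmentPoint x y t) (y := segmentPoint x y u)
    rw [norm_segmentPoint_sub, abs_of_pos hut', mul_assoc] at h1
    have h2 := hdiff t u
    have h3 := mul_lt_mul_of_pos_left hu hut'
    linarith

/-- The mean-square increment of the oracle is controlled by a self-bounding quantity. -/
theorem exists_lpNorm_sub_le (x y : EuclideanSpace ℝ (Fin d)) :
    ∃ m, 0 ≤ m ∧ lpNorm (fun ξ => Q.g y ξ - Q.g x ξ) 2 Q.law ≤ m ∧
      m ≤ ‖y - x‖ * (L₀ + L₁ * (lpNorm (Q.g x) 2 Q.law ^ α + m ^ α)) := by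
  set Φ : Set.Icc (0 : ℝ) 1 → ℝ := fun θ =>
    lpNorm (fun ξ => Q.g (segmentPoint x y θ) ξ - Q.g x ξ) 2 Q.law with hΦ
  have hbdd : BddAbove (Set.range Φ) := by
    refine ⟨‖y - x‖ * √(∫ ξ, (L₀ + L₁ * Q.segmentMax α x y ξ) ^ 2 ∂Q.law), ?_⟩
    rintro _ ⟨θ, rfl⟩
    have h1 := h.lpNorm_segment_sub_le hα hL₀ hL₁ (x := x) (y := y) le_rfl θ.2.1 θ.2.2
    have e : segmentPoint x y 0 = x := by simp [segmentPoint]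
    rw [e, sub_zero] at h1
    exact h1.trans (mul_le_of_le_one_left (by positivity) θ.2.2)
  -- The largest `L²` increment along the segment, finite by the crude Lipschitz bound. By the
  -- triangle inequality `a + m` bounds the oracle at every point of the segment, so it can serve as
  -- `S`; subadditivity of the power then makes the inequality self-bounding.
  set m := ⨆ θ, Φ θ with hm
  set a := lpNorm (Q.g x) 2 Q.law with ha
  have hm0 : 0 ≤ m := Real.iSup_nonneg fun _ => lpNorm_nonneg
  have ha0 : 0 ≤ a := lpNorm_nonneg
  have hS : ∀ θ ∈ Set.Icc (0 : ℝ) 1, lpNorm (Q.g (segmentPoint x y θ)) 2 Q.law ≤ a + m :=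
    fun θ hθ => by
    have h1 := lpNorm_two_sub_lpNorm_two_le (f := Q.g (segmentPoint x y θ)) (Q.memLp x)
    have h2 : lpNorm (Q.g (segmentPoint x y θ) - Q.g x) 2 Q.law ≤ m := le_ciSup hbdd ⟨θ, hθ⟩
    linarith
  refine ⟨m, hm0, ?_, ?_⟩
  · have h1 : Φ ⟨1, by simp⟩ ≤ m := le_ciSup hbdd _
    simpa [hΦ, segmentPoint] using h1
  · refine ciSup_le fun θ => ?_
    have h1 := h.lpNorm_segment_sub_le_of_forall_le hα hα1 hL₀ hL₁ hS θ.2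
    have hnn : 0 ≤ ‖y - x‖ * (L₀ + L₁ * (a + m) ^ α) := by positivity
    have h2 := Real.rpow_add_le_add_rpow ha0 hm0 hα.le hα1
    refine h1.trans ((mul_le_of_le_one_right hnn θ.2.2).trans ?_)
    gcongr

end ExpectedSymSmooth

end BG0Problem

/-! ### Scalar inequalities and the local smoothness constants -/

/-- Weighted arithmetic-geometric mean inequality for `l t / α` and `(α / l)^(α / (1 - α))` with
weights `α` and `1 - α`. The additive constant is the maximum of `t^α - l t`. -/
theorem rpow_le_mul_add {α t l : ℝ} (hα : 0 < α) (hα1 : α < 1) (ht : 0 ≤ t) (hl : 0 < l) :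
    t ^ α ≤ l * t + (1 - α) * α ^ (α / (1 - α)) * l ^ (-(α / (1 - α))) := by
  have h1 : 0 < 1 - α := sub_pos.2 hα1
  have h := Real.geom_mean_le_arith_mean2_weighted hα.le h1.le
    (show 0 ≤ l * t / α by positivity) (show 0 ≤ (α / l) ^ (α / (1 - α)) by positivity) (by ring)
  rw [← Real.rpow_mul (by positivity), div_mul_cancel₀ _ h1.ne',
    ← Real.mul_rpow (by positivity) (by positivity)] at h
  have e1 : l * t / α * (α / l) = t := by field_simp
  have e2 : α * (l * t / α) = l * t := by field_simp
  rw [e1, e2, Real.div_rpow hα.le hl.le] at h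
  rw [Real.rpow_neg hl.le, mul_assoc, ← div_eq_mul_inv]
  exact h

/-- Either `h L₁ m^α ≤ m / 2`, and this term is absorbed at the cost of a factor `2`, or `m^(1 - α)
≤ 2 L₁ h`, which bounds `m` outright. The conclusion adds both bounds. -/
theorem le_of_le_mul_add_rpow {α h m L₀ L₁ b : ℝ} (hα : 0 < α) (hα1 : α < 1) (hh : 0 ≤ h)
    (hm : 0 ≤ m) (hL₀ : 0 ≤ L₀) (hL₁ : 0 < L₁) (hb : 0 ≤ b)
    (hle : m ≤ h * (L₀ + L₁ * (b + m ^ α))) :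
    m ≤ h * (2 * L₀ + 2 * L₁ * b + (2 * L₁) ^ (1 / (1 - α)) * h ^ (α / (1 - α))) := by
  have h1 : 0 < 1 - α := sub_pos.2 hα1
  have hnn : 0 ≤ h * ((2 * L₁) ^ (1 / (1 - α)) * h ^ (α / (1 - α))) := by positivity
  have hnn2 : 0 ≤ h * (2 * L₀ + 2 * L₁ * b) := by positivity
  rcases le_or_gt (h * L₁ * m ^ α) (m / 2) with hc | hc
  · nlinarith
  · have hm0 : 0 < m := by
      rcases hm.eq_or_lt with rfl | h0
      · rw [Real.zero_rpow hα.ne'] at hc; simp at hc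
      · exact h0
    have hmα : 0 < m ^ α := Real.rpow_pos_of_pos hm0 α
    have h2 : m ^ (1 - α) ≤ 2 * L₁ * h := by
      rw [Real.rpow_sub hm0, Real.rpow_one, div_le_iff₀ hmα]
      linarith
    have h3 := Real.rpow_le_rpow (by positivity) h2 (show 0 ≤ 1 / (1 - α) by positivity)
    rw [← Real.rpow_mul hm, mul_one_div_cancel h1.ne', Real.rpow_one,
      Real.mul_rpow (by positivity) hh] at h3
    have h4 : h ^ (1 / (1 - α)) = h * h ^ (α / (1 - α)) := by
      have e : 1 / (1 - α) = 1 + α / (1 - α) := by field_simp; ring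
      rw [e, Real.rpow_add_of_nonneg hh zero_le_one (by positivity), Real.rpow_one]
    rw [h4] at h3
    linarith

namespace BG0Problem

variable {d : ℕ} {Ξ : Type u} [MeasurableSpace Ξ] {B G : ℝ} {Q : BG0Problem d Ξ B G}

theorem MeanSquareSmooth.locallySmooth {L : ℝ} (h : Q.MeanSquareSmooth L) (hL : 0 ≤ L) (r γ : ℝ) :
    Q.LocallySmooth r γ L 0 := by
  intro x y _ _
  refine le_of_sq_le_sq ?_ (by positivity)
  rw [lpNorm_two_sq (Q.memLp_sub x y).1]
  refine (h x y).trans_eq ?_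
  ring

/-- In the solved self-bounding inequality, the oracle norm at `x` is at most `‖∇f(x)‖ + B r + G`,
subadditivity separates the powers, and Young's inequality linearizes `‖∇f(x)‖^α`. The parameter `l`
stays free because it must later decay with the horizon. The constants leave room: only `2 L₀ ≤ K₀`,
`2 L₁ ≤ 2^(α/2) K₁` and `2 L₁ ≤ 5 L₁` are used. -/
theorem ExpectedSymSmooth.locallySmooth_of_lt_one {α L₀ L₁ K₀ K₁ K₂ : ℝ}
    (h : Q.ExpectedSymSmooth α L₀ L₁) (hα : 0 < α) (hα1 : α < 1) (hB : 0 ≤ B) (hG : 0 ≤ G)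
    (hL₀ : 0 < L₀) (hL₁ : 0 < L₁)
    (hK₀ : K₀ = 2 ^ ((2 - α) / (1 - α)) * L₀) (hK₁ : K₁ = 2 ^ ((2 - α) / (1 - α)) * L₁)
    (hK₂ : K₂ = (5 * L₁) ^ (1 / (1 - α))) {r γ l : ℝ} (hr : 0 ≤ r) (hl : 0 < l) :
    Q.LocallySmooth r γ (K₀ + 2 ^ (α / 2) * K₁ *
        ((1 - α) * α ^ (α / (1 - α)) * l ^ (-(α / (1 - α))) + B ^ α * r ^ α + G ^ α)
        + K₂ * γ ^ (α / (1 - α))) (2 ^ (α / 2) * K₁ * l) := by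
  intro x y hx hy
  have h1 : 0 < 1 - α := sub_pos.2 hα1
  obtain ⟨m, hm0, hm, hle⟩ := h.exists_lpNorm_sub_le hα hα1.le hL₀.le hL₁.le x y
  have ha0 : 0 ≤ lpNorm (Q.g x) 2 Q.law := lpNorm_nonneg
  have hself := le_of_le_mul_add_rpow hα hα1 (norm_nonneg _) hm0 hL₀.le hL₁ (by positivity) hle
  refine (hm.trans hself).trans (mul_le_mul_of_nonneg_left ?_ (norm_nonneg _))
  have ha : lpNorm (Q.g x) 2 Q.law ≤ ‖gradient Q.f x‖ + B * r + G :=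
    (Q.lpNorm_g_le hB hG x).trans (by gcongr)
  have haα : lpNorm (Q.g x) 2 Q.law ^ α ≤ ‖gradient Q.f x‖ ^ α + B ^ α * r ^ α + G ^ α := by
    have h2 := Real.rpow_add_le_add_rpow (show 0 ≤ ‖gradient Q.f x‖ + B * r by positivity) hG
      hα.le hα1.le
    have h3 := Real.rpow_add_le_add_rpow (norm_nonneg (gradient Q.f x))
      (show 0 ≤ B * r by positivity) hα.le hα1.le
    rw [Real.mul_rpow hB hr] at h3
    have h4 := Real.rpow_le_rpow ha0 ha hα.le
    linarith
  have hY := rpow_le_mul_add hα hα1 (norm_nonneg (gradient Q.f x)) hl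
  set Y := (1 - α) * α ^ (α / (1 - α)) * l ^ (-(α / (1 - α))) with hYdef
  have hY0 : 0 ≤ Y := by positivity
  set b := lpNorm (Q.g x) 2 Q.law ^ α with hbdef
  have hb : b ≤ l * ‖gradient Q.f x‖ + Y + B ^ α * r ^ α + G ^ α := by linarith
  have hb0 : 0 ≤ b := by positivity
  have two_le : (2 : ℝ) ≤ 2 ^ ((2 - α) / (1 - α)) := by
    conv_lhs => rw [← Real.rpow_one 2]
    refine Real.rpow_le_rpow_of_exponent_le one_le_two ?_
    rw [one_le_div h1]; linarith
  have one_le : (1 : ℝ) ≤ 2 ^ (α / 2) := Real.one_le_rpow one_le_two (by positivity)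
  have hK₁0 : 2 * L₁ ≤ 2 ^ (α / 2) * K₁ := by
    have e : 2 * L₁ ≤ K₁ := by rw [hK₁]; gcongr
    have : 0 ≤ K₁ := by linarith
    nlinarith
  have t1 : 2 * L₀ ≤ K₀ := by rw [hK₀]; gcongr
  have t2 : 2 * L₁ * b ≤
      2 ^ (α / 2) * K₁ * (l * ‖gradient Q.f x‖ + Y + B ^ α * r ^ α + G ^ α) :=
    mul_le_mul hK₁0 hb hb0 (by linarith)
  have t3 : (2 * L₁) ^ (1 / (1 - α)) * ‖y - x‖ ^ (α / (1 - α)) ≤ K₂ * γ ^ (α / (1 - α)) := by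
    rw [hK₂]
    gcongr
    norm_num
  linarith

/-- For exponent `1` the self-bounding inequality is linear in `m`, and its `m` term has coefficient
at most `1/16`; absorbing it produces the factor `16/15`. -/
theorem ExpectedSymSmooth.locallySmooth_one {L₀ L₁ : ℝ}
    (h : Q.ExpectedSymSmooth 1 L₀ L₁) (hB : 0 ≤ B) (hG : 0 ≤ G)
    (hL₀ : 0 < L₀) (hL₁ : 0 < L₁) {r γ : ℝ} (hγ : γ * L₁ ≤ 1 / 16) :
    Q.LocallySmooth r γ (16 / 15 * (L₀ + L₁ * (B * r + G))) (16 / 15 * L₁) := by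
  intro x y hx hy
  obtain ⟨m, hm0, hm, hle⟩ := h.exists_lpNorm_sub_le one_pos le_rfl hL₀.le hL₁.le x y
  rw [Real.rpow_one, Real.rpow_one] at hle
  have ha : lpNorm (Q.g x) 2 Q.law ≤ ‖gradient Q.f x‖ + B * r + G :=
    (Q.lpNorm_g_le hB hG x).trans (by gcongr)
  have h1 : ‖y - x‖ * L₁ ≤ 1 / 16 := (mul_le_mul_of_nonneg_right hy hL₁.le).trans hγ
  have h2 : ‖y - x‖ * L₁ * m ≤ 1 / 16 * m := mul_le_mul_of_nonneg_right h1 hm0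
  have h3 : ‖y - x‖ * (L₀ + L₁ * lpNorm (Q.g x) 2 Q.law) ≤
      ‖y - x‖ * (L₀ + L₁ * (‖gradient Q.f x‖ + B * r + G)) := by gcongr
  refine hm.trans ?_
  nlinarith

end BG0Problem

/-! ### Horizons, batch sizes and oracle calls -/

theorem exists_horizon {C p ε : ℝ} (hC : 0 ≤ C) (hp : 0 < p) (hε : 0 < ε) (hε1 : ε ≤ 1) :
    ∃ K : ℕ, C * ((K : ℝ) + 1) ^ (-(1 / p)) ≤ ε ∧ (K : ℝ) + 1 ≤ (C ^ p + 2) * ε ^ (-p) := by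
  set X := (C / ε) ^ p with hX
  have hX0 : 0 ≤ X := by positivity
  -- The rate requires `K + 1 ≥ X`. Rounding gives `K + 1 ≤ X + 2`, and the `2` is absorbed because
  -- `ε^(-p) ≥ 1`.
  refine ⟨⌈X⌉₊, ?_, ?_⟩
  · have h1 : X ≤ (⌈X⌉₊ : ℝ) + 1 := (Nat.le_ceil X).trans (by linarith)
    have h2 := Real.rpow_le_rpow hX0 h1 (show 0 ≤ 1 / p by positivity)
    rw [hX, ← Real.rpow_mul (by positivity), mul_one_div_cancel hp.ne', Real.rpow_one,
      div_le_iff₀ hε] at h2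
    have h3 : 0 < ((⌈X⌉₊ : ℝ) + 1) ^ (1 / p) := by positivity
    rw [Real.rpow_neg (by positivity), ← div_eq_mul_inv, div_le_iff₀ h3]
    linarith
  · have h1 := Nat.ceil_lt_add_one hX0
    have h2 : X = C ^ p * ε ^ (-p) := by
      rw [hX, Real.div_rpow hC hε.le, Real.rpow_neg hε.le, div_eq_mul_inv]
    have h3 : 1 ≤ ε ^ (-p) := Real.one_le_rpow_of_pos_of_le_one_of_nonpos hε hε1 (by linarith)
    nlinarith

theorem initBatch_pos (G r : ℝ) (K : ℕ) : 0 < initBatch G r K := by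
  unfold initBatch; positivity

theorem le_initBatch (G r : ℝ) (K : ℕ) : G ^ 2 * ((K : ℝ) + 1) ^ r ≤ initBatch G r K :=
  (Nat.le_ceil _).trans (by unfold initBatch; exact_mod_cast le_max_right _ _)

theorem initBatch_le {G r : ℝ} (hr : r ≤ 1) (K : ℕ) :
    (initBatch G r K : ℝ) ≤ 2 + G ^ 2 * ((K : ℝ) + 1) := by
  have h0 : 0 ≤ G ^ 2 * ((K : ℝ) + 1) ^ r := by positivity
  have h1 : ((K : ℝ) + 1) ^ r ≤ (K : ℝ) + 1 := by
    conv_rhs => rw [← Real.rpow_one ((K : ℝ) + 1)]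
    exact Real.rpow_le_rpow_of_exponent_le (by linarith [(Nat.cast_nonneg K : (0 : ℝ) ≤ K)]) hr
  have h2 : (⌈G ^ 2 * ((K : ℝ) + 1) ^ r⌉₊ : ℝ) ≤ G ^ 2 * ((K : ℝ) + 1) + 1 :=
    (Nat.ceil_lt_add_one h0).le.trans (by gcongr)
  unfold initBatch
  push_cast
  refine max_le ?_ (h2.trans (by linarith))
  have : 0 ≤ G ^ 2 * ((K : ℝ) + 1) := by positivity
  linarith

theorem div_sqrt_le_inv {G t N : ℝ} (ht : 0 < t) (hN : 0 < N)
    (h : G ^ 2 * t ^ 2 ≤ N) : G / √N ≤ 1 / t := by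
  rw [div_le_div_iff₀ (Real.sqrt_pos.2 hN) ht, one_mul]
  exact Real.le_sqrt_of_sq_le (by rw [mul_pow]; exact h)

theorem NSTORMRun.totalCalls_le {d : ℕ} {Ξ : Type u} [MeasurableSpace Ξ] {B G : ℝ}
    {Q : BG0Problem d Ξ B G} {N K : ℕ} {Ω : Type v} [MeasurableSpace Ω] (R : NSTORMRun Q N K Ω)
    {γ η C : ℝ} (hN : (N : ℝ) ≤ 2 + G ^ 2 * ((K : ℝ) + 1)) (hK : (K : ℝ) + 1 ≤ C) (ω : Ω) :
    (R.totalCalls γ η ω : ℝ) ≤ (4 + G ^ 2) * C := by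
  rw [R.totalCalls_eq]
  push_cast
  have : (4 + G ^ 2) * ((K : ℝ) + 1) ≤ (4 + G ^ 2) * C := by gcongr
  nlinarith [(Nat.cast_nonneg K : (0 : ℝ) ≤ K)]

/-! ### The rates in the three regimes -/

namespace NSTORMRun

variable {d : ℕ} {Ξ : Type u} [MeasurableSpace Ξ] {B G : ℝ} {Q : BG0Problem d Ξ B G}
  {K : ℕ} {Ω : Type v} [MeasurableSpace Ω]

theorem meanGradNorm_le_of_meanSquareSmooth {L γ₀ T γ η : ℝ} (hB : 0 ≤ B) (hG : 0 ≤ G)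
    (hL : 0 < L) (hγ₀ : 0 < γ₀) (hQ : Q.MeanSquareSmooth L) (hT : T = (K : ℝ) + 1)
    (hγ : γ = powerSchedule γ₀ (3 / 4) K) (hη : η = powerSchedule 1 1 K)
    (R : NSTORMRun Q (initBatch G (1 / 2) K) K Ω) :
    Integrable (R.gradNorm γ η) R.P ∧ R.meanGradNorm γ η ≤
      (Q.gap / γ₀ + 2 * (1 + L * γ₀ + B * γ₀)) * T ^ (-(1 / 4) : ℝ)
        + 2 * G * T ^ (-(1 / 2) : ℝ) + L * γ₀ / 2 * T ^ (-(3 / 4) : ℝ) := by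
  have hT1 : 1 ≤ T := by rw [hT]; linarith [(Nat.cast_nonneg K : (0 : ℝ) ≤ K)]
  have hT0 : 0 < T := by linarith
  -- In this unit all parameters are monomials: `γ = γ₀ / s³`, `η = 1 / s⁴`, `√η = 1 / s²`, `γT = γ₀
  -- s`. Since `ηT = 1`, the initial error is not damped further, and the batch must itself bring it
  -- down to `1 / s`.
  set s := T ^ (1 / 4 : ℝ) with hs
  have hs0 : 0 < s := by positivity
  have hs1 : 1 ≤ s := Real.one_le_rpow hT1 (by norm_num)
  have hpow : ∀ n : ℕ, T ^ ((n : ℝ) / 4) = s ^ n := fun n => by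
    rw [hs, ← Real.rpow_natCast, ← Real.rpow_mul hT0.le]; congr 1; ring
  have e1 : T ^ (-(1 / 4) : ℝ) = 1 / s := by rw [Real.rpow_neg hT0.le, ← hs, one_div]
  have e2 : T ^ (1 / 2 : ℝ) = s ^ 2 := by rw [← hpow]; norm_num
  have e3 : T ^ (3 / 4 : ℝ) = s ^ 3 := by rw [← hpow]; norm_num
  have e4 : T = s ^ 4 := by rw [← hpow]; norm_num
  have hγ' : γ = γ₀ / s ^ 3 := by
    rw [hγ, powerSchedule, ← hT, Real.rpow_neg hT0.le, e3, div_eq_mul_inv]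
  have hη' : η = 1 / s ^ 4 := by
    rw [hη, powerSchedule, ← hT, Real.rpow_neg hT0.le, Real.rpow_one, ← e4, div_eq_mul_inv]
  have hγ0 : 0 < γ := by rw [hγ']; positivity
  have hη0 : 0 < η := by rw [hη']; positivity
  have hη1 : η ≤ 1 := by rw [hη', ← e4, div_le_one hT0]; exact hT1
  obtain ⟨hint, hle⟩ := R.meanGradNorm_bound hB hG hγ0 hη0 hη1 hL.le le_rfl
    (hQ.locallySmooth hL.le _ _)
  refine ⟨hint, ?_⟩
  have hN := le_initBatch G (1 / 2) K
  rw [← hT, e2] at hN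
  have hb : R.initError γ η ≤ 1 / s := (R.initError_le hG (initBatch_pos _ _ _)).trans
    (div_sqrt_le_inv hs0 (by exact_mod_cast initBatch_pos _ _ _) hN)
  have hsqrt : √η = 1 / s ^ 2 := by
    rw [hη', show (1 : ℝ) / s ^ 4 = (1 / s ^ 2) ^ 2 by field_simp]
    exact Real.sqrt_sq (by positivity)
  rw [e1, Real.rpow_neg hT0.le, Real.rpow_neg hT0.le (3 / 4), e2, e3]
  rw [← hT, hsqrt] at hle
  have hηT : η * T = 1 := by rw [hη', e4]; field_simp
  have hγT : γ * T = γ₀ * s := by rw [hγ', e4]; field_simp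
  rw [hηT, div_one, mul_comm T γ, hγT] at hle
  simp only [mul_zero, zero_div, sub_zero, one_mul] at hle
  refine hle.trans ?_
  have e5 : 2 * ((γ * L + η * (B * (γ₀ * s) + G)) / (1 / s ^ 2)) =
      2 * (L * γ₀ + B * γ₀) * (1 / s) + 2 * G * (s ^ 2)⁻¹ := by
    rw [hγ', hη']; field_simp; ring
  have e6 : Q.gap / (γ₀ * s) = Q.gap / γ₀ * (1 / s) := by field_simp
  have e7 : γ * L / 2 = L * γ₀ / 2 * (s ^ 3)⁻¹ := by rw [hγ']; field_simp
  rw [e5, e6, e7]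
  linarith

theorem meanGradNorm_le_of_expectedSymSmooth {α L₀ L₁ γ₀ η₀ lam₀ K₀ K₁ K₂ T γ η : ℝ}
    (hα : 0 < α) (hα1 : α < 1) (hB : 0 ≤ B) (hG : 0 ≤ G) (hL₀ : 0 < L₀) (hL₁ : 0 < L₁)
    (hγ₀ : 0 < γ₀) (hη₀ : 0 < η₀) (hη₀1 : η₀ ≤ 1) (hlam₀ : 0 < lam₀)
    (hK₀ : K₀ = 2 ^ ((2 - α) / (1 - α)) * L₀) (hK₁ : K₁ = 2 ^ ((2 - α) / (1 - α)) * L₁)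
    (hK₂ : K₂ = (5 * L₁) ^ (1 / (1 - α)))
    (hs₁ : 2 ^ (α / 2) * K₁ * lam₀ * γ₀ ≤ 1)
    (hs₂ : 2 ^ ((6 + α) / 2) * K₁ * lam₀ * (γ₀ / η₀) ≤ 1)
    (hQ : Q.ExpectedSymSmooth α L₀ L₁) (hT : T = (K : ℝ) + 1)
    (hγ : γ = powerSchedule γ₀ ((3 + α) / (4 + α)) K) (hη : η = powerSchedule η₀ (4 / (4 + α)) K)
    (R : NSTORMRun Q (initBatch G (2 * (1 - α) / (4 + α)) K) K Ω) :
    Integrable (R.gradNorm γ η) R.P ∧ R.meanGradNorm γ η ≤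
      (4 * Q.gap / γ₀ + 8 / η₀
        + 8 * (1 - α) * α ^ (α / (1 - α)) * 2 ^ (α / 2) * K₁ * γ₀
            * lam₀ ^ (-(α / (1 - α))) / √η₀
        + 8 * 2 ^ (α / 2) * K₁ * B ^ α * γ₀ ^ (1 + α) / √η₀
        + 8 * √η₀ * B * γ₀) * T ^ (-(1 / (4 + α)))
      + (8 * K₀ * γ₀ / √η₀ + 8 * 2 ^ (α / 2) * K₁ * G ^ α * γ₀ / √η₀)
          * T ^ (-((1 + α) / (4 + α)))
      + 8 * √η₀ * G * T ^ (-(2 / (4 + α)))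
      + 8 * K₂ * γ₀ ^ (1 / (1 - α)) / √η₀
          * T ^ (-((1 + 3 * α) / ((1 - α) * (4 + α))))
      + 2 * K₀ * γ₀ * T ^ (-((3 + α) / (4 + α)))
      + 2 * (1 - α) * α ^ (α / (1 - α)) * 2 ^ (α / 2) * K₁ * γ₀
          * lam₀ ^ (-(α / (1 - α))) * T ^ (-(3 / (4 + α)))
      + 4 * K₂ * γ₀ ^ (1 / (1 - α)) * T ^ (-((3 + α) / ((1 - α) * (4 + α))))
      + 2 ^ (1 + α / 2) * K₁ * G ^ α * γ₀ * T ^ (-((3 + α) / (4 + α)))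
      + 2 ^ (1 + α / 2) * K₁ * B ^ α * γ₀ ^ (1 + α) * T ^ (-(3 / (4 + α))) := by
  have hT1 : 1 ≤ T := by rw [hT]; linarith [(Nat.cast_nonneg K : (0 : ℝ) ≤ K)]
  have hT0 : 0 < T := by linarith
  have h1α : 0 < 1 - α := sub_pos.2 hα1
  have h4α : 0 < 4 + α := by linarith
  -- Two units suffice: `T = s⁴ q`, `γ = γ₀ / (s³ q)`, `η = η₀ / s⁴` and `Tγ = γ₀ s`. Powers of `γ`
  -- with exponent `1 / (1 - α)` are collected separately in `w`.
  set s := T ^ (1 / (4 + α)) with hs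
  set q := T ^ (α / (4 + α)) with hq
  have hs0 : 0 < s := by positivity
  have hq0 : 0 < q := by positivity
  have hpow : ∀ n : ℕ, T ^ ((n : ℝ) / (4 + α)) = s ^ n := fun n => by
    rw [hs, ← Real.rpow_natCast, ← Real.rpow_mul hT0.le]; congr 1; ring
  have hpowq : ∀ n : ℕ, T ^ (((n : ℝ) + α) / (4 + α)) = s ^ n * q := fun n => by
    rw [add_div, Real.rpow_add hT0, hpow]
  have p1 : T ^ (-(1 / (4 + α))) = 1 / s := by rw [Real.rpow_neg hT0.le, ← hs, one_div]
  have p2 : T ^ (-(2 / (4 + α))) = 1 / s ^ 2 := by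
    rw [Real.rpow_neg hT0.le, one_div, ← hpow]; norm_num
  have p3 : T ^ (-(3 / (4 + α))) = 1 / s ^ 3 := by
    rw [Real.rpow_neg hT0.le, one_div, ← hpow]; norm_num
  have p4 : T ^ (-(4 / (4 + α))) = 1 / s ^ 4 := by
    rw [Real.rpow_neg hT0.le, one_div, ← hpow]; norm_num
  have p1α : T ^ (-((1 + α) / (4 + α))) = 1 / (s * q) := by
    have := hpowq 1
    rw [Nat.cast_one, pow_one] at this
    rw [Real.rpow_neg hT0.le, one_div, this]
  have p3α : T ^ (-((3 + α) / (4 + α))) = 1 / (s ^ 3 * q) := by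
    have := hpowq 3
    rw [Nat.cast_ofNat] at this
    rw [Real.rpow_neg hT0.le, one_div, this]
  have hTs : T = s ^ 4 * q := by
    rw [← hpowq 4, Nat.cast_ofNat, div_self h4α.ne', Real.rpow_one]
  set w := T ^ (-((3 + α) / ((1 - α) * (4 + α)))) with hw
  have pw : T ^ (-((1 + 3 * α) / ((1 - α) * (4 + α)))) = w * s ^ 2 := by
    rw [hw, ← hpow, ← Real.rpow_add hT0]
    congr 1
    push_cast
    field_simp
    ring
  have hγ' : γ = γ₀ * (1 / (s ^ 3 * q)) := by rw [hγ, powerSchedule, ← hT, p3α]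
  have hη' : η = η₀ * (1 / s ^ 4) := by rw [hη, powerSchedule, ← hT, p4]
  have hγ0 : 0 < γ := by rw [hγ']; positivity
  have hη0 : 0 < η := by rw [hη']; positivity
  have hη1 : η ≤ 1 := by
    rw [hη', ← p4]
    exact mul_le_one₀ hη₀1 (by positivity)
      (Real.rpow_le_one_of_one_le_of_nonpos hT1 (neg_nonpos.2 (by positivity)))
  have hγγ : γ * γ ^ (α / (1 - α)) = γ₀ ^ (1 / (1 - α)) * w := by
    have e : 1 / (1 - α) = 1 + α / (1 - α) := by field_simp; ring
    have e' : γ * γ ^ (α / (1 - α)) = γ ^ (1 / (1 - α)) := by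
      rw [e, Real.rpow_add hγ0, Real.rpow_one]
    rw [e', hγ', ← p3α, Real.mul_rpow hγ₀.le (by positivity), ← Real.rpow_mul hT0.le, hw]
    congr 2
    field_simp
  have hTγ : T * γ = γ₀ * s := by rw [hγ', hTs]; field_simp
  have hTγα : (T * γ) ^ α = γ₀ ^ α * q := by
    rw [hTγ, Real.mul_rpow hγ₀.le hs0.le, hs, ← Real.rpow_mul hT0.le, hq]
    congr 2
    ring
  -- The Young parameter decays like `T^(-(1 - α)/(4 + α))`, which makes `γM / η` independent of
  -- `T`. The price `l^(-(α/(1 - α)))` grows like `q`, just as `(Tγ)^α` does, and `γ` compensates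
  -- it.
  set l := lam₀ * (q / s) with hl
  have hl0 : 0 < l := by positivity
  have hqs : q / s = T ^ (-((1 - α) / (4 + α))) := by
    rw [hq, hs, ← Real.rpow_sub hT0]; congr 1; ring
  have hlα : l ^ (-(α / (1 - α))) = lam₀ ^ (-(α / (1 - α))) * q := by
    rw [hl, Real.mul_rpow hlam₀.le (by positivity), hqs, ← Real.rpow_mul hT0.le, hq]
    congr 2
    field_simp
  have hK₁0 : 0 ≤ K₁ := by rw [hK₁]; positivity
  have hK₀0 : 0 ≤ K₀ := by rw [hK₀]; positivity
  have hK₂0 : 0 ≤ K₂ := by rw [hK₂]; positivity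
  have hr0 : 0 ≤ ((K : ℝ) + 1) * γ := by positivity
  have hsm := hQ.locallySmooth_of_lt_one hα hα1 hB hG hL₀ hL₁ hK₀ hK₁ hK₂ (γ := γ) hr0 hl0
  rw [← hT] at hsm
  set D := 2 ^ (α / 2) * K₁ with hD
  have hD0 : 0 ≤ D := by positivity
  set y := (1 - α) * α ^ (α / (1 - α)) * lam₀ ^ (-(α / (1 - α))) with hy
  have hy0 : 0 ≤ y := by positivity
  set A := K₀ + D * ((1 - α) * α ^ (α / (1 - α)) * l ^ (-(α / (1 - α))) + B ^ α * (T * γ) ^ α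
    + G ^ α) + K₂ * γ ^ (α / (1 - α)) with hA
  have hA0 : 0 ≤ A := by positivity
  have hM0 : 0 ≤ D * l := by positivity
  rw [hT] at hsm
  obtain ⟨hint, hle⟩ := R.meanGradNorm_bound hB hG hγ0 hη0 hη1 hA0 hM0 hsm
  refine ⟨hint, ?_⟩
  rw [← hT] at hle
  have hN := le_initBatch G (2 * (1 - α) / (4 + α)) K
  have hN2 : T ^ (2 * (1 - α) / (4 + α)) = (s / q) ^ 2 := by
    rw [hs, hq, ← Real.rpow_sub hT0, ← Real.rpow_natCast, ← Real.rpow_mul hT0.le]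
    congr 1
    push_cast
    ring
  rw [← hT, hN2] at hN
  have hb : R.initError γ η ≤ 1 / (s / q) := (R.initError_le hG (initBatch_pos _ _ _)).trans
    (div_sqrt_le_inv (by positivity) (by exact_mod_cast initBatch_pos _ _ _) hN)
  set z := √η₀ with hz
  have hz0 : 0 < z := Real.sqrt_pos.2 hη₀
  have hz2 : η₀ = z ^ 2 := (Real.sq_sqrt hη₀.le).symm
  have hsqrt : √η = z * (1 / s ^ 2) := by
    rw [hη', hz2, show z ^ 2 * (1 / s ^ 4) = (z * (1 / s ^ 2)) ^ 2 by field_simp]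
    exact Real.sqrt_sq (by positivity)
  -- Since `2^((6 + α)/2) = 8 · 2^(α/2)`, the second parameter condition gives exactly `1/8`.
  -- Together with `c2` the coefficient of the mean gradient norm is at least `1 - 1/4 - 1/2 = 1/4`.
  have c1 : γ * (D * l) / η ≤ 1 / 8 := by
    have e : γ * (D * l) / η = D * lam₀ * (γ₀ / η₀) := by
      rw [hγ', hη', hl]; field_simp
    have e8 : (2 : ℝ) ^ ((6 + α) / 2) = 8 * 2 ^ (α / 2) := by
      rw [show (6 + α) / 2 = 3 + α / 2 by ring, Real.rpow_add two_pos]; norm_num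
    rw [e8] at hs₂
    rw [e, hD]
    linarith
  have c2 : γ * (D * l) ≤ 1 := by
    have e : γ * (D * l) = D * lam₀ * γ₀ * T ^ (-(4 / (4 + α))) := by
      rw [hγ', hl, p4]; field_simp
    rw [e]
    exact mul_le_one₀ hs₁ (by positivity)
      (Real.rpow_le_one_of_one_le_of_nonpos hT1 (neg_nonpos.2 (by positivity)))
  have hm0 : 0 ≤ R.meanGradNorm γ η := integral_nonneg fun _ => norm_nonneg _
  have hquarter : 1 / 4 * R.meanGradNorm γ η ≤
      (1 - 2 * (γ * (D * l) / η) - γ * (D * l) / 2) * R.meanGradNorm γ η :=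
    mul_le_mul_of_nonneg_right (by linarith) hm0
  have hb2 : R.initError γ η / (η * T) ≤ 1 / η₀ * (1 / s) := by
    have e : η * T = η₀ * q := by rw [hη', hTs]; field_simp
    rw [e]
    refine (div_le_div_of_nonneg_right hb (by positivity)).trans_eq ?_
    field_simp
  have hγA : γ * A = K₀ * γ₀ * (1 / (s ^ 3 * q)) + D * γ₀ * y * (1 / s ^ 3)
      + D * B ^ α * γ₀ ^ (1 + α) * (1 / s ^ 3) + D * G ^ α * γ₀ * (1 / (s ^ 3 * q))
      + K₂ * (γ₀ ^ (1 / (1 - α)) * w) := by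
    have e : γ * A = γ * K₀ + D * (γ * (y * q + B ^ α * (γ₀ ^ α * q) + G ^ α))
        + K₂ * (γ * γ ^ (α / (1 - α))) := by
      rw [hA, hlα, hTγα, hy]; ring
    rw [e, hγγ, hγ', Real.rpow_add hγ₀, Real.rpow_one]
    field_simp
    ring
  have hgap : Q.gap / (γ * T) = Q.gap / γ₀ * (1 / s) := by
    rw [mul_comm, hTγ]; field_simp
  have hηBG : η * (B * (T * γ) + G) / √η =
      z * B * γ₀ * (1 / s) + z * G * (1 / s ^ 2) := by
    rw [hsqrt, hTγ, hη', hz2]; field_simp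
  have hγAη : γ * A / √η = K₀ * γ₀ / z * (1 / (s * q)) + D * γ₀ * y / z * (1 / s)
      + D * B ^ α * γ₀ ^ (1 + α) / z * (1 / s) + D * G ^ α * γ₀ / z * (1 / (s * q))
      + K₂ * γ₀ ^ (1 / (1 - α)) / z * (w * s ^ 2) := by
    rw [hγA, hsqrt]
    field_simp
  rw [add_div, hγAη, hηBG, hgap, hγA] at hle
  have two_rpow : (2 : ℝ) ^ (1 + α / 2) = 2 * 2 ^ (α / 2) := by
    rw [Real.rpow_add two_pos, Real.rpow_one]
  rw [p1, p2, p3, p1α, p3α, pw, two_rpow]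
  -- The computation yields `2 K₂` for the `w` term, while the claim has `4 K₂`; this nonnegative
  -- quantity fills the gap.
  have hlast : 0 ≤ K₂ * (γ₀ ^ (1 / (1 - α)) * w) := by positivity
  have hmain := hquarter.trans hle
  have hrhs : (4 * Q.gap / γ₀ + 8 / η₀
        + 8 * (1 - α) * α ^ (α / (1 - α)) * 2 ^ (α / 2) * K₁ * γ₀
            * lam₀ ^ (-(α / (1 - α))) / z
        + 8 * 2 ^ (α / 2) * K₁ * B ^ α * γ₀ ^ (1 + α) / z
        + 8 * z * B * γ₀) * (1 / s)
      + (8 * K₀ * γ₀ / z + 8 * 2 ^ (α / 2) * K₁ * G ^ α * γ₀ / z) * (1 / (s * q))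
      + 8 * z * G * (1 / s ^ 2)
      + 8 * K₂ * γ₀ ^ (1 / (1 - α)) / z * (w * s ^ 2)
      + 2 * K₀ * γ₀ * (1 / (s ^ 3 * q))
      + 2 * (1 - α) * α ^ (α / (1 - α)) * 2 ^ (α / 2) * K₁ * γ₀
          * lam₀ ^ (-(α / (1 - α))) * (1 / s ^ 3)
      + 4 * K₂ * γ₀ ^ (1 / (1 - α)) * w
      + 2 * 2 ^ (α / 2) * K₁ * G ^ α * γ₀ * (1 / (s ^ 3 * q))
      + 2 * 2 ^ (α / 2) * K₁ * B ^ α * γ₀ ^ (1 + α) * (1 / s ^ 3) =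
      4 * (Q.gap / γ₀ * (1 / s) + 2 * (1 / η₀ * (1 / s))
        + 2 * (K₀ * γ₀ / z * (1 / (s * q)) + D * γ₀ * y / z * (1 / s)
          + D * B ^ α * γ₀ ^ (1 + α) / z * (1 / s) + D * G ^ α * γ₀ / z * (1 / (s * q))
          + K₂ * γ₀ ^ (1 / (1 - α)) / z * (w * s ^ 2)
          + (z * B * γ₀ * (1 / s) + z * G * (1 / s ^ 2)))
        + (K₀ * γ₀ * (1 / (s ^ 3 * q)) + D * γ₀ * y * (1 / s ^ 3)
          + D * B ^ α * γ₀ ^ (1 + α) * (1 / s ^ 3) + D * G ^ α * γ₀ * (1 / (s ^ 3 * q))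
          + K₂ * (γ₀ ^ (1 / (1 - α)) * w)) / 2) + 2 * (K₂ * (γ₀ ^ (1 / (1 - α)) * w)) := by
    rw [hD, hy]; ring
  rw [hrhs]
  linarith

theorem meanGradNorm_le_of_expectedSymSmooth_one {L₀ L₁ γ₀ T γ η : ℝ}
    (hB : 0 ≤ B) (hG : 0 ≤ G) (hL₀ : 0 < L₀) (hL₁ : 0 < L₁) (hγ₀ : 0 < γ₀)
    (hγ₀1 : γ₀ ≤ 1 / (16 * √(2 * Real.exp (3 / 4)) * L₁))
    (hQ : Q.ExpectedSymSmooth 1 L₀ L₁) (hT : T = (K : ℝ) + 1)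
    (hγ : γ = powerSchedule γ₀ (4 / 5) K) (hη : η = powerSchedule 1 (4 / 5) K)
    (R : NSTORMRun Q 1 K Ω) :
    Integrable (R.gradNorm γ η) R.P ∧ R.meanGradNorm γ η ≤
      (4 * Q.gap / γ₀ + 8 * R.initError γ η + 8 * B * γ₀
        + 16 * √(2 * Real.exp (3 / 4)) * L₁ * B * γ₀ ^ 2) * T ^ (-(1 / 5) : ℝ)
      + (8 * √(2 * Real.exp (3 / 4)) * γ₀ * (L₀ + 2 * L₁ * G) + 8 * G) * T ^ (-(2 / 5) : ℝ)
      + 8 * √2 * L₁ * B * γ₀ ^ 2 * T ^ (-(3 / 5) : ℝ)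
      + (4 * √2 * L₀ * γ₀ + 8 * √2 * L₁ * G * γ₀) * T ^ (-(4 / 5) : ℝ) := by
  have hT1 : 1 ≤ T := by rw [hT]; linarith [(Nat.cast_nonneg K : (0 : ℝ) ≤ K)]
  have hT0 : 0 < T := by linarith
  set s := T ^ (1 / 5 : ℝ) with hs
  have hs0 : 0 < s := by positivity
  have hs1 : 1 ≤ s := Real.one_le_rpow hT1 (by norm_num)
  have hpow : ∀ n : ℕ, T ^ ((n : ℝ) / 5) = s ^ n := fun n => by
    rw [hs, ← Real.rpow_natCast, ← Real.rpow_mul hT0.le]; congr 1; ring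
  have p1 : T ^ (-(1 / 5) : ℝ) = 1 / s := by rw [Real.rpow_neg hT0.le, ← hs, one_div]
  have p2 : T ^ (-(2 / 5) : ℝ) = 1 / s ^ 2 := by
    rw [Real.rpow_neg hT0.le, one_div, ← hpow]; norm_num
  have p3 : T ^ (-(3 / 5) : ℝ) = 1 / s ^ 3 := by
    rw [Real.rpow_neg hT0.le, one_div, ← hpow]; norm_num
  have p4 : T ^ (-(4 / 5) : ℝ) = 1 / s ^ 4 := by
    rw [Real.rpow_neg hT0.le, one_div, ← hpow]; norm_num
  have hTs : T = s ^ 5 := by rw [← hpow]; norm_num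
  set c := √(2 * Real.exp (3 / 4)) with hc
  have hsqrt2 : 4 / 3 ≤ √2 := Real.le_sqrt_of_sq_le (by norm_num)
  have hc2 : √2 ≤ c :=
    Real.sqrt_le_sqrt (by linarith [Real.one_le_exp (show (0 : ℝ) ≤ 3 / 4 by norm_num)])
  have hc0 : 0 < c := by linarith
  -- Of the constant `√(2 e^(3/4))` only `c ≥ 1` is needed here; the later comparisons use `c ≥ √2 ≥
  -- 4/3`.
  have hγL : γ₀ * L₁ ≤ 1 / 16 := by
    have h1 := (le_div_iff₀ (by positivity)).1 hγ₀1
    have : γ₀ * L₁ * 1 ≤ γ₀ * L₁ * c := by gcongr; linarith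
    linarith
  have hγ' : γ = γ₀ * (1 / s ^ 4) := by rw [hγ, powerSchedule, ← hT, p4]
  have hη' : η = 1 / s ^ 4 := by rw [hη, powerSchedule, ← hT, p4, one_mul]
  have hs4 : 1 / s ^ 4 ≤ 1 := by
    rw [div_le_one (by positivity)]; exact one_le_pow₀ hs1
  have hγ0 : 0 < γ := by rw [hγ']; positivity
  have hη0 : 0 < η := by rw [hη']; positivity
  have hη1 : η ≤ 1 := hη'.le.trans hs4
  have hγγ₀ : γ ≤ γ₀ := by rw [hγ']; exact mul_le_of_le_one_right hγ₀.le hs4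
  have hγL' : γ * L₁ ≤ 1 / 16 := (mul_le_mul_of_nonneg_right hγγ₀ hL₁.le).trans hγL
  have hTγ : T * γ = γ₀ * s := by rw [hγ', hTs]; field_simp
  have hsm := hQ.locallySmooth_one hB hG hL₀ hL₁ (r := ((K : ℝ) + 1) * γ) hγL'
  obtain ⟨hint, hle⟩ := R.meanGradNorm_bound hB hG hγ0 hη0 hη1 (by positivity) (by positivity) hsm
  refine ⟨hint, ?_⟩
  rw [← hT, hTγ] at hle
  have hsqrt : √η = 1 / s ^ 2 := by
    rw [hη', show (1 : ℝ) / s ^ 4 = (1 / s ^ 2) ^ 2 by field_simp]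
    exact Real.sqrt_sq (by positivity)
  have c1 : γ * (16 / 15 * L₁) / η ≤ 1 / 15 := by
    have e : γ * (16 / 15 * L₁) / η = 16 / 15 * (γ₀ * L₁) := by
      rw [hγ', hη']; field_simp
    rw [e]; linarith
  have hm0 : 0 ≤ R.meanGradNorm γ η := integral_nonneg fun _ => norm_nonneg _
  -- The coefficient is at least `1 - 2/15 - 1/30 = 5/6`; the weaker `1/4` already gives the stated
  -- constants.
  have hquarter : 1 / 4 * R.meanGradNorm γ η ≤
      (1 - 2 * (γ * (16 / 15 * L₁) / η) - γ * (16 / 15 * L₁) / 2) * R.meanGradNorm γ η :=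
    mul_le_mul_of_nonneg_right (by linarith) hm0
  have hmain := hquarter.trans hle
  set A := 16 / 15 * (L₀ + L₁ * (B * (γ₀ * s) + G)) with hA
  have e1 : Q.gap / (γ * T) = Q.gap / γ₀ * (1 / s) := by rw [mul_comm γ T, hTγ]; field_simp
  have e2 : R.initError γ η / (η * T) = R.initError γ η * (1 / s) := by
    rw [show η * T = s by rw [hη', hTs]; field_simp, ← div_eq_mul_one_div]
  have e3 : (γ * A + η * (B * (γ₀ * s) + G)) / √η =
      16 / 15 * γ₀ * (L₀ + L₁ * G) * (1 / s ^ 2) + 16 / 15 * L₁ * B * γ₀ ^ 2 * (1 / s)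
        + B * γ₀ * (1 / s) + G * (1 / s ^ 2) := by
    rw [hsqrt, hγ', hη', hA]; field_simp; ring
  have e4 : γ * A = 16 / 15 * γ₀ * (L₀ + L₁ * G) * (1 / s ^ 4)
      + 16 / 15 * L₁ * B * γ₀ ^ 2 * (1 / s ^ 3) := by
    rw [hγ', hA]; field_simp; ring
  rw [e3, e1, e2, e4] at hmain
  rw [mul_div_assoc 4 Q.gap γ₀, p1, p2, p3, p4]
  -- The computed factors `16/15` are relaxed to the stated multiples of `c` and `√2`, and `L₁ G` to
  -- `2 L₁ G`.
  have t1 : 16 / 15 * L₁ * B * γ₀ ^ 2 * (1 / s) ≤ 2 * c * L₁ * B * γ₀ ^ 2 * (1 / s) := by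
    gcongr; linarith
  have t2 : 16 / 15 * γ₀ * (L₀ + L₁ * G) * (1 / s ^ 2) ≤
      c * γ₀ * (L₀ + 2 * L₁ * G) * (1 / s ^ 2) := by
    have : 0 ≤ L₁ * G := by positivity
    gcongr <;> linarith
  have t3 : 16 / 15 * L₁ * B * γ₀ ^ 2 * (1 / s ^ 3) ≤ 4 * √2 * L₁ * B * γ₀ ^ 2 * (1 / s ^ 3) := by
    gcongr; linarith
  have t4 : 16 / 15 * γ₀ * (L₀ + L₁ * G) * (1 / s ^ 4) ≤
      2 * √2 * γ₀ * (L₀ + 2 * L₁ * G) * (1 / s ^ 4) := by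
    have : 0 ≤ L₁ * G := by positivity
    gcongr <;> linarith
  linarith

end NSTORMRun

/-! ### Uniform constants and oracle complexity -/

theorem theorem2 :
    -- (i) mean-square smoothness
    (∀ B G L γ₀ Δ : ℝ, 0 ≤ B → 0 ≤ G → 0 < L → 0 < γ₀ →
      ∃ C : ℝ,
        (∀ (d : ℕ) (Ξ : Type u) [MeasurableSpace Ξ] (Q : BG0Problem d Ξ B G),
          Q.MeanSquareSmooth L → Q.gap = Δ →
          ∀ (K : ℕ) (T γ η : ℝ), T = (K : ℝ) + 1 →
          γ = powerSchedule γ₀ (3 / 4) K → η = powerSchedule 1 1 K →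
          ∀ (Ω : Type v) [MeasurableSpace Ω] (R : NSTORMRun Q (initBatch G (1 / 2) K) K Ω),
            Integrable (R.gradNorm γ η) R.P ∧
            R.meanGradNorm γ η ≤
              (Δ / γ₀ + 2 * (1 + L * γ₀ + B * γ₀)) * T ^ (-(1 / 4) : ℝ)
              + 2 * G * T ^ (-(1 / 2) : ℝ) + L * γ₀ / 2 * T ^ (-(3 / 4) : ℝ) ∧
            R.meanGradNorm γ η ≤ C * T ^ (-(1 / 4) : ℝ)) ∧
        (∀ ε : ℝ, 0 < ε → ε ≤ 1 → ∃ K : ℕ,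
          ∀ (d : ℕ) (Ξ : Type u) [MeasurableSpace Ξ] (Q : BG0Problem d Ξ B G),
          Q.MeanSquareSmooth L → Q.gap = Δ →
          ∀ γ η : ℝ, γ = powerSchedule γ₀ (3 / 4) K → η = powerSchedule 1 1 K →
          ∀ (Ω : Type v) [MeasurableSpace Ω] (R : NSTORMRun Q (initBatch G (1 / 2) K) K Ω),
            R.meanGradNorm γ η ≤ ε ∧
            ∀ ω, (R.totalCalls γ η ω : ℝ) ≤ C * ε ^ (-4 : ℝ))) ∧
    -- (ii) expected symmetric generalized smoothness with exponent in (0, 1)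
    (∀ α B G L₀ L₁ γ₀ η₀ lam₀ Δ K₀ K₁ K₂ : ℝ, 0 < α → α < 1 → 0 ≤ B → 0 ≤ G → 0 < L₀ → 0 < L₁ →
      0 < γ₀ → 0 < η₀ → η₀ ≤ 1 → 0 < lam₀ →
      K₀ = 2 ^ ((2 - α) / (1 - α)) * L₀ →
      K₁ = 2 ^ ((2 - α) / (1 - α)) * L₁ →
      K₂ = (5 * L₁) ^ (1 / (1 - α)) →
      2 ^ (α / 2) * K₁ * lam₀ * γ₀ ≤ 1 →
      2 ^ ((6 + α) / 2) * K₁ * lam₀ * (γ₀ / η₀) ≤ 1 →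
      (∀ e ∈ [(1 + α) / (4 + α), 2 / (4 + α), (1 + 3 * α) / ((1 - α) * (4 + α)),
          (3 + α) / (4 + α), 3 / (4 + α), (3 + α) / ((1 - α) * (4 + α))], 1 / (4 + α) ≤ e) ∧
      ∃ C : ℝ,
        (∀ (d : ℕ) (Ξ : Type u) [MeasurableSpace Ξ] (Q : BG0Problem d Ξ B G),
          Q.ExpectedSymSmooth α L₀ L₁ → Q.gap = Δ →
          ∀ (K : ℕ) (T γ η : ℝ), T = (K : ℝ) + 1 →
          γ = powerSchedule γ₀ ((3 + α) / (4 + α)) K → η = powerSchedule η₀ (4 / (4 + α)) K →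
          ∀ (Ω : Type v) [MeasurableSpace Ω]
            (R : NSTORMRun Q (initBatch G (2 * (1 - α) / (4 + α)) K) K Ω),
            Integrable (R.gradNorm γ η) R.P ∧
            R.meanGradNorm γ η ≤
              (4 * Δ / γ₀ + 8 / η₀
                + 8 * (1 - α) * α ^ (α / (1 - α)) * 2 ^ (α / 2) * K₁ * γ₀
                    * lam₀ ^ (-(α / (1 - α))) / √η₀
                + 8 * 2 ^ (α / 2) * K₁ * B ^ α * γ₀ ^ (1 + α) / √η₀
                + 8 * √η₀ * B * γ₀) * T ^ (-(1 / (4 + α)))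
              + (8 * K₀ * γ₀ / √η₀ + 8 * 2 ^ (α / 2) * K₁ * G ^ α * γ₀ / √η₀)
                  * T ^ (-((1 + α) / (4 + α)))
              + 8 * √η₀ * G * T ^ (-(2 / (4 + α)))
              + 8 * K₂ * γ₀ ^ (1 / (1 - α)) / √η₀
                  * T ^ (-((1 + 3 * α) / ((1 - α) * (4 + α))))
              + 2 * K₀ * γ₀ * T ^ (-((3 + α) / (4 + α)))
              + 2 * (1 - α) * α ^ (α / (1 - α)) * 2 ^ (α / 2) * K₁ * γ₀
                  * lam₀ ^ (-(α / (1 - α))) * T ^ (-(3 / (4 + α)))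
              + 4 * K₂ * γ₀ ^ (1 / (1 - α)) * T ^ (-((3 + α) / ((1 - α) * (4 + α))))
              + 2 ^ (1 + α / 2) * K₁ * G ^ α * γ₀ * T ^ (-((3 + α) / (4 + α)))
              + 2 ^ (1 + α / 2) * K₁ * B ^ α * γ₀ ^ (1 + α) * T ^ (-(3 / (4 + α))) ∧
            R.meanGradNorm γ η ≤ C * T ^ (-(1 / (4 + α)))) ∧
        (∀ ε : ℝ, 0 < ε → ε ≤ 1 → ∃ K : ℕ,
          ∀ (d : ℕ) (Ξ : Type u) [MeasurableSpace Ξ] (Q : BG0Problem d Ξ B G),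
          Q.ExpectedSymSmooth α L₀ L₁ → Q.gap = Δ →
          ∀ γ η : ℝ,
          γ = powerSchedule γ₀ ((3 + α) / (4 + α)) K → η = powerSchedule η₀ (4 / (4 + α)) K →
          ∀ (Ω : Type v) [MeasurableSpace Ω]
            (R : NSTORMRun Q (initBatch G (2 * (1 - α) / (4 + α)) K) K Ω),
            R.meanGradNorm γ η ≤ ε ∧
            ∀ ω, (R.totalCalls γ η ω : ℝ) ≤ C * ε ^ (-(4 + α)))) ∧
    -- (iii) expected symmetric generalized smoothness with exponent 1, one initial sample
    (∀ B G L₀ L₁ γ₀ Δ : ℝ, 0 ≤ B → 0 ≤ G → 0 < L₀ → 0 < L₁ →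
      0 < γ₀ → γ₀ ≤ 1 / (16 * √(2 * Real.exp (3 / 4)) * L₁) →
      ∃ C : ℝ,
        (∀ (d : ℕ) (Ξ : Type u) [MeasurableSpace Ξ] (Q : BG0Problem d Ξ B G),
          Q.ExpectedSymSmooth 1 L₀ L₁ → Q.gap = Δ →
          ∀ (K : ℕ) (T γ η : ℝ), T = (K : ℝ) + 1 →
          γ = powerSchedule γ₀ (4 / 5) K → η = powerSchedule 1 (4 / 5) K →
          ∀ (Ω : Type v) [MeasurableSpace Ω] (R : NSTORMRun Q 1 K Ω),
            R.initError γ η ≤ G ∧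
            Integrable (R.gradNorm γ η) R.P ∧
            R.meanGradNorm γ η ≤
              (4 * Δ / γ₀ + 8 * R.initError γ η + 8 * B * γ₀
                + 16 * √(2 * Real.exp (3 / 4)) * L₁ * B * γ₀ ^ 2) * T ^ (-(1 / 5) : ℝ)
              + (8 * √(2 * Real.exp (3 / 4)) * γ₀ * (L₀ + 2 * L₁ * G) + 8 * G)
                  * T ^ (-(2 / 5) : ℝ)
              + 8 * √2 * L₁ * B * γ₀ ^ 2 * T ^ (-(3 / 5) : ℝ)
              + (4 * √2 * L₀ * γ₀ + 8 * √2 * L₁ * G * γ₀) * T ^ (-(4 / 5) : ℝ) ∧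
            R.meanGradNorm γ η ≤ C * T ^ (-(1 / 5) : ℝ)) ∧
        (∀ ε : ℝ, 0 < ε → ε ≤ 1 → ∃ K : ℕ,
          ∀ (d : ℕ) (Ξ : Type u) [MeasurableSpace Ξ] (Q : BG0Problem d Ξ B G),
          Q.ExpectedSymSmooth 1 L₀ L₁ → Q.gap = Δ →
          ∀ γ η : ℝ, γ = powerSchedule γ₀ (4 / 5) K → η = powerSchedule 1 (4 / 5) K →
          ∀ (Ω : Type v) [MeasurableSpace Ω] (R : NSTORMRun Q 1 K Ω),
            R.meanGradNorm γ η ≤ ε ∧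
            ∀ ω, (R.totalCalls γ η ω : ℝ) ≤ C * ε ^ (-5 : ℝ)))
    := by
  refine ⟨?_, ?_, ?_⟩
  · intro B G L γ₀ Δ hB hG hL hγ₀
    -- The constant is fixed before any problem is given, when `Δ` is just a real number; the
    -- absolute value keeps `C₁` nonnegative.
    set C₁ := |Δ| / γ₀ + 2 * (1 + L * γ₀ + B * γ₀) + 2 * G + L * γ₀ / 2 with hC₁
    have hC₁0 : 0 ≤ C₁ := by positivity
    have hrate : ∀ (d : ℕ) (Ξ : Type u) [MeasurableSpace Ξ] (Q : BG0Problem d Ξ B G),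
        Q.MeanSquareSmooth L → Q.gap = Δ →
        ∀ (K : ℕ) (T γ η : ℝ), T = (K : ℝ) + 1 →
        γ = powerSchedule γ₀ (3 / 4) K → η = powerSchedule 1 1 K →
        ∀ (Ω : Type v) [MeasurableSpace Ω] (R : NSTORMRun Q (initBatch G (1 / 2) K) K Ω),
        R.meanGradNorm γ η ≤ C₁ * T ^ (-(1 / 4) : ℝ) := by
      intro d Ξ _ Q hQ hΔ K T γ η hT hγ hη Ω _ R
      have h := (R.meanGradNorm_le_of_meanSquareSmooth hB hG hL hγ₀ hQ hT hγ hη).2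
      have hT1 : 1 ≤ T := by rw [hT]; linarith [(Nat.cast_nonneg K : (0 : ℝ) ≤ K)]
      rw [hΔ] at h
      calc R.meanGradNorm γ η ≤ _ := h
        _ ≤ (|Δ| / γ₀ + 2 * (1 + L * γ₀ + B * γ₀)) * T ^ (-(1 / 4) : ℝ)
            + 2 * G * T ^ (-(1 / 4) : ℝ) + L * γ₀ / 2 * T ^ (-(1 / 4) : ℝ) := by
          gcongr
          · exact le_abs_self Δ
          · norm_num
          · norm_num
        _ = C₁ * T ^ (-(1 / 4) : ℝ) := by rw [hC₁]; ring
    -- One constant serves the rate and the number of calls: `4 + G²` bounds the calls per unit of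
    -- `T`, and `C₁⁴ + 2` comes from the choice of the horizon.
    refine ⟨max C₁ ((4 + G ^ 2) * (C₁ ^ (4 : ℝ) + 2)), ?_, ?_⟩
    · intro d Ξ _ Q hQ hΔ K T γ η hT hγ hη Ω _ R
      have h := R.meanGradNorm_le_of_meanSquareSmooth hB hG hL hγ₀ hQ hT hγ hη
      have hT0 : 0 < T := by rw [hT]; positivity
      refine ⟨h.1, hΔ ▸ h.2, (hrate d Ξ Q hQ hΔ K T γ η hT hγ hη Ω R).trans ?_⟩
      gcongr
      exact le_max_left _ _
    · intro ε hε hε1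
      obtain ⟨K, hK1, hK2⟩ := exists_horizon hC₁0 (show (0 : ℝ) < 4 by norm_num) hε hε1
      refine ⟨K, fun d Ξ _ Q hQ hΔ γ η hγ hη Ω _ R =>
        ⟨(hrate d Ξ Q hQ hΔ K _ γ η rfl hγ hη Ω R).trans hK1, fun ω => ?_⟩⟩
      refine (R.totalCalls_le (initBatch_le (by norm_num) K) hK2 ω).trans ?_
      rw [← mul_assoc]
      gcongr
      exact le_max_right _ _
  · intro α B G L₀ L₁ γ₀ η₀ lam₀ Δ K₀ K₁ K₂ hα hα1 hB hG hL₀ hL₁ hγ₀ hη₀ hη₀1 hlam₀ hK₀ hK₁ hK₂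
      hs₁ hs₂
    have h1α : 0 < 1 - α := sub_pos.2 hα1
    have h4α : 0 < 4 + α := by linarith
    have hexp : ∀ e ∈ [(1 + α) / (4 + α), 2 / (4 + α), (1 + 3 * α) / ((1 - α) * (4 + α)),
          (3 + α) / (4 + α), 3 / (4 + α), (3 + α) / ((1 - α) * (4 + α))], 1 / (4 + α) ≤ e := by
      have hdiv : ∀ a : ℝ, 1 ≤ a → 1 / (4 + α) ≤ a / (4 + α) := fun a ha =>
        div_le_div_of_nonneg_right ha h4α.le
      -- For a denominator with the extra factor `1 - α`, a numerator of at least `1 - α` is enough.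
      have hdiv' : ∀ a : ℝ, 1 - α ≤ a → 1 / (4 + α) ≤ a / ((1 - α) * (4 + α)) := fun a ha => by
        rw [← div_div]
        exact hdiv _ ((one_le_div h1α).2 ha)
      simp only [List.mem_cons, List.not_mem_nil, or_false]
      rintro e (rfl | rfl | rfl | rfl | rfl | rfl)
      · exact hdiv _ (by linarith)
      · exact hdiv _ (by linarith)
      · exact hdiv' _ (by linarith)
      · exact hdiv _ (by linarith)
      · exact hdiv _ (by linarith)
      · exact hdiv' _ (by linarith)
    refine ⟨hexp, ?_⟩
    have hK₀0 : 0 ≤ K₀ := by rw [hK₀]; positivity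
    have hK₁0 : 0 ≤ K₁ := by rw [hK₁]; positivity
    have hK₂0 : 0 ≤ K₂ := by rw [hK₂]; positivity
    set C₁ := 4 * |Δ| / γ₀ + 8 / η₀
      + 8 * (1 - α) * α ^ (α / (1 - α)) * 2 ^ (α / 2) * K₁ * γ₀
          * lam₀ ^ (-(α / (1 - α))) / √η₀
      + 8 * 2 ^ (α / 2) * K₁ * B ^ α * γ₀ ^ (1 + α) / √η₀
      + 8 * √η₀ * B * γ₀
      + (8 * K₀ * γ₀ / √η₀ + 8 * 2 ^ (α / 2) * K₁ * G ^ α * γ₀ / √η₀)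
      + 8 * √η₀ * G
      + 8 * K₂ * γ₀ ^ (1 / (1 - α)) / √η₀
      + 2 * K₀ * γ₀
      + 2 * (1 - α) * α ^ (α / (1 - α)) * 2 ^ (α / 2) * K₁ * γ₀ * lam₀ ^ (-(α / (1 - α)))
      + 4 * K₂ * γ₀ ^ (1 / (1 - α))
      + 2 ^ (1 + α / 2) * K₁ * G ^ α * γ₀
      + 2 ^ (1 + α / 2) * K₁ * B ^ α * γ₀ ^ (1 + α) with hC₁
    have hC₁0 : 0 ≤ C₁ := by positivity
    have hrate : ∀ (d : ℕ) (Ξ : Type u) [MeasurableSpace Ξ] (Q : BG0Problem d Ξ B G),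
        Q.ExpectedSymSmooth α L₀ L₁ → Q.gap = Δ →
        ∀ (K : ℕ) (T γ η : ℝ), T = (K : ℝ) + 1 →
        γ = powerSchedule γ₀ ((3 + α) / (4 + α)) K → η = powerSchedule η₀ (4 / (4 + α)) K →
        ∀ (Ω : Type v) [MeasurableSpace Ω]
          (R : NSTORMRun Q (initBatch G (2 * (1 - α) / (4 + α)) K) K Ω),
        R.meanGradNorm γ η ≤ C₁ * T ^ (-(1 / (4 + α))) := by
      intro d Ξ _ Q hQ hΔ K T γ η hT hγ hη Ω _ R
      have h := (R.meanGradNorm_le_of_expectedSymSmooth hα hα1 hB hG hL₀ hL₁ hγ₀ hη₀ hη₀1 hlam₀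
        hK₀ hK₁ hK₂ hs₁ hs₂ hQ hT hγ hη).2
      have hT1 : 1 ≤ T := by rw [hT]; linarith [(Nat.cast_nonneg K : (0 : ℝ) ≤ K)]
      have hdec : ∀ e, 1 / (4 + α) ≤ e → T ^ (-e) ≤ T ^ (-(1 / (4 + α))) := fun e he =>
        Real.rpow_le_rpow_of_exponent_le hT1 (neg_le_neg he)
      simp only [List.forall_mem_cons] at hexp
      obtain ⟨x1, x2, x3, x4, x5, x6, -⟩ := hexp
      rw [hΔ] at h
      have y0 := le_abs_self Δ
      have y1 := hdec _ x1
      have y2 := hdec _ x2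
      have y3 := hdec _ x3
      have y4 := hdec _ x4
      have y5 := hdec _ x5
      have y6 := hdec _ x6
      have hτ : 0 < T ^ (-(1 / (4 + α))) := by positivity
      set τ := T ^ (-(1 / (4 + α)))
      calc R.meanGradNorm γ η ≤ _ := h
        _ ≤ (4 * |Δ| / γ₀ + 8 / η₀
              + 8 * (1 - α) * α ^ (α / (1 - α)) * 2 ^ (α / 2) * K₁ * γ₀
                  * lam₀ ^ (-(α / (1 - α))) / √η₀
              + 8 * 2 ^ (α / 2) * K₁ * B ^ α * γ₀ ^ (1 + α) / √η₀
              + 8 * √η₀ * B * γ₀) * τ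
            + (8 * K₀ * γ₀ / √η₀ + 8 * 2 ^ (α / 2) * K₁ * G ^ α * γ₀ / √η₀) * τ
            + 8 * √η₀ * G * τ
            + 8 * K₂ * γ₀ ^ (1 / (1 - α)) / √η₀ * τ
            + 2 * K₀ * γ₀ * τ
            + 2 * (1 - α) * α ^ (α / (1 - α)) * 2 ^ (α / 2) * K₁ * γ₀
                * lam₀ ^ (-(α / (1 - α))) * τ
            + 4 * K₂ * γ₀ ^ (1 / (1 - α)) * τ
            + 2 ^ (1 + α / 2) * K₁ * G ^ α * γ₀ * τ
            + 2 ^ (1 + α / 2) * K₁ * B ^ α * γ₀ ^ (1 + α) * τ := by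
          refine add_le_add (add_le_add (add_le_add (add_le_add (add_le_add (add_le_add (add_le_add
            (add_le_add ?_ ?_) ?_) ?_) ?_) ?_) ?_) ?_) ?_
          · gcongr
          · exact mul_le_mul_of_nonneg_left y1 (by positivity)
          · exact mul_le_mul_of_nonneg_left y2 (by positivity)
          · exact mul_le_mul_of_nonneg_left y3 (by positivity)
          · exact mul_le_mul_of_nonneg_left y4 (by positivity)
          · exact mul_le_mul_of_nonneg_left y5 (by positivity)
          · exact mul_le_mul_of_nonneg_left y6 (by positivity)
          · exact mul_le_mul_of_nonneg_left y4 (by positivity)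
          · exact mul_le_mul_of_nonneg_left y5 (by positivity)
        _ = C₁ * τ := by rw [hC₁]; ring
    refine ⟨max C₁ ((4 + G ^ 2) * (C₁ ^ (4 + α) + 2)), ?_, ?_⟩
    · intro d Ξ _ Q hQ hΔ K T γ η hT hγ hη Ω _ R
      have h := R.meanGradNorm_le_of_expectedSymSmooth hα hα1 hB hG hL₀ hL₁ hγ₀ hη₀ hη₀1 hlam₀
        hK₀ hK₁ hK₂ hs₁ hs₂ hQ hT hγ hη
      have hT0 : 0 < T := by rw [hT]; positivity
      refine ⟨h.1, hΔ ▸ h.2, (hrate d Ξ Q hQ hΔ K T γ η hT hγ hη Ω R).trans ?_⟩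
      exact mul_le_mul_of_nonneg_right (le_max_left _ _) (by positivity)
    · intro ε hε hε1
      obtain ⟨K, hK1, hK2⟩ := exists_horizon hC₁0 h4α hε hε1
      refine ⟨K, fun d Ξ _ Q hQ hΔ γ η hγ hη Ω _ R =>
        ⟨(hrate d Ξ Q hQ hΔ K _ γ η rfl hγ hη Ω R).trans hK1, fun ω => ?_⟩⟩
      have hr : 2 * (1 - α) / (4 + α) ≤ 1 := by rw [div_le_one h4α]; linarith
      refine (R.totalCalls_le (initBatch_le hr K) hK2 ω).trans ?_
      rw [← mul_assoc]
      exact mul_le_mul_of_nonneg_right (le_max_right _ _) (by positivity)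
  · intro B G L₀ L₁ γ₀ Δ hB hG hL₀ hL₁ hγ₀ hγ₀1
    -- The initial error depends on the run, so its bound `G` takes its place in the uniform
    -- constant.
    set C₁ := 4 * |Δ| / γ₀ + 8 * G + 8 * B * γ₀
      + 16 * √(2 * Real.exp (3 / 4)) * L₁ * B * γ₀ ^ 2
      + (8 * √(2 * Real.exp (3 / 4)) * γ₀ * (L₀ + 2 * L₁ * G) + 8 * G)
      + 8 * √2 * L₁ * B * γ₀ ^ 2
      + (4 * √2 * L₀ * γ₀ + 8 * √2 * L₁ * G * γ₀) with hC₁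
    have hC₁0 : 0 ≤ C₁ := by positivity
    have hrate : ∀ (d : ℕ) (Ξ : Type u) [MeasurableSpace Ξ] (Q : BG0Problem d Ξ B G),
        Q.ExpectedSymSmooth 1 L₀ L₁ → Q.gap = Δ →
        ∀ (K : ℕ) (T γ η : ℝ), T = (K : ℝ) + 1 →
        γ = powerSchedule γ₀ (4 / 5) K → η = powerSchedule 1 (4 / 5) K →
        ∀ (Ω : Type v) [MeasurableSpace Ω] (R : NSTORMRun Q 1 K Ω),
        R.initError γ η ≤ G ∧ R.meanGradNorm γ η ≤ C₁ * T ^ (-(1 / 5) : ℝ) := by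
      intro d Ξ _ Q hQ hΔ K T γ η hT hγ hη Ω _ R
      have h := (R.meanGradNorm_le_of_expectedSymSmooth_one hB hG hL₀ hL₁ hγ₀ hγ₀1 hQ hT hγ hη).2
      have hT1 : 1 ≤ T := by rw [hT]; linarith [(Nat.cast_nonneg K : (0 : ℝ) ≤ K)]
      have hb : R.initError γ η ≤ G := by
        simpa using R.initError_le (γ := γ) (η := η) hG one_pos
      refine ⟨hb, ?_⟩
      rw [hΔ] at h
      calc R.meanGradNorm γ η ≤ _ := h
        _ ≤ (4 * |Δ| / γ₀ + 8 * G + 8 * B * γ₀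
              + 16 * √(2 * Real.exp (3 / 4)) * L₁ * B * γ₀ ^ 2) * T ^ (-(1 / 5) : ℝ)
            + (8 * √(2 * Real.exp (3 / 4)) * γ₀ * (L₀ + 2 * L₁ * G) + 8 * G)
                * T ^ (-(1 / 5) : ℝ)
            + 8 * √2 * L₁ * B * γ₀ ^ 2 * T ^ (-(1 / 5) : ℝ)
            + (4 * √2 * L₀ * γ₀ + 8 * √2 * L₁ * G * γ₀) * T ^ (-(1 / 5) : ℝ) := by
          gcongr
          · exact le_abs_self Δ
          · norm_num
          · norm_num
          · norm_num
        _ = C₁ * T ^ (-(1 / 5) : ℝ) := by rw [hC₁]; ring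
    refine ⟨max C₁ ((4 + G ^ 2) * (C₁ ^ (5 : ℝ) + 2)), ?_, ?_⟩
    · intro d Ξ _ Q hQ hΔ K T γ η hT hγ hη Ω _ R
      have h := R.meanGradNorm_le_of_expectedSymSmooth_one hB hG hL₀ hL₁ hγ₀ hγ₀1 hQ hT hγ hη
      obtain ⟨hb, hr⟩ := hrate d Ξ Q hQ hΔ K T γ η hT hγ hη Ω R
      have hT0 : 0 < T := by rw [hT]; positivity
      refine ⟨hb, h.1, hΔ ▸ h.2, hr.trans ?_⟩
      exact mul_le_mul_of_nonneg_right (le_max_left _ _) (by positivity)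
    · intro ε hε hε1
      obtain ⟨K, hK1, hK2⟩ := exists_horizon hC₁0 (show (0 : ℝ) < 5 by norm_num) hε hε1
      refine ⟨K, fun d Ξ _ Q hQ hΔ γ η hγ hη Ω _ R =>
        ⟨(hrate d Ξ Q hQ hΔ K _ γ η rfl hγ hη Ω R).2.trans hK1, fun ω => ?_⟩⟩
      have hN : ((1 : ℕ) : ℝ) ≤ 2 + G ^ 2 * ((K : ℝ) + 1) := by
        have : 0 ≤ G ^ 2 * ((K : ℝ) + 1) := by positivity
        push_cast
        linarith
      refine (R.totalCalls_le hN hK2 ω).trans ?_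
      rw [← mul_assoc]
      exact mul_le_mul_of_nonneg_right (le_max_right _ _) (by positivity)
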